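/- Let $\tau_2\in W_2^1[0,1]$ (continuous representative), $\tau_1,r_0\in L_2[0,1]$ be complex-valued, $\tau_0=r_0'$ (in the sense of distributions), and consider on $(0,1)$ the equation $$y^{(4)}+(\tau_2y')'+(\tau_1y)'+\tau_1y'+\tau_0y=\lambda y. \qquad (1)$$ Let $\sigma_0,\sigma_1\in W_2^1[0,1]$ be the unique functions with $\sigma_0''=\tau_0$, $\sigma_0(0)=\sigma_0(1)=0$, $\sigma_1'=\tau_1$, $\sigma_1(0)=0$, and let $$F=[f_{k,j}]_{k,j=1}^4=\begin{bmatrix}0&1&0&0\\-(\sigma_1+\sigma_0)&0&1&0\\0&-\tau_2+2\sigma_0&0&1\\\sigma_0^2-\sigma_1^2&0&\sigma_1-\sigma_0&0\end{bmatrix},\qquad y^{[0]}:=y,\quad y^{[k]}:=(y^{[k-1]})'-\sum_{j=1}^kf_{k,j}y^{[j-1]},\ k=1,\dots,4.$$ A solution of (1) is a function $y$ such that $y^{[0]},\dots,y^{[3]}$ are absolutely continuous on $[0,1]$ and $y^{[4]}=\lambda y$ a.e. on $(0,1)$. For $\kappa\in\{1,\dots,8\}$, $h>0$, $\rho^*>0$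 put $$\Gamma_\kappa=\{\rho\in\mathbb C:\tfrac{\pi(\kappa-1)}4<\arg\rho<\tfrac{\pi\kappa}4\},\qquad \Gamma_{\kappa,h,\rho^*}=\{\rho\in\mathbb C:\rho+he^{i\pi(\kappa-1/2)/4}\in\Gamma_\kappa,\ |\rho|>\rho^*\},$$ and denote by $\overline\Gamma_{\kappa,h,\rho^*}$ the closure of the latter. Let $\omega_1,\dots,\omega_4$ be the roots of $\omega^4=1$ numbered so that $\mathrm{Re}(\rho\omega_1)<\mathrm{Re}(\rho\omega_2)<\mathrm{Re}(\rho\omega_3)<\mathrm{Re}(\rho\omega_4)$ for $\rho\in\Gamma_\kappa$. Put $\Omega=[\omega_k^{j-1}]_{j,k=1}^4$, $$[a_{jk}]_{j,k=1}^4=\Omega^{-1}\begin{bmatrix}0&0&0&0\\-(\sigma_1+\sigma_0)&0&0&0\\0&-\tau_2+2\sigma_0&0&0\\0&0&\sigma_1-\sigma_0&0\end{bmatrix}\Omega,\qquad \tau_2^{\langle-1\rangle}(x)=\int_0^x\tau_2(t)\,dt,\quad \tau_2^{\langle-2\rangle}(x)=\int_0^x\tau_2(t)\tau_2^{\langle-1\rangle}(t)\,dt.$$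 A complex sequence $\{\rho_n\}_{n\ge1}$ is called non-condensing if $N(t):=\#\{n:|\rho_n|\le t\}$ is finite for all $t$ and $\sup_{t>0}(N(t+1)-N(t))<\infty$. **Theorem.** For every $\kappa\in\{1,\dots,8\}$ and $h>0$ there exists $\rho^*>0$ such that for all $\rho\in\overline\Gamma_{\kappa,h,\rho^*}$ equation (1) with $\lambda=\rho^4$ has a fundamental system of solutions (a basis of its space of solutions) $\{y_k(x,\rho)\}_{k=1}^4$ with the following properties. For $k=1,\dots,4$ and $j=0,\dots,3$ the quasi-derivative $y_k^{[j]}(x,\rho)$ is continuous in $(x,\rho)\in[0,1]\times\overline\Gamma_{\kappa,h,\rho^*}$, is analytic in $\rho\in\Gamma_{\kappa,h,\rho^*}$ for each fixed $x\in[0,1]$, and satisfies, for $x\in[0,1]$ and $\rho\in\overline\Gamma_{\kappa,h,\rho^*}$, $$y_k^{[j]}(x,\rho)=(\rho\omega_k)^je^{\rho\omega_kx}\Biggl(1-\frac{\tau_2^{\langle-1\rangle}(x)}{4\rho\omega_k}+\frac{\tau_2^{\langle-2\rangle}(x)}{(4\rho\omega_k)^2}-\sum_{l\ne k}\Bigl(\frac{\omega_l}{\omega_k}\Bigr)^j\frac{a_{lk}(x)}{\rho^2(\omega_l-\omega_k)}+\frac{\Upsilon_{kj}(x,\rho)}{\rho^2}\Biggr),$$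 where for each fixed $x\in[0,1]$ the remainder satisfies $\Upsilon_{kj}(x,\rho)\to0$ as $|\rho|\to\infty$, $\rho\in\overline\Gamma_{\kappa,h,\rho^*}$, and $\sum_n|\Upsilon_{kj}(x,\rho_n)|^2<\infty$ for every non-condensing sequence $\{\rho_n\}\subset\Gamma_{\kappa,h,\rho^*}$. -/

import Mathlib

open MeasureTheory Set

open scoped Topology

noncomputable section

namespace FourthOrder

/-- The space `L₂[0,1]`; only the values on `[0,1]` matter. -/
def IsL2 (f : ℝ → ℂ) : Prop :=
  MemLp f 2 (volume.restrict (Icc (0 : ℝ) 1))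

/-- The space `W₂¹[0,1]` (each class being identified with its continuous representative):
primitives of functions of `L₂[0,1]`. -/
def IsW12 (f : ℝ → ℂ) : Prop :=
  ∃ g : ℝ → ℂ, IsL2 g ∧ ∀ x ∈ Icc (0 : ℝ) 1, f x = f 0 + ∫ t in (0 : ℝ)..x, g t

/-- `σ₀`, the function of `W₂¹[0,1]` with `σ₀'' = τ₀ = r₀'` and `σ₀(0) = σ₀(1) = 0`:
its first derivative differs from `r₀` by a constant, which `σ₀(1) = 0` determines. -/
def sigma0 (r₀ : ℝ → ℂ) (x : ℝ) : ℂ :=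
  (∫ t in (0 : ℝ)..x, r₀ t) - (x : ℂ) * ∫ t in (0 : ℝ)..1, r₀ t

/-- `σ₁`, the function of `W₂¹[0,1]` with `σ₁' = τ₁` and `σ₁(0) = 0`. -/
def sigma1 (τ₁ : ℝ → ℂ) (x : ℝ) : ℂ :=
  ∫ t in (0 : ℝ)..x, τ₁ t

/-- The associated matrix `F(x)` of the differential expression
`y⁗ + (τ₂ y')' + (τ₁ y)' + τ₁ y' + r₀' y`. -/
def assocMatrix (τ₂ τ₁ r₀ : ℝ → ℂ) (x : ℝ) : Matrix (Fin 4) (Fin 4) ℂ :=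
  !![0, 1, 0, 0;
     -(sigma1 τ₁ x + sigma0 r₀ x), 0, 1, 0;
     0, -τ₂ x + 2 * sigma0 r₀ x, 0, 1;
     sigma0 r₀ x ^ 2 - sigma1 τ₁ x ^ 2, 0, sigma1 τ₁ x - sigma0 r₀ x, 0]

/-- The quasi-derivatives `y^[0], …, y^[4]` of `y` on `[0,1]` generated by `F`:
`y^[0] = y` and `y^[k] = (y^[k-1])' - ∑_{j=1}^{k} f_{k,j} y^[j-1]`.
The indices of `Fin 4` start from zero, so `f_{k,j}` is `F x (k-1) (j-1)`. -/
def quasiDeriv (F : ℝ → Matrix (Fin 4) (Fin 4) ℂ) (y : ℝ → ℂ) : ℕ → ℝ → ℂ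
  | 0 => y
  | 1 => fun x => derivWithin (quasiDeriv F y 0) (Icc 0 1) x
      - F x 0 0 * quasiDeriv F y 0 x
  | 2 => fun x => derivWithin (quasiDeriv F y 1) (Icc 0 1) x
      - (F x 1 0 * quasiDeriv F y 0 x + F x 1 1 * quasiDeriv F y 1 x)
  | 3 => fun x => derivWithin (quasiDeriv F y 2) (Icc 0 1) x
      - (F x 2 0 * quasiDeriv F y 0 x + F x 2 1 * quasiDeriv F y 1 x
        + F x 2 2 * quasiDeriv F y 2 x)
  | 4 => fun x => derivWithin (quasiDeriv F y 3) (Icc 0 1) x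
      - (F x 3 0 * quasiDeriv F y 0 x + F x 3 1 * quasiDeriv F y 1 x
        + F x 3 2 * quasiDeriv F y 2 x + F x 3 3 * quasiDeriv F y 3 x)
  | _ + 5 => 0

/-- `y` solves the regularized equation `y^[4] = μ y` on `(0,1)`: `y` lies in the domain
(`y^[0], …, y^[3]` are absolutely continuous on `[0,1]`) and the equation holds almost
everywhere. -/
def IsSolution (F : ℝ → Matrix (Fin 4) (Fin 4) ℂ) (μ : ℂ) (y : ℝ → ℂ) : Prop :=
  (∀ j < 4, AbsolutelyContinuousOnInterval (quasiDeriv F y j) 0 1) ∧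
    ∀ᵐ x ∂(volume.restrict (Icc (0 : ℝ) 1)), quasiDeriv F y 4 x = μ * y x

/-- A fundamental system of solutions: solutions that, as functions on `[0,1]`, are linearly
independent and span the space of all solutions. -/
def IsFundamentalSystem (F : ℝ → Matrix (Fin 4) (Fin 4) ℂ) (μ : ℂ)
    (y : Fin 4 → ℝ → ℂ) : Prop :=
  (∀ k, IsSolution F μ (y k)) ∧
  (∀ c : Fin 4 → ℂ, (∀ x ∈ Icc (0 : ℝ) 1, ∑ k, c k * y k x = 0) → c = 0) ∧
  (∀ z, IsSolution F μ z →
    ∃ c : Fin 4 → ℂ, ∀ x ∈ Icc (0 : ℝ) 1, z x = ∑ k, c k * y k x)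

/-- The open sector `π(κ-1)/4 < arg ρ < πκ/4`. -/
def sector (κ : ℕ) : Set ℂ :=
  {ρ | ∃ r θ : ℝ, 0 < r ∧ Real.pi * ((κ : ℝ) - 1) / 4 < θ ∧ θ < Real.pi * (κ : ℝ) / 4 ∧
    ρ = (r : ℂ) * Complex.exp (Complex.I * (θ : ℂ))}

/-- The extended sector `Γ_{κ,h,ρ*}`: the sector shifted by `h` along its bisector,
away from the sector, without a disk. -/
def extSector (κ : ℕ) (h ρs : ℝ) : Set ℂ :=
  {ρ | ρ + (h : ℂ) * Complex.exp (Complex.I * (Real.pi : ℂ) * ((κ : ℂ) - 1 / 2) / 4) ∈ sector κ ∧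
    ρs < ‖ρ‖}

/-- `ω` lists the roots of `ω⁴ = 1` in the order of increasing `Re (ρ ω_k)`, `ρ ∈ Γ_κ`. -/
def IsRootOrdering (κ : ℕ) (ω : Fin 4 → ℂ) : Prop :=
  (∀ k, ω k ^ 4 = 1) ∧ ∀ ρ ∈ sector κ, StrictMono fun k => (ρ * ω k).re

/-- `Ω = [ω_k^{j-1}]_{j,k=1}^4`. -/
def omegaMatrix (ω : Fin 4 → ℂ) : Matrix (Fin 4) (Fin 4) ℂ :=
  Matrix.of fun j k => ω k ^ (j : ℕ)

/-- The matrix `A_(2)(x) = [a_{jk}(x)]`. -/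
def matrixA2 (ω : Fin 4 → ℂ) (τ₂ τ₁ r₀ : ℝ → ℂ) (x : ℝ) : Matrix (Fin 4) (Fin 4) ℂ :=
  (omegaMatrix ω)⁻¹ *
    !![0, 0, 0, 0;
       -(sigma1 τ₁ x + sigma0 r₀ x), 0, 0, 0;
       0, -τ₂ x + 2 * sigma0 r₀ x, 0, 0;
       0, 0, sigma1 τ₁ x - sigma0 r₀ x, 0] * omegaMatrix ω

/-- `τ₂^⟨-1⟩(x) = ∫₀ˣ τ₂(t) dt`. -/
def primOne (τ₂ : ℝ → ℂ) (x : ℝ) : ℂ :=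
  ∫ t in (0 : ℝ)..x, τ₂ t

/-- `τ₂^⟨-2⟩(x) = ∫₀ˣ τ₂(t) τ₂^⟨-1⟩(t) dt`. -/
def primTwo (τ₂ : ℝ → ℂ) (x : ℝ) : ℂ :=
  ∫ t in (0 : ℝ)..x, τ₂ t * primOne τ₂ t

/-- Non-condensing sequences: the counting function `N(t) = #{n : |ρ_n| ≤ t}` is finite and
`N(t+1) - N(t)` is bounded over `t > 0`. -/
def NonCondensing (ρ : ℕ → ℂ) : Prop :=
  (∀ t : ℝ, {n | ‖ρ n‖ ≤ t}.Finite) ∧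
    ∃ K : ℕ, ∀ t : ℝ, 0 < t → {n | ‖ρ n‖ ≤ t + 1}.ncard ≤ {n | ‖ρ n‖ ≤ t}.ncard + K

/-- The class of remainders `Υ(ρ)` on the set `Γ`: they tend to zero as `|ρ| → ∞` in the closure
of `Γ` and are square-summable along every non-condensing sequence in `Γ`. -/
def IsUpsilon (Γ : Set ℂ) (Υ : ℂ → ℂ) : Prop :=
  Filter.Tendsto Υ (Bornology.cobounded ℂ ⊓ Filter.principal (closure Γ)) (𝓝 0) ∧
    ∀ ρ : ℕ → ℂ, (∀ n, ρ n ∈ Γ) → NonCondensing ρ → Summable fun n => ‖Υ (ρ n)‖ ^ 2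

end FourthOrder

end

/-!
The equation is equivalent to the first-order system `Y' = (F + ρ⁴ E₄₁) Y` for the vector of
quasi-derivatives. The substitution `Y = e^{ρ ω_k x} diag(1, ρ, ρ², ρ³) Ω U` turns it into
`U_l' = ρ (ω_l - ω_k) U_l + ∑_j (ρ⁻¹ a_{lj} + ρ⁻³ b_{lj}) U_j` with continuous coefficients, where
`[a_{lj}]` is the matrix of the theorem and `a_{lj} ∈ W₂¹` (`isSystemSolution_birkhoffVector`).

*Existence.* The variation-of-constants form of the `l`-th equation is integrated from `0` if `l ≤ k`
and from `1` if `l > k`. Then the exponentials `e^{ρ (ω_l - ω_k)(x - t)}` are bounded uniformly on the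
extended sector, because the ordering of the roots holds there up to an additive constant. The kernels
are `O(ρ⁻¹)`, and successive approximations converge for large `ρ` to functions that are continuous in
`(x, ρ)` and analytic in `ρ` (`exists_isIntegralSolution`). All this is done on an open region that
contains the closure of the extended sector (`closure_extSector_subset`).

*Asymptotics.* The initial values at the base points are chosen so that, after one integration by parts,
no boundary terms remain there, and for `l ≠ k` one gets, up to `O(ρ⁻³)`,
`U_l = ρ⁻² (∫ e^{ρ (ω_l - ω_k)(x - t)} a_{lk}'(t) dt - a_{lk}(x)) / (ω_l - ω_k)`.
Iterating the `k`-th equation twice gives `U_k = 1 + ρ⁻¹ ∫ a_{kk} + ρ⁻² ∫ a_{kk} ∫ a_{kk} + O(ρ⁻³)`, where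
`a_{kk} = -τ₂ / (4 ω_k)` (`IsIntegralSolution.asymptotics`). Hence `Υ_{kj}` is a linear combination of the
exponential integrals of `a_{lk}' ∈ L₂` and of a term `O(ρ⁻¹)`.

*Square-summability.* Both kinds of terms are square-summable along sequences with a bounded number of
moduli in each unit interval. For the exponential integrals this is a Bessel-type inequality: by duality
it reduces to a bound for the Gram matrix of two-sided exponentials, whose entries are values of the
Cauchy kernel (`sum_norm_sq_integral_twoSidedExp_le`). It holds on the whole region, boundary included,
and convergence to zero follows from it, since otherwise a sparse sequence would contradict it
(`SqSummableOn.tendsto_zero`).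

*Fundamental system.* At `x = 0` the matrix of the amplitudes is near the identity and `Ω` is invertible,
so the four initial vectors are independent. Any solution of the equation has continuously differentiable
quasi-derivatives, because an absolutely continuous function whose derivative equals a continuous
function almost everywhere is continuously differentiable; so it solves the first-order system and is determined by its
initial vector (`isFundamentalSystem_of_independent`).
-/

noncomputable section

namespace FourthOrder

/-! ### Estimates for two-sided exponentials -/

/-- A Schur-type bound for the Cauchy kernel `Q_{nm}` whose height `s n + s m` depends on both points.
Only the row sums of the one-point kernel `P_{nm} = s_n / (s_n² + (r_n - r_m)²)` are bounded by `L`,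
its column sums need not be. Therefore the form `X = ⟨Qc, c⟩` is estimated through `D = Pᵀc`:
`X ≤ 4 ⟨c, D⟩`, while `P_{nm} P_{n'm} ≤ Q_{nn'} (P_{nm} + P_{n'm})` gives `‖D‖² ≤ 2 L X`. -/
lemma sum_sum_cauchy_le {ι : Type*} (S : Finset ι) (c s r : ι → ℝ) (hc : ∀ n, 0 ≤ c n)
    (hs : ∀ n, 1 ≤ s n) {L : ℝ} (hL0 : 0 < L)
    (hL : ∀ n ∈ S, ∑ m ∈ S, s n / (s n ^ 2 + (r n - r m) ^ 2) ≤ L) :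
    ∑ n ∈ S, ∑ m ∈ S, c n * c m * ((s n + s m) / ((s n + s m) ^ 2 + (r n - r m) ^ 2))
      ≤ 32 * L * ∑ n ∈ S, c n ^ 2 := by
  set P : ι → ι → ℝ := fun n m => s n / (s n ^ 2 + (r n - r m) ^ 2) with hP
  set Q : ι → ι → ℝ := fun n m => (s n + s m) / ((s n + s m) ^ 2 + (r n - r m) ^ 2) with hQ
  have hs0 : ∀ n, 0 < s n := fun n => lt_of_lt_of_le one_pos (hs n)
  have hP0 : ∀ n m, 0 < P n m := fun n m => by
    have := hs0 n
    simp only [hP]; positivity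
  have hQ0 : ∀ n m, 0 < Q n m := fun n m => by
    have := hs0 n
    have := hs0 m
    simp only [hQ]; positivity
  set D : ι → ℝ := fun m => ∑ n ∈ S, c n * P n m with hD
  set X : ℝ := ∑ n ∈ S, ∑ m ∈ S, c n * c m * Q n m with hX
  have hQP : ∀ n m, Q n m ≤ 2 * (P n m + P m n) := by
    intro n m
    have h1 := hs0 n
    have h2 := hs0 m
    have key : ∀ a b u : ℝ, 0 < a → 0 < b → b ≤ a →
        (a + b) / ((a + b) ^ 2 + u ^ 2) ≤ 2 * (a / (a ^ 2 + u ^ 2)) := by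
      intro a b u ha hb hab
      rw [← mul_div_assoc]
      have : 0 ≤ u ^ 2 := sq_nonneg u
      apply div_le_div₀ (by linarith) (by linarith) (by positivity)
      nlinarith
    rcases le_total (s m) (s n) with h | h
    · have := key _ _ (r n - r m) h1 h2 h
      have h3 := hP0 m n
      simp only [hQ, hP] at *
      linarith
    · have := key _ _ (r m - r n) h2 h1 h
      have h3 := hP0 n m
      simp only [hQ, hP] at *
      rw [show (r n - r m) ^ 2 = (r m - r n) ^ 2 by ring, add_comm (s n)]
      rw [show (r n - r m) ^ 2 = (r m - r n) ^ 2 by ring] at h3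
      linarith
  have h1 : X ≤ 4 * ∑ m ∈ S, c m * D m := by
    have e1 : ∑ n ∈ S, ∑ m ∈ S, c n * c m * P n m = ∑ m ∈ S, c m * D m := by
      rw [Finset.sum_comm]
      refine Finset.sum_congr rfl fun m _ => ?_
      rw [hD, Finset.mul_sum]
      exact Finset.sum_congr rfl fun n _ => by ring
    have e2 : ∑ n ∈ S, ∑ m ∈ S, c n * c m * P m n = ∑ m ∈ S, c m * D m := by
      refine Finset.sum_congr rfl fun m _ => ?_
      rw [hD, Finset.mul_sum]
      exact Finset.sum_congr rfl fun n _ => by ring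
    calc X ≤ ∑ n ∈ S, ∑ m ∈ S, (2 * (c n * c m * P n m) + 2 * (c n * c m * P m n)) := by
          refine Finset.sum_le_sum fun n _ => Finset.sum_le_sum fun m _ => ?_
          have := mul_le_mul_of_nonneg_left (hQP n m) (mul_nonneg (hc n) (hc m))
          linarith
      _ = 4 * ∑ m ∈ S, c m * D m := by
          simp only [Finset.sum_add_distrib, ← Finset.mul_sum, e1, e2]
          ring
  -- `P_a(u) P_b(v) ≤ Q_{a+b}(u+v) (P_a(u) + P_b(v))`, a form of the Cauchy–Schwarz inequality
  have hPP : ∀ n n' m, P n m * P n' m ≤ Q n n' * (P n m + P n' m) := by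
    intro n n' m
    have key : ∀ a b u v : ℝ, 0 < a → 0 < b →
        a / (a ^ 2 + u ^ 2) * (b / (b ^ 2 + v ^ 2)) ≤
          (a + b) / ((a + b) ^ 2 + (u - v) ^ 2) * (a / (a ^ 2 + u ^ 2) + b / (b ^ 2 + v ^ 2)) := by
      intro a b u v ha hb
      have hA : 0 < a ^ 2 + u ^ 2 := by positivity
      have hB : 0 < b ^ 2 + v ^ 2 := by positivity
      have hC : 0 < (a + b) ^ 2 + (u - v) ^ 2 := by positivity
      rw [div_add_div _ _ hA.ne' hB.ne', div_mul_div_comm, div_mul_div_comm,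
        div_le_div_iff₀ (by positivity) (by positivity)]
      have : a * b * ((a + b) ^ 2 + (u - v) ^ 2) ≤
          (a + b) * (a * (b ^ 2 + v ^ 2) + (a ^ 2 + u ^ 2) * b) := by
        nlinarith [sq_nonneg (a * v + b * u)]
      calc _ = (a * b * ((a + b) ^ 2 + (u - v) ^ 2)) * ((a ^ 2 + u ^ 2) * (b ^ 2 + v ^ 2)) := by
            ring
        _ ≤ ((a + b) * (a * (b ^ 2 + v ^ 2) + (a ^ 2 + u ^ 2) * b)) *
            ((a ^ 2 + u ^ 2) * (b ^ 2 + v ^ 2)) := by gcongr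
        _ = _ := by ring
    have := key (s n) (s n') (r n - r m) (r n' - r m) (hs0 n) (hs0 n')
    rwa [show r n - r m - (r n' - r m) = r n - r n' by ring] at this
  have h2 : ∑ m ∈ S, D m ^ 2 ≤ 2 * L * X := by
    have e : ∑ m ∈ S, D m ^ 2 = ∑ n ∈ S, ∑ n' ∈ S, c n * c n' * ∑ m ∈ S, P n m * P n' m := by
      have e1 : ∀ m, D m ^ 2 = ∑ n ∈ S, ∑ n' ∈ S, c n * c n' * (P n m * P n' m) := by
        intro m
        rw [sq, hD, Finset.sum_mul_sum]
        exact Finset.sum_congr rfl fun n _ => Finset.sum_congr rfl fun n' _ => by ring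
      simp only [e1, Finset.mul_sum]
      rw [Finset.sum_comm]
      exact Finset.sum_congr rfl fun n _ => Finset.sum_comm
    rw [e, hX, Finset.mul_sum]
    refine Finset.sum_le_sum fun n hn => ?_
    rw [Finset.mul_sum]
    refine Finset.sum_le_sum fun n' hn' => ?_
    have : ∑ m ∈ S, P n m * P n' m ≤ Q n n' * (2 * L) := by
      calc _ ≤ ∑ m ∈ S, Q n n' * (P n m + P n' m) := Finset.sum_le_sum fun m _ => hPP n n' m
        _ = Q n n' * (∑ m ∈ S, P n m + ∑ m ∈ S, P n' m) := by
            rw [← Finset.mul_sum, Finset.sum_add_distrib]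
        _ ≤ _ := by
            have := hL n hn
            have := hL n' hn'
            have := (hQ0 n n').le
            gcongr
            linarith
    have := mul_le_mul_of_nonneg_left this (mul_nonneg (hc n) (hc n'))
    linarith
  have h3 : 4 * ∑ m ∈ S, c m * D m ≤
      (1 / (4 * L)) * ∑ m ∈ S, D m ^ 2 + 16 * L * ∑ m ∈ S, c m ^ 2 := by
    rw [Finset.mul_sum, Finset.mul_sum, Finset.mul_sum, ← Finset.sum_add_distrib]
    refine Finset.sum_le_sum fun m _ => ?_
    have e : (1 / (4 * L)) * D m ^ 2 + 16 * L * c m ^ 2 - 4 * (c m * D m)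
        = (1 / (4 * L)) * (D m - 8 * L * c m) ^ 2 := by
      field_simp
      ring
    have : 0 ≤ (1 / (4 * L)) * (D m - 8 * L * c m) ^ 2 := by positivity
    linarith
  have h4 : (1 / (4 * L)) * ∑ m ∈ S, D m ^ 2 ≤ X / 2 := by
    calc _ ≤ (1 / (4 * L)) * (2 * L * X) := by gcongr
      _ = X / 2 := by field_simp; ring
  linarith

lemma sum_range_cauchy_le (s : ℝ) (hs : 1 ≤ s) (N : ℕ) :
    ∑ i ∈ Finset.range N, s / (s ^ 2 + (i : ℝ) ^ 2) ≤ 3 := by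
  -- the terms are dominated by the differences of the telescoping sequence `2 s / (s + n)`
  have h : ∀ n : ℕ, ∑ i ∈ Finset.range (n + 1), s / (s ^ 2 + (i : ℝ) ^ 2) ≤ 3 - 2 * s / (s + n) := by
    intro n
    have hs0 : 0 < s := by linarith
    induction n with
    | zero =>
      simp only [zero_add, Finset.sum_range_one, Nat.cast_zero]
      rw [add_zero, mul_div_assoc, div_self hs0.ne', show s / (s ^ 2 + 0 ^ 2) = 1 / s by
        field_simp; simp]
      have : 1 / s ≤ 1 := by rw [div_le_one hs0]; exact hs
      linarith
    | succ n ih =>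
      rw [Finset.sum_range_succ]
      have h1 : s / (s ^ 2 + ((n + 1 : ℕ) : ℝ) ^ 2) ≤ 2 * s / (s + n) - 2 * s / (s + (n + 1 : ℕ)) := by
        push_cast
        have hn : (0 : ℝ) ≤ n := Nat.cast_nonneg n
        rw [div_sub_div _ _ (by positivity) (by positivity),
          div_le_div_iff₀ (by positivity) (by positivity)]
        have e : 2 * s * (s + (n + 1 : ℝ)) - (s + n) * (2 * s) = 2 * s := by ring
        rw [e]
        have : (s + n) * (s + (n + 1 : ℝ)) ≤ 2 * (s ^ 2 + (n + 1 : ℝ) ^ 2) := by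
          nlinarith [sq_nonneg (s - (n + 1))]
        nlinarith
      linarith
  rcases N with _ | n
  · simp
  · have := h n
    have h2 : 0 ≤ 2 * s / (s + n) := by positivity
    linarith

/-- A sum of the Cauchy kernel over points of which every unit interval contains at most `K`. -/
lemma sum_cauchy_le {ι : Type*} (S : Finset ι) (r : ι → ℝ) (K : ℕ)
    (hK : ∀ t : ℝ, (S.filter fun n => r n ∈ Ico t (t + 1)).card ≤ K) (s : ℝ) (hs : 1 ≤ s)
    (x : ℝ) : ∑ n ∈ S, s / (s ^ 2 + (x - r n) ^ 2) ≤ 9 * K := by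
  classical
  set f : ι → ℕ := fun n => ⌊|x - r n|⌋₊ with hf
  obtain ⟨N, hN⟩ : ∃ N, ∀ n ∈ S, f n < N :=
    ⟨S.sup f + 1, fun n hn => Nat.lt_succ_of_le (Finset.le_sup hn)⟩
  have hs0 : 0 < s := by linarith
  have hcard : ∀ i : ℕ, (S.filter fun n => f n = i).card ≤ 3 * K := by
    intro i
    have hsub : (S.filter fun n => f n = i) ⊆
        (S.filter fun n => r n ∈ Ico (x + i) (x + i + 1)) ∪
        ((S.filter fun n => r n ∈ Ico (x - i - 1) (x - i - 1 + 1)) ∪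
        (S.filter fun n => r n ∈ Ico (x - i) (x - i + 1))) := by
      intro n hn
      simp only [Finset.mem_filter, Finset.mem_union, mem_Ico] at hn ⊢
      obtain ⟨hnS, hn⟩ := hn
      have h1 : (i : ℝ) ≤ |x - r n| := hn ▸ Nat.floor_le (abs_nonneg _)
      have h2 : |x - r n| < i + 1 := by
        have := Nat.lt_floor_add_one |x - r n|
        rw [← hn]; exact this
      rcases abs_cases (x - r n) with ⟨h3, h4⟩ | ⟨h3, h4⟩
      · by_cases h5 : r n < x - i
        · exact Or.inr (Or.inl ⟨hnS, by linarith, by linarith⟩)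
        · exact Or.inr (Or.inr ⟨hnS, by linarith, by linarith⟩)
      · exact Or.inl ⟨hnS, by linarith, by linarith⟩
    have := (Finset.card_le_card hsub).trans (Finset.card_union_le _ _)
    have h2 := Finset.card_union_le (S.filter fun n => r n ∈ Ico (x - i - 1) (x - i - 1 + 1))
        (S.filter fun n => r n ∈ Ico (x - i) (x - i + 1))
    have := hK (x + i)
    have := hK (x - i - 1)
    have := hK (x - i)
    omega
  calc ∑ n ∈ S, s / (s ^ 2 + (x - r n) ^ 2)
      ≤ ∑ n ∈ S, s / (s ^ 2 + (f n : ℝ) ^ 2) := by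
        refine Finset.sum_le_sum fun n _ => ?_
        have : (f n : ℝ) ^ 2 ≤ (x - r n) ^ 2 := by
          rw [← sq_abs (x - r n)]
          exact pow_le_pow_left₀ (Nat.cast_nonneg _) (Nat.floor_le (abs_nonneg _)) 2
        gcongr
    _ = ∑ i ∈ Finset.range N, ∑ n ∈ S with f n = i, s / (s ^ 2 + (f n : ℝ) ^ 2) :=
        (Finset.sum_fiberwise_of_maps_to (fun n hn => Finset.mem_range.2 (hN n hn)) _).symm
    _ ≤ ∑ i ∈ Finset.range N, (3 * K) * (s / (s ^ 2 + (i : ℝ) ^ 2)) := by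
        refine Finset.sum_le_sum fun i _ => ?_
        calc _ = ∑ n ∈ S with f n = i, s / (s ^ 2 + (i : ℝ) ^ 2) :=
              Finset.sum_congr rfl fun n hn => by rw [(Finset.mem_filter.1 hn).2]
          _ = ((S.filter fun n => f n = i).card : ℝ) * (s / (s ^ 2 + (i : ℝ) ^ 2)) := by
              rw [Finset.sum_const, nsmul_eq_mul]
          _ ≤ _ := by
              gcongr
              exact_mod_cast hcard i
    _ ≤ (3 * K) * 3 := by
        rw [← Finset.mul_sum]
        gcongr
        exact sum_range_cauchy_le s hs N
    _ = 9 * K := by ring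

/-- The exponential `t ↦ exp (-s |t - x| + i τ (t - x))`, two-sided and integrable for `s > 0`. -/
def twoSidedExp (x s τ t : ℝ) : ℂ :=
  Complex.exp (-(s : ℂ) * (|t - x| : ℝ) + Complex.I * τ * ((t - x : ℝ) : ℂ))

lemma continuous_twoSidedExp (x s τ : ℝ) : Continuous (twoSidedExp x s τ) := by
  unfold twoSidedExp
  fun_prop

lemma twoSidedExp_mul_conj (x s τ s' τ' t : ℝ) :
    twoSidedExp x s τ t * (starRingEnd ℂ) (twoSidedExp x s' τ' t)
      = twoSidedExp x (s + s') (τ - τ') t := by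
  unfold twoSidedExp
  rw [← Complex.exp_conj, ← Complex.exp_add]
  congr 1
  simp only [map_add, map_mul, map_neg, Complex.conj_ofReal, Complex.conj_I]
  push_cast
  ring

lemma integrable_twoSidedExp (x : ℝ) {s : ℝ} (hs : 0 < s) (τ : ℝ) :
    Integrable (twoSidedExp x s τ) ∧
      ∫ t, twoSidedExp x s τ t = ((2 * s / (s ^ 2 + τ ^ 2) : ℝ) : ℂ) := by
  set f : ℝ → ℂ := fun t => Complex.exp (-(s : ℂ) * (|t| : ℝ) + Complex.I * τ * (t : ℂ)) with hf
  have e : twoSidedExp x s τ = fun t => f (t - x) := rfl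
  have h1 : ∀ t ∈ Iic (0 : ℝ), f t = Complex.exp (((s : ℂ) + Complex.I * τ) * t) := by
    intro t ht
    simp only [hf, abs_of_nonpos (mem_Iic.1 ht)]
    congr 1; push_cast; ring
  have h2 : ∀ t ∈ Ioi (0 : ℝ), f t = Complex.exp ((-(s : ℂ) + Complex.I * τ) * t) := by
    intro t ht
    simp only [hf, abs_of_pos (mem_Ioi.1 ht)]
    congr 1; ring
  have r1 : 0 < ((s : ℂ) + Complex.I * τ).re := by simpa using hs
  have r2 : (-(s : ℂ) + Complex.I * τ).re < 0 := by simpa using hs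
  have i1 : IntegrableOn f (Iic 0) :=
    (integrableOn_exp_mul_complex_Iic r1 0).congr_fun (fun t ht => (h1 t ht).symm)
      measurableSet_Iic
  have i2 : IntegrableOn f (Ioi 0) :=
    (integrableOn_exp_mul_complex_Ioi r2 0).congr_fun (fun t ht => (h2 t ht).symm)
      measurableSet_Ioi
  have i3 : Integrable f := by
    rw [← integrableOn_univ, ← Iic_union_Ioi (a := (0 : ℝ))]
    exact i1.union i2
  refine ⟨by rw [e]; exact i3.comp_sub_right x, ?_⟩
  rw [e, integral_sub_right_eq_self f x, ← intervalIntegral.integral_Iic_add_Ioi i1 i2,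
    setIntegral_congr_fun measurableSet_Iic h1, setIntegral_congr_fun measurableSet_Ioi h2,
    integral_exp_mul_complex_Iic r1, integral_exp_mul_complex_Ioi r2]
  have n1 : (s : ℂ) + Complex.I * τ ≠ 0 := fun h => by rw [h] at r1; simp at r1
  have n2 : -(s : ℂ) + Complex.I * τ ≠ 0 := fun h => by rw [h] at r2; simp at r2
  have n3 : (s : ℂ) ^ 2 + (τ : ℂ) ^ 2 ≠ 0 := by
    have : (s ^ 2 + τ ^ 2 : ℝ) ≠ 0 := by positivity
    exact_mod_cast this
  push_cast
  simp only [mul_zero, Complex.exp_zero]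
  rw [div_add_div _ _ n1 n2, div_eq_div_iff (mul_ne_zero n1 n2) n3]
  ring_nf
  simp only [Complex.I_sq]
  ring

/-- A Bessel-type inequality for two-sided exponentials: by duality it follows from a bound for the
Gram matrix, whose entries are values of the Cauchy kernel at variable heights. The points `r n`
stand in for the frequencies `τ n`, whose separation is at least comparable up to the factor `M`. -/
lemma sum_norm_sq_integral_twoSidedExp_le {ι : Type*} (S : Finset ι) (x : ℝ) (s τ r : ι → ℝ)
    (hs : ∀ n, 1 ≤ s n) {M L : ℝ} (hM : 0 < M) (hL0 : 0 < L)
    (hr : ∀ n m, (s n + s m) ^ 2 + (r n - r m) ^ 2 ≤ M * ((s n + s m) ^ 2 + (τ n - τ m) ^ 2))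
    (hL : ∀ n ∈ S, ∑ m ∈ S, s n / (s n ^ 2 + (r n - r m) ^ 2) ≤ L)
    {E : Set ℝ} {g : ℝ → ℂ} (hg : MemLp g 2 (volume.restrict E)) :
    ∑ n ∈ S, ‖∫ t in E, twoSidedExp x (s n) (τ n) t * g t‖ ^ 2
      ≤ 64 * M * L * ∫ t in E, ‖g t‖ ^ 2 := by
  have hs0 : ∀ n, 0 < s n := fun n => lt_of_lt_of_le one_pos (hs n)
  set G : ι → ℂ := fun n => ∫ t in E, twoSidedExp x (s n) (τ n) t * g t with hG
  set c : ι → ℂ := fun n => (starRingEnd ℂ) (G n) with hc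
  set h : ℝ → ℂ := fun t => ∑ n ∈ S, c n * twoSidedExp x (s n) (τ n) t with hh
  set T : ℝ := ∑ n ∈ S, ‖G n‖ ^ 2 with hT
  set K : ℝ := 64 * M * L with hK
  have hK0 : 0 < K := by positivity
  have hcont : Continuous h := by
    simp only [hh]
    exact continuous_finsetSum _ fun n _ => continuous_const.mul (continuous_twoSidedExp _ _ _)
  have hsq : ∀ t, ((‖h t‖ ^ 2 : ℝ) : ℂ) = ∑ n ∈ S, ∑ m ∈ S,
      c n * (starRingEnd ℂ) (c m) * twoSidedExp x (s n + s m) (τ n - τ m) t := by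
    intro t
    rw [Complex.ofReal_pow, ← Complex.mul_conj', hh]
    simp only [map_sum, Finset.sum_mul_sum, map_mul]
    refine Finset.sum_congr rfl fun n _ => Finset.sum_congr rfl fun m _ => ?_
    rw [← twoSidedExp_mul_conj]
    ring
  have hint : ∀ n m, Integrable (fun t =>
      c n * (starRingEnd ℂ) (c m) * twoSidedExp x (s n + s m) (τ n - τ m) t) := fun n m =>
    (integrable_twoSidedExp x (add_pos (hs0 n) (hs0 m)) _).1.const_mul _
  have hIsq : Integrable fun t => ((‖h t‖ ^ 2 : ℝ) : ℂ) := by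
    simp only [hsq]
    exact integrable_finsetSum _ fun n _ => integrable_finsetSum _ fun m _ => hint n m
  have hIsqR : Integrable fun t => ‖h t‖ ^ 2 := by
    refine hIsq.norm.congr (Filter.Eventually.of_forall fun t => ?_)
    simp only [Complex.norm_real, Real.norm_of_nonneg (sq_nonneg ‖h t‖)]
  have hnormh : ∫ t, ‖h t‖ ^ 2 ≤ K * T := by
    have e : ((∫ t, ‖h t‖ ^ 2 : ℝ) : ℂ) = ∑ n ∈ S, ∑ m ∈ S, c n * (starRingEnd ℂ) (c m) *
        ((2 * (s n + s m) / ((s n + s m) ^ 2 + (τ n - τ m) ^ 2) : ℝ) : ℂ) := by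
      rw [← integral_complex_ofReal]
      simp only [hsq]
      rw [integral_finsetSum _ fun n _ => integrable_finsetSum _ fun m _ => hint n m]
      refine Finset.sum_congr rfl fun n _ => ?_
      rw [integral_finsetSum _ fun m _ => hint n m]
      refine Finset.sum_congr rfl fun m _ => ?_
      rw [integral_const_mul, (integrable_twoSidedExp x (add_pos (hs0 n) (hs0 m)) _).2]
    have e2 : ∫ t, ‖h t‖ ^ 2 = ‖((∫ t, ‖h t‖ ^ 2 : ℝ) : ℂ)‖ := by
      rw [Complex.norm_real, Real.norm_of_nonneg (integral_nonneg fun t => by positivity)]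
    rw [e2, e]
    calc _ ≤ ∑ n ∈ S, ∑ m ∈ S, 2 * M * (‖c n‖ * ‖c m‖ *
          ((s n + s m) / ((s n + s m) ^ 2 + (r n - r m) ^ 2))) := by
          refine (norm_sum_le _ _).trans (Finset.sum_le_sum fun n _ => ?_)
          refine (norm_sum_le _ _).trans (Finset.sum_le_sum fun m _ => ?_)
          have h1 := hs0 n
          have h2 := hs0 m
          rw [norm_mul, norm_mul, RCLike.norm_conj (c m), Complex.norm_real,
            Real.norm_of_nonneg (by positivity)]
          have : 2 * (s n + s m) / ((s n + s m) ^ 2 + (τ n - τ m) ^ 2) ≤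
              2 * M * ((s n + s m) / ((s n + s m) ^ 2 + (r n - r m) ^ 2)) := by
            rw [← mul_div_assoc, div_le_div_iff₀ (by positivity) (by positivity)]
            have := mul_le_mul_of_nonneg_left (hr n m) (show 0 ≤ 2 * (s n + s m) by positivity)
            linarith
          calc _ ≤ ‖c n‖ * ‖c m‖ * (2 * M * ((s n + s m) / ((s n + s m) ^ 2 + (r n - r m) ^ 2))) := by
                gcongr
            _ = _ := by ring
      _ = 2 * M * ∑ n ∈ S, ∑ m ∈ S, ‖c n‖ * ‖c m‖ *
          ((s n + s m) / ((s n + s m) ^ 2 + (r n - r m) ^ 2)) := by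
          simp only [← Finset.mul_sum]
      _ ≤ 2 * M * (32 * L * ∑ n ∈ S, ‖c n‖ ^ 2) := by
          gcongr
          exact sum_sum_cauchy_le S _ s r (fun n => norm_nonneg _) hs hL0 hL
      _ = K * T := by
          simp only [hc, RCLike.norm_conj, hK, hT]
          ring
  have hLp : ∀ n, MemLp (twoSidedExp x (s n) (τ n)) 2 (volume.restrict E) := by
    intro n
    refine MemLp.restrict _ ?_
    rw [memLp_two_iff_integrable_sq_norm (continuous_twoSidedExp _ _ _).aestronglyMeasurable]
    have h1 := (integrable_twoSidedExp x (add_pos (hs0 n) (hs0 n)) (τ n - τ n)).1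
    refine h1.norm.congr (Filter.Eventually.of_forall fun t => ?_)
    beta_reduce
    rw [← twoSidedExp_mul_conj, norm_mul, RCLike.norm_conj, sq]
  have hmul : ∀ n, IntegrableOn (fun t => twoSidedExp x (s n) (τ n) t * g t) E := fun n =>
    (hLp n).integrable_mul hg
  have hg2 : IntegrableOn (fun t => ‖g t‖ ^ 2) E :=
    (memLp_two_iff_integrable_sq_norm hg.1).1 hg
  -- duality: testing against `c = conj G` gives the sum of squares
  have hdual : (T : ℂ) = ∫ t in E, h t * g t := by
    have : ∀ t, h t * g t = ∑ n ∈ S, c n * (twoSidedExp x (s n) (τ n) t * g t) := by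
      intro t
      rw [hh, Finset.sum_mul]
      exact Finset.sum_congr rfl fun n _ => by ring
    simp only [this]
    rw [integral_finsetSum _ fun n _ => (hmul n).const_mul _]
    simp only [integral_const_mul]
    rw [hT]
    push_cast
    refine Finset.sum_congr rfl fun n _ => ?_
    rw [← Complex.conj_mul']
  have hle : T ≤ ∫ t in E, (K / 2 * ‖g t‖ ^ 2 + 1 / (2 * K) * ‖h t‖ ^ 2) := by
    have h0 : T = ‖(T : ℂ)‖ := by
      rw [Complex.norm_real, Real.norm_of_nonneg (by positivity)]
    rw [h0, hdual]
    refine norm_integral_le_of_norm_le ((hg2.const_mul _).add (hIsqR.integrableOn.const_mul _))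
      (Filter.Eventually.of_forall fun t => ?_)
    rw [norm_mul]
    have e : K / 2 * ‖g t‖ ^ 2 + 1 / (2 * K) * ‖h t‖ ^ 2 - ‖h t‖ * ‖g t‖
        = 1 / (2 * K) * (K * ‖g t‖ - ‖h t‖) ^ 2 := by
      field_simp
      ring
    have : 0 ≤ 1 / (2 * K) * (K * ‖g t‖ - ‖h t‖) ^ 2 := by positivity
    linarith
  rw [integral_add (hg2.const_mul _) (hIsqR.integrableOn.const_mul _), integral_const_mul,
    integral_const_mul] at hle
  have h5 : ∫ t in E, ‖h t‖ ^ 2 ≤ K * T :=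
    (setIntegral_le_integral hIsqR (Filter.Eventually.of_forall fun t => by positivity)).trans
      hnormh
  have h6 : 1 / (2 * K) * ∫ t in E, ‖h t‖ ^ 2 ≤ T / 2 := by
    calc _ ≤ 1 / (2 * K) * (K * T) := by gcongr
      _ = T / 2 := by field_simp
  linarith

/-! ### Square-summability along non-condensing sequences -/

/-- The moduli of the sequence `ρ` have uniformly bounded multiplicity at unit scale: at most `K`
of them lie in any half-open interval of length one. -/
def UnitCountBound (ρ : ℕ → ℂ) (K : ℕ) : Prop :=
  ∀ (S : Finset ℕ) (t : ℝ), (S.filter fun n => ‖ρ n‖ ∈ Ico t (t + 1)).card ≤ K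

lemma NonCondensing.exists_unitCountBound {ρ : ℕ → ℂ} (h : NonCondensing ρ) :
    ∃ K, UnitCountBound ρ K := by
  classical
  obtain ⟨hfin, K, hK⟩ := h
  refine ⟨2 * K + {n | ‖ρ n‖ ≤ 2}.ncard, fun S t => ?_⟩
  -- the increments of the counting function are controlled on `(0, ∞)` only
  rcases le_or_gt t 1 with ht | ht
  · have hsub : ((S.filter fun n => ‖ρ n‖ ∈ Ico t (t + 1) : Finset ℕ) : Set ℕ) ⊆
        {n | ‖ρ n‖ ≤ 2} := by
      intro n hn
      simp only [Finset.coe_filter, mem_Ico, mem_ofPred_eq] at hn ⊢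
      linarith [hn.2.2]
    have := ncard_le_ncard hsub (hfin 2)
    rw [ncard_coe_finset] at this
    omega
  · have hsub : ((S.filter fun n => ‖ρ n‖ ∈ Ico t (t + 1) : Finset ℕ) : Set ℕ) ∪
        {n | ‖ρ n‖ ≤ t - 1} ⊆ {n | ‖ρ n‖ ≤ t - 1 + 1 + 1} := by
      intro n hn
      simp only [Finset.coe_filter, mem_Ico, mem_ofPred_eq, mem_union] at hn ⊢
      rcases hn with hn | hn
      · linarith [hn.2.2]
      · linarith
    have hdisj : Disjoint ((S.filter fun n => ‖ρ n‖ ∈ Ico t (t + 1) : Finset ℕ) : Set ℕ)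
        {n | ‖ρ n‖ ≤ t - 1} := by
      rw [Set.disjoint_left]
      intro n hn hn'
      simp only [Finset.coe_filter, mem_Ico, mem_ofPred_eq] at hn hn'
      linarith [hn.2.1]
    have h1 := ncard_le_ncard hsub (hfin _)
    rw [ncard_union_eq hdisj (Finset.finite_toSet _) (hfin _), ncard_coe_finset] at h1
    have h2 := hK (t - 1) (by linarith)
    have h3 := hK (t - 1 + 1) (by linarith)
    omega

/-- Functions square-summable along every sequence of `Γ` whose moduli are of bounded multiplicity
at unit scale. -/
def SqSummableOn (Γ : Set ℂ) (f : ℂ → ℂ) : Prop :=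
  ∀ (ρ : ℕ → ℂ) (K : ℕ), (∀ n, ρ n ∈ Γ) → UnitCountBound ρ K → Summable fun n => ‖f (ρ n)‖ ^ 2

namespace SqSummableOn

variable {Γ : Set ℂ} {f g : ℂ → ℂ}

lemma of_norm_le {C : ℝ} (hf : SqSummableOn Γ f) (h : ∀ ρ ∈ Γ, ‖g ρ‖ ≤ C * ‖f ρ‖) :
    SqSummableOn Γ g := by
  intro ρ K hρ hK
  refine Summable.of_nonneg_of_le (fun n => by positivity) (fun n => ?_)
    ((hf ρ K hρ hK).mul_left (C ^ 2))
  rw [← mul_pow]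
  exact pow_le_pow_left₀ (norm_nonneg _) (h _ (hρ n)) 2

lemma add (hf : SqSummableOn Γ f) (hg : SqSummableOn Γ g) :
    SqSummableOn Γ (fun ρ => f ρ + g ρ) := by
  intro ρ K hρ hK
  refine Summable.of_nonneg_of_le (fun n => by positivity) (fun n => ?_)
    (((hf ρ K hρ hK).add (hg ρ K hρ hK)).mul_left 2)
  have h1 := pow_le_pow_left₀ (norm_nonneg _) (norm_add_le (f (ρ n)) (g (ρ n))) 2
  nlinarith [sq_nonneg (‖f (ρ n)‖ - ‖g (ρ n)‖)]

lemma const_mul (c : ℂ) (hf : SqSummableOn Γ f) : SqSummableOn Γ (fun ρ => c * f ρ) :=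
  hf.of_norm_le (C := ‖c‖) fun ρ _ => (norm_mul c (f ρ)).le

lemma congr (hf : SqSummableOn Γ f) (h : ∀ ρ ∈ Γ, g ρ = f ρ) : SqSummableOn Γ g :=
  hf.of_norm_le (C := 1) fun ρ hρ => by rw [h ρ hρ, one_mul]

lemma sum {ι : Type*} (s : Finset ι) {F : ι → ℂ → ℂ} (h : ∀ i ∈ s, SqSummableOn Γ (F i)) :
    SqSummableOn Γ (fun ρ => ∑ i ∈ s, F i ρ) := by
  classical
  induction s using Finset.induction_on with
  | empty =>
    intro ρ K _ _
    simp
  | insert a s ha ih =>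
    refine ((h a (Finset.mem_insert_self _ _)).add
      (ih fun i hi => h i (Finset.mem_insert_of_mem hi))).congr fun ρ _ => ?_
    rw [Finset.sum_insert ha]

lemma of_le_inv {C : ℝ} (hΓ : ∀ ρ ∈ Γ, 1 ≤ ‖ρ‖) (h : ∀ ρ ∈ Γ, ‖f ρ‖ ≤ C / ‖ρ‖) :
    SqSummableOn Γ f := by
  have : SqSummableOn Γ (fun ρ => ρ⁻¹) := by
    intro ρ K hρ hK
    refine summable_of_sum_le (c := 2 * (9 * K)) (fun n => by positivity) fun S => ?_
    have h1 := sum_cauchy_le S (fun n => ‖ρ n‖) K (hK S) 1 le_rfl 0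
    calc _ ≤ ∑ n ∈ S, 2 * (1 / (1 ^ 2 + (0 - ‖ρ n‖) ^ 2)) := by
          refine Finset.sum_le_sum fun n _ => ?_
          have := hΓ _ (hρ n)
          rw [norm_inv, inv_pow, ← one_div, ← mul_div_assoc,
            div_le_div_iff₀ (by positivity) (by positivity)]
          nlinarith
      _ ≤ _ := by
          rw [← Finset.mul_sum]
          gcongr
  refine this.of_norm_le (C := C) fun ρ hρ => ?_
  rw [norm_inv, ← div_eq_mul_inv]
  exact h ρ hρ

/-- Square-summability along sequences forces decay: otherwise a sequence with
`‖ρ (n + 1)‖ ≥ ‖ρ n‖ + 1` would keep the function away from zero. -/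
lemma tendsto_zero (hf : SqSummableOn Γ f) :
    Filter.Tendsto f (Bornology.cobounded ℂ ⊓ Filter.principal Γ) (𝓝 0) := by
  rw [Metric.tendsto_nhds]
  intro ε hε
  by_contra hcon
  have hfar : ∀ R : ℝ, ∃ ρ ∈ Γ, R ≤ ‖ρ‖ ∧ ε ≤ ‖f ρ‖ := by
    intro R
    by_contra! hR
    refine hcon ?_
    rw [Filter.eventually_inf_principal]
    have := (tendsto_norm_cobounded_atTop (E := ℂ)).eventually (Filter.eventually_ge_atTop R)
    filter_upwards [this] with ρ h1 h2
    rw [dist_zero_right]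
    exact hR ρ h2 h1
  choose a ha1 ha2 ha3 using hfar
  let ρ : ℕ → ℂ := fun n => Nat.rec (a 0) (fun _ z => a (‖z‖ + 1)) n
  have hsucc : ∀ n, ρ (n + 1) = a (‖ρ n‖ + 1) := fun n => rfl
  have hmem : ∀ n, ∃ R, ρ n = a R := fun n => by
    cases n with
    | zero => exact ⟨0, rfl⟩
    | succ n => exact ⟨_, hsucc n⟩
  have hstep : ∀ n, ‖ρ n‖ + 1 ≤ ‖ρ (n + 1)‖ := fun n => by rw [hsucc]; exact ha2 _
  have hmono : StrictMono fun n => ‖ρ n‖ := strictMono_nat_of_lt_succ fun n => by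
    linarith [hstep n]
  have hgap : ∀ n m, n < m → ‖ρ n‖ + 1 ≤ ‖ρ m‖ := fun n m hnm =>
    (hstep n).trans (hmono.monotone hnm)
  have hK : UnitCountBound ρ 1 := by
    intro S t
    rw [Finset.card_le_one]
    intro n hn m hm
    simp only [Finset.mem_filter, mem_Ico] at hn hm
    rcases lt_trichotomy n m with h | h | h
    · linarith [hgap n m h, hn.2.1, hm.2.2]
    · exact h
    · linarith [hgap m n h, hm.2.1, hn.2.2]
  have hsum := hf ρ 1 (fun n => by obtain ⟨R, hR⟩ := hmem n; rw [hR]; exact ha1 R) hK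
  have h0 := hsum.tendsto_atTop_zero
  obtain ⟨n, hn⟩ := (h0.eventually (gt_mem_nhds (show (0 : ℝ) < ε ^ 2 by positivity))).exists
  obtain ⟨R, hR⟩ := hmem n
  rw [hR] at hn
  exact absurd (pow_le_pow_left₀ hε.le (ha3 R) 2) (not_le.2 hn)

lemma isUpsilon {Γ' : Set ℂ} (hf : SqSummableOn Γ f) (h : closure Γ' ⊆ Γ) : IsUpsilon Γ' f := by
  refine ⟨hf.tendsto_zero.mono_left (inf_le_inf_left _ (Filter.principal_mono.2 h)), ?_⟩
  intro ρ hρ hN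
  obtain ⟨K, hK⟩ := hN.exists_unitCountBound
  exact hf ρ K (fun n => h (subset_closure (hρ n))) hK

/-- Exponential integrals of square-integrable functions are square-summable along sequences of a
half-plane; `ε = ±1` tells on which side of `x` the set `E` lies. A weight `e^{(C+1)|t-x|}` moved to
`u` makes the decay rates `s n` at least one. -/
lemma integral_exp {d : ℂ} (hd : d ≠ 0) {C ε x : ℝ} (hε : |ε| = 1) {E : Set ℝ}
    (hE : MeasurableSet E) (hEx : ∀ t ∈ E, x - t = ε * |t - x| ∧ |t - x| ≤ 1)
    (hΓ : ∀ ρ ∈ Γ, ε * (ρ * d).re ≤ C) {u : ℝ → ℂ} (hu : MemLp u 2 (volume.restrict E)) :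
    SqSummableOn Γ (fun ρ => ∫ t in E, Complex.exp (ρ * d * ((x - t : ℝ) : ℂ)) * u t) := by
  intro ρ K hρ hK
  set s : ℕ → ℝ := fun n => C + 1 - ε * (ρ n * d).re with hs
  set τ : ℕ → ℝ := fun n => -(ρ n * d).im with hτ
  have hs1 : ∀ n, 1 ≤ s n := fun n => by
    have := hΓ _ (hρ n)
    simp only [hs]; linarith
  set v : ℝ → ℂ := fun t => (Real.exp ((C + 1) * |t - x|) : ℂ) * u t with hv
  have hvLp : MemLp v 2 (volume.restrict E) := by
    have hc : Continuous fun t : ℝ => (Real.exp ((C + 1) * |t - x|) : ℂ) := by fun_prop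
    refine hu.of_le_mul (c := Real.exp (|C + 1|)) (hc.aestronglyMeasurable.mul hu.1) ?_
    rw [ae_restrict_iff' hE]
    refine Filter.Eventually.of_forall fun t ht => ?_
    rw [hv, norm_mul, Complex.norm_real, Real.norm_of_nonneg (Real.exp_pos _).le]
    gcongr
    calc (C + 1) * |t - x| ≤ |C + 1| * |t - x| := by gcongr; exact le_abs_self _
      _ ≤ |C + 1| * 1 := by gcongr; exact (hEx t ht).2
      _ = _ := mul_one _
  have heq : ∀ n, ∫ t in E, Complex.exp (ρ n * d * ((x - t : ℝ) : ℂ)) * u t =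
      ∫ t in E, twoSidedExp x (s n) (τ n) t * v t := by
    intro n
    refine setIntegral_congr_fun hE fun t ht => ?_
    have h1 := (hEx t ht).1
    simp only [hv, twoSidedExp]
    rw [← mul_assoc, Complex.ofReal_exp, ← Complex.exp_add]
    congr 2
    have h2 : ((t - x : ℝ) : ℂ) = -((x - t : ℝ) : ℂ) := by push_cast; ring
    rw [h2]
    have h4 : ((x - t : ℝ) : ℂ) = (ε : ℂ) * (|t - x| : ℝ) := by rw [h1]; push_cast; rfl
    simp only [hs, hτ]
    generalize ρ n * d = w
    have h3 := Complex.re_add_im w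
    push_cast
    push_cast at h4
    linear_combination (w.re : ℂ) * h4 - ((x : ℂ) - t) * h3
  -- for `w = ρ n * d`, `w' = ρ m * d`, the reflection `-conj w'` has the same modulus as `w'` and
  -- turns the difference of the real parts into their sum, which is `O(s n + s m)`
  obtain ⟨M, hM, hr⟩ : ∃ M : ℝ, 0 < M ∧ ∀ n m, (s n + s m) ^ 2 + (‖ρ n‖ - ‖ρ m‖) ^ 2 ≤
      M * ((s n + s m) ^ 2 + (τ n - τ m) ^ 2) := by
    have hd0 : 0 < ‖d‖ := norm_pos_iff.2 hd
    refine ⟨1 + (|C| + 2) ^ 2 / ‖d‖ ^ 2, by positivity, fun n m => ?_⟩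
    set σ := s n + s m with hσ
    set θ := τ n - τ m with hθ
    have hσ2 : 2 ≤ σ := by linarith [hs1 n, hs1 m]
    set w := ρ n * d with hw
    set w' := ρ m * d with hw'
    have h1 : (‖w‖ - ‖w'‖) ^ 2 ≤ ‖w + (starRingEnd ℂ) w'‖ ^ 2 := by
      rw [← sq_abs (‖w‖ - ‖w'‖)]
      refine pow_le_pow_left₀ (abs_nonneg _) ?_ 2
      have := abs_norm_sub_norm_le w (-(starRingEnd ℂ) w')
      rwa [norm_neg, RCLike.norm_conj, sub_neg_eq_add] at this
    have h2 : ‖w + (starRingEnd ℂ) w'‖ ^ 2 = (w.re + w'.re) ^ 2 + θ ^ 2 := by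
      rw [Complex.sq_norm, Complex.normSq_apply]
      simp only [Complex.add_re, Complex.add_im, Complex.conj_re, Complex.conj_im, hθ, hτ]
      ring
    have h3 : (w.re + w'.re) ^ 2 ≤ ((|C| + 2) * σ) ^ 2 := by
      rw [← sq_abs (w.re + w'.re)]
      refine pow_le_pow_left₀ (abs_nonneg _) ?_ 2
      have e : |w.re + w'.re| = |2 * (C + 1) - σ| := by
        have : 2 * (C + 1) - σ = ε * (w.re + w'.re) := by simp only [hσ, hs]; ring
        rw [this, abs_mul, hε, one_mul]
      rw [e, abs_le]
      have := abs_nonneg C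
      have h5 := neg_abs_le C
      have h6 := le_abs_self C
      constructor <;> nlinarith
    have h4 : (‖w‖ - ‖w'‖) ^ 2 = ‖d‖ ^ 2 * (‖ρ n‖ - ‖ρ m‖) ^ 2 := by
      rw [hw, hw', norm_mul, norm_mul]; ring
    have h5 : (‖ρ n‖ - ‖ρ m‖) ^ 2 ≤ (|C| + 2) ^ 2 / ‖d‖ ^ 2 * (σ ^ 2 + θ ^ 2) := by
      rw [div_mul_eq_mul_div, le_div_iff₀ (by positivity)]
      have : θ ^ 2 ≤ (|C| + 2) ^ 2 * θ ^ 2 := by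
        have : 1 ≤ (|C| + 2) ^ 2 := by nlinarith [abs_nonneg C]
        nlinarith [sq_nonneg θ]
      nlinarith
    nlinarith [sq_nonneg θ]
  refine summable_of_sum_le (c := 64 * M * (9 * K + 1) * ∫ t in E, ‖v t‖ ^ 2)
    (fun n => by positivity) fun S => ?_
  simp only [heq]
  refine sum_norm_sq_integral_twoSidedExp_le S x s τ (fun n => ‖ρ n‖) hs1 hM (by positivity) hr
    (fun n _ => ?_) hvLp
  exact (sum_cauchy_le S (fun n => ‖ρ n‖) K (hK S) (s n) (hs1 n) _).trans (by linarith)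

end SqSummableOn

/-! ### Integral systems depending on a parameter -/

lemma continuousOn_parametric_integral {Ω : Set ℂ} {f : ℝ → ℝ → ℂ → ℂ}
    (hf : ContinuousOn (fun p : ℝ × ℝ × ℂ => f p.1 p.2.1 p.2.2) (univ ×ˢ univ ×ˢ Ω))
    (a : ℝ) {b : ℝ → ℝ} (hb : Continuous b) :
    ContinuousOn (fun p : ℝ × ℂ => ∫ t in a..b p.1, f p.1 t p.2) (univ ×ˢ Ω) := by
  rw [continuousOn_iff_continuous_domRestrict]
  have h : Continuous (Function.uncurry fun (q : (univ ×ˢ Ω : Set (ℝ × ℂ))) (t : ℝ) =>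
      f q.1.1 t q.1.2) := by
    refine hf.comp_continuous (f := fun r : (univ ×ˢ Ω : Set (ℝ × ℂ)) × ℝ =>
      (r.1.1.1, r.2, r.1.1.2)) (by fun_prop) fun r => ⟨trivial, trivial, r.1.2.2⟩
  exact intervalIntegral.continuous_parametric_intervalIntegral_of_continuous (a₀ := a) h
    (s := fun q => b q.1.1) (by fun_prop)

lemma differentiableOn_parametric_integral {Ω : Set ℂ} (hΩ : IsOpen Ω) {F : ℝ → ℂ → ℂ}
    (hF : ContinuousOn (fun p : ℝ × ℂ => F p.1 p.2) (univ ×ˢ Ω))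
    (hd : ∀ t, DifferentiableOn ℂ (F t) Ω) (a b : ℝ) :
    DifferentiableOn ℂ (fun ρ => ∫ t in a..b, F t ρ) Ω := by
  intro ρ₀ hρ₀
  obtain ⟨r, hr, hball⟩ : ∃ r > 0, Metric.closedBall ρ₀ (2 * r) ⊆ Ω := by
    obtain ⟨ε, hε, h⟩ := Metric.nhds_basis_closedBall.mem_iff.1 (hΩ.mem_nhds hρ₀)
    exact ⟨ε / 2, by positivity, by rwa [mul_div_cancel₀ _ two_ne_zero]⟩
  have hcont : ∀ ρ ∈ Ω, Continuous fun t => F t ρ := fun ρ hρ =>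
    hF.comp_continuous (f := fun t : ℝ => (t, ρ)) (by fun_prop) fun t => ⟨trivial, hρ⟩
  obtain ⟨M, hM⟩ := (isCompact_uIcc (a := a) (b := b)).prod
    (isCompact_closedBall ρ₀ (2 * r)) |>.exists_bound_of_continuousOn
    (hF.mono (prod_mono (subset_univ _) hball))
  have hsub : ∀ ρ ∈ Metric.ball ρ₀ r, Metric.closedBall ρ r ⊆ Metric.closedBall ρ₀ (2 * r) := by
    intro ρ hρ
    refine Metric.closedBall_subset_closedBall' ?_
    rw [Metric.mem_ball] at hρ
    linarith
  have hmem : ∀ ρ ∈ Metric.ball ρ₀ r, ρ ∈ Ω := fun ρ hρ =>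
    hball (hsub ρ hρ (Metric.mem_closedBall_self hr.le))
  have hder : ∀ t, ∀ ρ ∈ Metric.ball ρ₀ r, HasDerivAt (F t) (deriv (F t) ρ) ρ := fun t ρ hρ =>
    ((hd t).differentiableAt (hΩ.mem_nhds (hmem ρ hρ))).hasDerivAt
  -- the derivative is a pointwise limit of difference quotients along a sequence
  have hmeas : Measurable fun t => deriv (F t) ρ₀ := by
    set u : ℕ → ℂ := fun n => ρ₀ + ((r / 2 / (n + 1) : ℝ) : ℂ) with hu
    have hpos : ∀ n : ℕ, 0 < r / 2 / ((n : ℝ) + 1) := fun n => by positivity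
    have hu1 : Filter.Tendsto u Filter.atTop (𝓝[≠] ρ₀) := by
      refine tendsto_nhdsWithin_iff.2 ⟨?_, Filter.Eventually.of_forall fun n => ?_⟩
      · have h1 : Filter.Tendsto (fun n : ℕ => r / 2 / ((n : ℝ) + 1)) Filter.atTop (𝓝 0) :=
          tendsto_const_div_atTop_nhds_zero_nat (r / 2) |>.comp (Filter.tendsto_add_atTop_nat 1) |>.congr
            fun n => by simp
        have h2 := (Complex.continuous_ofReal.tendsto 0).comp h1
        simpa [hu] using! h2.const_add ρ₀
      · simp only [hu, mem_compl_iff, mem_singleton_iff, add_eq_left, Complex.ofReal_eq_zero]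
        exact (hpos n).ne'
    have hu2 : ∀ n, u n ∈ Metric.ball ρ₀ r := by
      intro n
      simp only [hu, Metric.mem_ball, dist_self_add_left, Complex.norm_real,
        Real.norm_of_nonneg (hpos n).le]
      rw [div_lt_iff₀ (by positivity)]
      have : (0 : ℝ) ≤ n := Nat.cast_nonneg n
      nlinarith
    refine measurable_of_tendsto_metrizable (f := fun n t => slope (F t) ρ₀ (u n)) (fun n => ?_) ?_
    · simp only [slope_def_module]
      have h1 := hcont _ (hmem _ (hu2 n))
      have h2 := hcont _ hρ₀
      fun_prop
    · rw [tendsto_pi_nhds]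
      intro t
      exact (hasDerivAt_iff_tendsto_slope.1
        (hder t ρ₀ (Metric.mem_ball_self hr))).comp hu1
  refine (intervalIntegral.hasDerivAt_integral_of_dominated_loc_of_deriv_le
    (F := fun ρ t => F t ρ) (F' := fun ρ t => deriv (F t) ρ) (bound := fun _ => M / r)
    (Metric.ball_mem_nhds ρ₀ hr) ?_ ?_ hmeas.aestronglyMeasurable ?_
    intervalIntegrable_const ?_).2.differentiableAt.differentiableWithinAt
  · filter_upwards [Metric.ball_mem_nhds ρ₀ hr] with ρ hρ
    exact (hcont ρ (hmem ρ hρ)).aestronglyMeasurable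
  · exact (hcont ρ₀ hρ₀).intervalIntegrable _ _
  · refine Filter.Eventually.of_forall fun t ht ρ hρ => ?_
    refine Complex.norm_deriv_le_of_forall_mem_sphere_norm_le hr ?_ fun z hz => ?_
    · refine DifferentiableOn.diffContOnCl ((hd t).mono ?_)
      rw [closure_ball _ hr.ne']
      exact (hsub ρ hρ).trans hball
    · exact hM (t, z) ⟨uIoc_subset_uIcc ht, hsub ρ hρ (Metric.sphere_subset_closedBall hz)⟩
  · exact Filter.Eventually.of_forall fun t _ ρ hρ => hder t ρ hρ

/-- Retraction of the real line onto `[0,1]`. -/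
def clip (x : ℝ) : ℝ := max 0 (min x 1)

lemma continuous_clip : Continuous clip := by unfold clip; fun_prop

lemma clip_mem (x : ℝ) : clip x ∈ Icc (0 : ℝ) 1 := by
  unfold clip
  exact ⟨le_max_left _ _, max_le zero_le_one (min_le_right _ _)⟩

lemma clip_of_mem {x : ℝ} (hx : x ∈ Icc (0 : ℝ) 1) : clip x = x := by
  unfold clip
  rw [min_eq_left hx.2, max_eq_right hx.1]

lemma abs_sub_le_one {s x : ℝ} (hs : s ∈ Icc (0 : ℝ) 1) (hx : x ∈ Icc (0 : ℝ) 1) :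
    |x - s| ≤ 1 := by
  rw [abs_le]; constructor <;> linarith [hs.1, hs.2, hx.1, hx.2]

/-- Successive approximations for the system `U_l(x) = f_l(x) + ∫_{s_l}^x ∑_j K_{lj}(x,t) U_j(t) dt`
whose kernel is a contraction, with an analytic parameter. -/
lemma exists_solution_integral_system {ι : Type*} [Fintype ι] {Ω : Set ℂ} (hΩ : IsOpen Ω)
    {s : ι → ℝ} (hs : ∀ l, s l ∈ Icc (0 : ℝ) 1) {K : ι → ι → ℝ → ℝ → ℂ → ℂ}
    (hKc : ∀ l j, ContinuousOn (fun p : ℝ × ℝ × ℂ => K l j p.1 p.2.1 p.2.2)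
      (univ ×ˢ univ ×ˢ Ω))
    (hKd : ∀ l j x t, DifferentiableOn ℂ (K l j x t) Ω)
    {f : ι → ℝ → ℂ → ℂ}
    (hfc : ∀ l, ContinuousOn (fun p : ℝ × ℂ => f l p.1 p.2) (univ ×ˢ Ω))
    (hfd : ∀ l x, DifferentiableOn ℂ (f l x) Ω)
    {B : ℝ} (hB0 : 0 ≤ B) (hfB : ∀ l, ∀ x ∈ Icc (0 : ℝ) 1, ∀ ρ ∈ Ω, ‖f l x ρ‖ ≤ B)
    (hK : ∀ l, ∀ x ∈ Icc (0 : ℝ) 1, ∀ t ∈ uIcc (s l) x, ∀ ρ ∈ Ω,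
      ∑ j, ‖K l j x t ρ‖ ≤ 1 / 2) :
    ∃ U : ι → ℝ → ℂ → ℂ,
      (∀ l, ContinuousOn (fun p : ℝ × ℂ => U l p.1 p.2) (univ ×ˢ Ω)) ∧
      (∀ l x, DifferentiableOn ℂ (U l x) Ω) ∧
      (∀ l x, ∀ ρ ∈ Ω, ‖U l x ρ‖ ≤ 2 * B) ∧
      ∀ l, ∀ x ∈ Icc (0 : ℝ) 1, ∀ ρ ∈ Ω,
        U l x ρ = f l x ρ + ∫ t in s l..x, ∑ j, K l j x t ρ * U j t ρ := by
  -- composition with `clip` keeps the iterates continuous and bounded on the whole line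
  let T : ℕ → ι → ℝ → ℂ → ℂ := fun n => Nat.rec (fun l x ρ => f l (clip x) ρ)
    (fun _ V l x ρ => ∫ t in s l..clip x, ∑ j, K l j (clip x) t ρ * V j t ρ) n
  have hT0 : ∀ l x ρ, T 0 l x ρ = f l (clip x) ρ := fun _ _ _ => rfl
  have hTs : ∀ n l x ρ, T (n + 1) l x ρ =
      ∫ t in s l..clip x, ∑ j, K l j (clip x) t ρ * T n j t ρ := fun _ _ _ _ => rfl
  have hclip := continuous_clip
  have hTc : ∀ n l, ContinuousOn (fun p : ℝ × ℂ => T n l p.1 p.2) (univ ×ˢ Ω) := by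
    intro n
    induction n with
    | zero =>
      intro l
      exact (hfc l).comp (f := fun p : ℝ × ℂ => (clip p.1, p.2)) (by fun_prop)
        fun p hp => ⟨trivial, hp.2⟩
    | succ n ih =>
      intro l
      simp only [hTs]
      refine continuousOn_parametric_integral
        (f := fun x t ρ => ∑ j, K l j (clip x) t ρ * T n j t ρ) ?_ (s l) hclip
      refine continuousOn_finsetSum _ fun j _ => ContinuousOn.mul ?_ ?_
      · exact (hKc l j).comp (f := fun p : ℝ × ℝ × ℂ => (clip p.1, p.2.1, p.2.2)) (by fun_prop)
          fun p hp => ⟨trivial, trivial, hp.2.2⟩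
      · exact (ih j).comp (f := fun p : ℝ × ℝ × ℂ => (p.2.1, p.2.2)) (by fun_prop)
          fun p hp => ⟨trivial, hp.2.2⟩
  have hKc' : ∀ l j x, ContinuousOn (fun p : ℝ × ℂ => K l j x p.1 p.2) (univ ×ˢ Ω) :=
    fun l j x => (hKc l j).comp (f := fun p : ℝ × ℂ => (x, p.1, p.2)) (by fun_prop)
      fun p hp => ⟨trivial, trivial, hp.2⟩
  have hTd : ∀ n l x, DifferentiableOn ℂ (T n l x) Ω := by
    intro n
    induction n with
    | zero => exact fun l x => hfd l (clip x)
    | succ n ih =>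
      intro l x
      refine differentiableOn_parametric_integral hΩ
        (F := fun t ρ => ∑ j, K l j (clip x) t ρ * T n j t ρ) ?_ (fun t => ?_) _ _
      · exact continuousOn_finsetSum _ fun j _ => (hKc' l j _).mul (hTc n j)
      · exact DifferentiableOn.fun_sum fun j _ => (hKd l j _ t).mul (ih j t)
  have hsum_le : ∀ (V : ι → ℂ) (b : ℝ), (∀ j, ‖V j‖ ≤ b) → 0 ≤ b → ∀ l, ∀ x ∈ Icc (0 : ℝ) 1,
      ∀ t ∈ uIcc (s l) x, ∀ ρ ∈ Ω, ‖∑ j, K l j x t ρ * V j‖ ≤ b / 2 := by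
    intro V b hV hb l x hx t ht ρ hρ
    calc _ ≤ ∑ j, ‖K l j x t ρ‖ * b := by
          refine (norm_sum_le _ _).trans (Finset.sum_le_sum fun j _ => ?_)
          rw [norm_mul]
          gcongr
          exact hV j
      _ = (∑ j, ‖K l j x t ρ‖) * b := by rw [Finset.sum_mul]
      _ ≤ 1 / 2 * b := by gcongr; exact hK l x hx t ht ρ hρ
      _ = b / 2 := by ring
  have hTB : ∀ n l x, ∀ ρ ∈ Ω, ‖T n l x ρ‖ ≤ B * (1 / 2) ^ n := by
    intro n
    induction n with
    | zero =>
      intro l x ρ hρ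
      rw [hT0, pow_zero, mul_one]
      exact hfB l _ (clip_mem x) ρ hρ
    | succ n ih =>
      intro l x ρ hρ
      rw [hTs]
      have h1 := intervalIntegral.norm_integral_le_of_norm_le_const (a := s l) (b := clip x)
        (f := fun t => ∑ j, K l j (clip x) t ρ * T n j t ρ) (C := B * (1 / 2) ^ n / 2)
        fun t ht => hsum_le (fun j => T n j t ρ) _ (fun j => ih j t ρ hρ) (by positivity) l _
          (clip_mem x) t (uIoc_subset_uIcc ht) ρ hρ
      calc _ ≤ B * (1 / 2) ^ n / 2 * |clip x - s l| := h1
        _ ≤ B * (1 / 2) ^ n / 2 * 1 := by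
            gcongr
            exact abs_sub_le_one (hs l) (clip_mem x)
        _ = _ := by rw [pow_succ]; ring
  have hgeo : Summable fun n : ℕ => B * (1 / 2 : ℝ) ^ n := summable_geometric_two.mul_left B
  have hTsum : ∀ l x, ∀ ρ ∈ Ω, Summable fun n => T n l x ρ := fun l x ρ hρ =>
    Summable.of_norm_bounded hgeo fun n => hTB n l x ρ hρ
  refine ⟨fun l x ρ => ∑' n, T n l x ρ, fun l => ?_, fun l x => ?_, fun l x ρ hρ => ?_,
    fun l x hx ρ hρ => ?_⟩
  · exact continuousOn_tsum (hTc · l) hgeo fun n p hp => hTB n l p.1 p.2 hp.2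
  · exact Complex.differentiableOn_tsum_of_summable_norm hgeo (hTd · l x) hΩ
      fun n ρ hρ => hTB n l x ρ hρ
  · have h := tsum_of_norm_bounded (hasSum_geometric_two.mul_left B)
      fun n => hTB n l x ρ hρ
    linarith
  · have hxc := clip_of_mem hx
    have hcont : ∀ g : ι → ℝ → ℂ → ℂ,
        (∀ j, ContinuousOn (fun p : ℝ × ℂ => g j p.1 p.2) (univ ×ˢ Ω)) →
        Continuous fun t => ∑ j, K l j x t ρ * g j t ρ := fun g hg =>
      (continuousOn_finsetSum _ fun j _ => (hKc' l j x).mul (hg j)).comp_continuous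
        (f := fun t : ℝ => (t, ρ)) (by fun_prop) fun t => ⟨trivial, hρ⟩
    have hI : HasSum (fun n => T (n + 1) l x ρ)
        (∫ t in s l..x, ∑ j, K l j x t ρ * ∑' n, T n j t ρ) := by
      simp only [hTs, hxc]
      refine intervalIntegral.hasSum_integral_of_dominated_convergence
        (fun n _ => B * (1 / 2) ^ n / 2) (fun n => ?_) (fun n => ?_) ?_ ?_ ?_
      · exact (hcont (T n) (hTc n)).aestronglyMeasurable
      · exact Filter.Eventually.of_forall fun t ht =>
          hsum_le (fun j => T n j t ρ) _ (fun j => hTB n j t ρ hρ) (by positivity) l x hx t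
            (uIoc_subset_uIcc ht) ρ hρ
      · exact Filter.Eventually.of_forall fun t _ => hgeo.div_const 2
      · exact intervalIntegrable_const
      · refine Filter.Eventually.of_forall fun t _ => ?_
        exact hasSum_sum fun j _ => (hTsum j t ρ hρ).hasSum.mul_left _
    beta_reduce
    rw [(hTsum l x ρ hρ).tsum_eq_zero_add, hI.tsum_eq, hT0, hxc]

/-! ### Absolutely continuous functions and primitives -/

/-- Absolute continuity is inherited by functions with smaller increments. -/
lemma absolutelyContinuousOnInterval_of_dist_le {X Y : Type*} [PseudoMetricSpace X]
    [PseudoMetricSpace Y] {f : ℝ → X} {g : ℝ → Y} {a b : ℝ}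
    (hg : AbsolutelyContinuousOnInterval g a b)
    (h : ∀ x ∈ uIcc a b, ∀ y ∈ uIcc a b, dist (f x) (f y) ≤ dist (g x) (g y)) :
    AbsolutelyContinuousOnInterval f a b := by
  rw [absolutelyContinuousOnInterval_iff] at hg ⊢
  intro ε hε
  obtain ⟨δ, hδ, H⟩ := hg ε hε
  refine ⟨δ, hδ, fun E hE hlen => lt_of_le_of_lt (Finset.sum_le_sum fun i hi => ?_) (H E hE hlen)⟩
  exact h _ (hE.1 i hi).1 _ (hE.1 i hi).2

lemma absolutelyContinuousOnInterval_primitive {g : ℝ → ℂ} {a b : ℝ}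
    (hg : IntervalIntegrable g volume a b) {c : ℝ} (hc : c ∈ uIcc a b) :
    AbsolutelyContinuousOnInterval (fun x => ∫ t in c..x, g t) a b := by
  refine absolutelyContinuousOnInterval_of_dist_le
    (hg.norm.absolutelyContinuousOnInterval_intervalIntegral hc) fun x hx y hy => ?_
  have hi : ∀ z ∈ uIcc a b, IntervalIntegrable g volume c z := fun z hz =>
    hg.mono_set (uIcc_subset_uIcc hc hz)
  rw [dist_eq_norm, dist_eq_norm, intervalIntegral.integral_interval_sub_left (hi x hx) (hi y hy),
    intervalIntegral.integral_interval_sub_left (hi x hx).norm (hi y hy).norm]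
  exact intervalIntegral.norm_integral_le_abs_integral_norm

lemma absolutelyContinuousOnInterval_of_hasDerivWithinAt {f f' : ℝ → ℂ}
    (hf : ∀ x ∈ Icc (0 : ℝ) 1, HasDerivWithinAt f (f' x) (Icc 0 1) x)
    (hf' : ContinuousOn f' (Icc 0 1)) : AbsolutelyContinuousOnInterval f 0 1 := by
  obtain ⟨C, hC⟩ := isCompact_Icc.exists_bound_of_continuousOn hf'
  refine LipschitzOnWith.absolutelyContinuousOnInterval (K := C.toNNReal) ?_
  rw [uIcc_of_le zero_le_one]
  refine (convex_Icc 0 1).lipschitzOnWith_of_nnnorm_hasDerivWithin_le hf fun x hx => ?_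
  rw [← NNReal.coe_le_coe, coe_nnnorm]
  exact (hC x hx).trans (Real.le_coe_toNNReal C)

lemma ae_mem_Ioo_of_mem_Icc : ∀ᵐ x : ℝ, x ∈ Icc (0 : ℝ) 1 → x ∈ Ioo (0 : ℝ) 1 := by
  have h0 : ∀ᵐ x : ℝ, x ≠ 0 := by simp [ae_iff, measure_singleton]
  have h1 : ∀ᵐ x : ℝ, x ≠ 1 := by simp [ae_iff, measure_singleton]
  filter_upwards [h0, h1] with x h0 h1 hx
  exact ⟨lt_of_le_of_ne hx.1 (Ne.symm h0), lt_of_le_of_ne hx.2 h1⟩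

lemma ContinuousOn.comp_clip {E : Type*} [TopologicalSpace E] {f : ℝ → E}
    (hf : ContinuousOn f (Icc 0 1)) : Continuous fun x => f (clip x) :=
  hf.comp_continuous continuous_clip clip_mem

lemma hasDerivWithinAt_primitive {G : ℝ → ℂ} (hG : ContinuousOn G (Icc 0 1)) {s : ℝ}
    (hs : s ∈ Icc (0 : ℝ) 1) {x : ℝ} (hx : x ∈ Icc (0 : ℝ) 1) :
    HasDerivWithinAt (fun x => ∫ t in s..x, G t) (G x) (Icc 0 1) x := by
  have hc := ContinuousOn.comp_clip hG
  have h := (hc.integral_hasStrictDerivAt s x).hasDerivAt.hasDerivWithinAt (s := Icc (0 : ℝ) 1)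
  rw [clip_of_mem hx] at h
  refine h.congr_of_mem (fun y hy => ?_) hx
  refine intervalIntegral.integral_congr fun t ht => ?_
  have ht' : t ∈ Icc (0 : ℝ) 1 := (uIcc_subset_Icc hs hy) ht
  simp only [clip_of_mem ht']

/-- An absolutely continuous function whose derivative agrees almost everywhere with a continuous
function is continuously differentiable. -/
lemma hasDerivWithinAt_of_ae_eq {f G : ℝ → ℂ} (hf : AbsolutelyContinuousOnInterval f 0 1)
    (hG : ContinuousOn G (Icc 0 1))
    (h : ∀ᵐ x ∂(volume.restrict (Icc (0 : ℝ) 1)), derivWithin f (Icc 0 1) x = G x) :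
    ∀ x ∈ Icc (0 : ℝ) 1, HasDerivWithinAt f (G x) (Icc 0 1) x := by
  have h01 : (0 : ℝ) ∈ Icc (0 : ℝ) 1 := ⟨le_rfl, zero_le_one⟩
  have hprim := fun x hx => hasDerivWithinAt_primitive hG h01 (x := x) hx
  have hac : AbsolutelyContinuousOnInterval (fun x => f x - ∫ t in (0 : ℝ)..x, G t) 0 1 :=
    hf.fun_sub (absolutelyContinuousOnInterval_of_hasDerivWithinAt hprim hG)
  rw [ae_restrict_iff' measurableSet_Icc] at h
  obtain ⟨c, hc⟩ := hac.const_of_ae_hasDerivAt_zero (by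
    filter_upwards [hf.boundedVariationOn.ae_differentiableAt_of_mem_uIcc, h,
      ae_mem_Ioo_of_mem_Icc] with x h1 h2 h3 hx
    rw [uIcc_of_le zero_le_one] at hx h1
    have hn : Icc (0 : ℝ) 1 ∈ 𝓝 x := Icc_mem_nhds (h3 hx).1 (h3 hx).2
    have h4 := (h1 hx).hasDerivAt
    rw [← derivWithin_of_mem_nhds hn, h2 hx] at h4
    simpa using h4.fun_sub ((hprim x hx).hasDerivAt hn))
  rw [uIcc_of_le zero_le_one] at hc
  intro x hx
  refine ((hprim x hx).const_add c).congr_of_mem (fun y hy => ?_) hx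
  rw [← hc y hy]
  ring

/-- Integration by parts of an absolutely continuous function, given as a primitive, against a
continuously differentiable one. -/
lemma integral_deriv_mul_primitive {a g φ φ' : ℝ → ℂ} (hg : IntervalIntegrable g volume 0 1)
    (ha : ∀ x ∈ Icc (0 : ℝ) 1, a x = a 0 + ∫ t in (0 : ℝ)..x, g t)
    (hφ : ∀ x ∈ Icc (0 : ℝ) 1, HasDerivWithinAt φ (φ' x) (Icc 0 1) x)
    (hφ' : ContinuousOn φ' (Icc 0 1)) {u v : ℝ} (hu : u ∈ Icc (0 : ℝ) 1)
    (hv : v ∈ Icc (0 : ℝ) 1) :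
    ∫ t in u..v, φ' t * a t = φ v * a v - φ u * a u - ∫ t in u..v, φ t * g t := by
  have h01 : uIcc (0 : ℝ) 1 = Icc 0 1 := uIcc_of_le zero_le_one
  have hac := absolutelyContinuousOnInterval_of_hasDerivWithinAt hφ hφ'
  have hφc : ContinuousOn φ (Icc 0 1) := fun x hx => (hφ x hx).continuousWithinAt
  have hca : AbsolutelyContinuousOnInterval (fun x => a 0 + ∫ t in (0 : ℝ)..x, g t) 0 1 :=
    absolutelyContinuousOnInterval_of_dist_le
      (absolutelyContinuousOnInterval_primitive hg (c := 0) (by simp))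
      fun x _ y _ => by rw [dist_add_left]
  have haa : AbsolutelyContinuousOnInterval a 0 1 :=
    absolutelyContinuousOnInterval_of_dist_le hca fun x hx y hy => by
      rw [h01] at hx hy
      rw [ha x hx, ha y hy]
  have i1 : IntervalIntegrable (fun t => φ' t * a t) volume 0 1 :=
    ContinuousOn.intervalIntegrable (by rw [h01]; exact hφ'.mul (h01 ▸ haa.continuousOn))
  have i2 : IntervalIntegrable (fun t => φ t * g t) volume 0 1 :=
    hg.continuousOn_mul (by rw [h01]; exact hφc)
  have i3 := i1.add i2
  have hH : AbsolutelyContinuousOnInterval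
      (fun x => φ x * a x - ∫ t in u..x, (φ' t * a t + φ t * g t)) 0 1 :=
    (hac.fun_smul haa).fun_sub (absolutelyContinuousOnInterval_primitive i3 (by rwa [h01]))
  obtain ⟨c, hc⟩ := hH.const_of_ae_hasDerivAt_zero (by
    filter_upwards [hg.ae_hasDerivAt_integral, i3.ae_hasDerivAt_integral,
      ae_mem_Ioo_of_mem_Icc] with x h1 h2 h3 hx
    have h1 := h1 hx 0 (by simp)
    have h2 := h2 hx u (by rwa [h01])
    rw [h01] at hx
    have hn : Icc (0 : ℝ) 1 ∈ 𝓝 x := Icc_mem_nhds (h3 hx).1 (h3 hx).2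
    have h4 := (hφ x hx).hasDerivAt hn
    have h5 : HasDerivAt a (g x) x := by
      refine (h1.const_add (a 0)).congr_of_eventuallyEq ?_
      filter_upwards [hn] with y hy using ha y hy
    convert! (h4.fun_mul h5).fun_sub h2 using 1
    ring)
  rw [h01] at hc
  have e := (hc v hv).trans (hc u hu).symm
  have hsub : uIcc u v ⊆ uIcc 0 1 := by rw [h01]; exact uIcc_subset_Icc hu hv
  rw [intervalIntegral.integral_same, intervalIntegral.integral_add (i1.mono_set hsub)
    (i2.mono_set hsub)] at e
  linear_combination -e

/-! ### Exponential regions and uniform orders of magnitude -/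

/-- The region of the spectral parameter in which the exponentials `e^{ρ ω_k x}` are ordered up to
a factor `e^C`: a neighbourhood of the extended sector, outside a disk. -/
def expRegion (ω : Fin 4 → ℂ) (C R : ℝ) : Set ℂ :=
  {ρ | R < ‖ρ‖ ∧ ∀ l k, l < k → (ρ * (ω l - ω k)).re < C}

/-- The end of `[0,1]` from which `e^{ρ (ω_l - ω_k) (x - t)}` is integrated: the kernel is bounded
for `t` between this end and `x`. -/
def basePoint (k l : Fin 4) : ℝ := if l ≤ k then 0 else 1

lemma basePoint_mem (k l : Fin 4) : basePoint k l ∈ Icc (0 : ℝ) 1 := by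
  unfold basePoint
  split_ifs <;> simp

lemma isOpen_expRegion (ω : Fin 4 → ℂ) (C R : ℝ) : IsOpen (expRegion ω C R) := by
  have : expRegion ω C R = {ρ | R < ‖ρ‖} ∩ ⋂ l, ⋂ k, ⋂ (_ : l < k),
      {ρ : ℂ | (ρ * (ω l - ω k)).re < C} := by
    ext ρ
    simp [expRegion]
  rw [this]
  refine (isOpen_lt continuous_const continuous_norm).inter ?_
  refine isOpen_iInter_of_finite fun l => isOpen_iInter_of_finite fun k =>
    isOpen_iInter_of_finite fun _ => isOpen_lt (by fun_prop) continuous_const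

lemma expRegion_mono (ω : Fin 4 → ℂ) (C : ℝ) {R R' : ℝ} (h : R ≤ R') :
    expRegion ω C R' ⊆ expRegion ω C R := fun _ hρ => ⟨h.trans_lt hρ.1, hρ.2⟩

lemma norm_exp_le {ω : Fin 4 → ℂ} {C R : ℝ} (hC : 0 ≤ C) {ρ : ℂ} (hρ : ρ ∈ expRegion ω C R)
    {k l : Fin 4} {x t : ℝ} (hx : x ∈ Icc (0 : ℝ) 1) (ht : t ∈ uIcc (basePoint k l) x) :
    ‖Complex.exp (ρ * (ω l - ω k) * ((x - t : ℝ) : ℂ))‖ ≤ Real.exp C := by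
  rw [Complex.norm_exp, Real.exp_le_exp, Complex.re_mul_ofReal]
  unfold basePoint at ht
  split_ifs at ht with h
  · rw [uIcc_of_le hx.1] at ht
    rcases h.lt_or_eq with h | rfl
    · have := (hρ.2 l k h).le
      nlinarith [ht.1, ht.2, hx.2]
    · simpa using hC
  · rw [uIcc_of_ge hx.2] at ht
    have := (hρ.2 k l (not_le.1 h)).le
    have e : (ρ * (ω l - ω k)).re = -(ρ * (ω k - ω l)).re := by
      rw [← Complex.neg_re]; congr 1; ring
    rw [e]
    nlinarith [ht.1, ht.2, hx.1]

/-- The variation-of-constants formula solves `u' = z u + F`. -/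
lemma hasDerivWithinAt_duhamel {z β : ℂ} {F u : ℝ → ℂ} (hF : ContinuousOn F (Icc 0 1)) {s : ℝ}
    (hs : s ∈ Icc (0 : ℝ) 1)
    (hu : ∀ x ∈ Icc (0 : ℝ) 1, u x = Complex.exp (z * ((x - s : ℝ) : ℂ)) * β +
      ∫ t in s..x, Complex.exp (z * ((x - t : ℝ) : ℂ)) * F t)
    {x : ℝ} (hx : x ∈ Icc (0 : ℝ) 1) :
    HasDerivWithinAt u (z * u x + F x) (Icc 0 1) x := by
  have hu' : ∀ x ∈ Icc (0 : ℝ) 1, u x = Complex.exp (z * ((x - s : ℝ) : ℂ)) *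
      (β + ∫ t in s..x, Complex.exp (z * ((s - t : ℝ) : ℂ)) * F t) := by
    intro x hx
    rw [hu x hx, mul_add, ← intervalIntegral.integral_const_mul]
    congr 1
    refine intervalIntegral.integral_congr fun t _ => ?_
    rw [← mul_assoc, ← Complex.exp_add]
    congr 2
    push_cast
    ring
  have hG : ContinuousOn (fun t => Complex.exp (z * ((s - t : ℝ) : ℂ)) * F t) (Icc 0 1) :=
    ContinuousOn.mul (by fun_prop) hF
  have h1 := (hasDerivWithinAt_primitive hG hs hx).const_add β
  have h2 : HasDerivWithinAt (fun x : ℝ => Complex.exp (z * ((x - s : ℝ) : ℂ)))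
      (Complex.exp (z * ((x - s : ℝ) : ℂ)) * (z * 1)) (Icc 0 1) x := by
    refine HasDerivAt.hasDerivWithinAt (HasDerivAt.cexp ?_)
    exact (HasDerivAt.ofReal_comp ((hasDerivAt_id x).sub_const s)).const_mul z
  have h3 := (h2.fun_mul h1).congr_of_mem hu' hx
  convert! h3 using 1
  rw [hu' x hx]
  have e : Complex.exp (z * ((x - s : ℝ) : ℂ)) * (Complex.exp (z * ((s - x : ℝ) : ℂ)) * F x)
      = F x := by
    rw [← mul_assoc, ← Complex.exp_add, show z * ((x - s : ℝ) : ℂ) + z * ((s - x : ℝ) : ℂ) = 0 by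
      push_cast; ring, Complex.exp_zero, one_mul]
  rw [e]
  ring

/-- The functions of `(x, ρ)` that are `O(ρ⁻ⁿ)` on `Ω`, uniformly in `x ∈ [0,1]`. -/
def UnifO (Ω : Set ℂ) (n : ℕ) (f : ℝ → ℂ → ℂ) : Prop :=
  ∃ C, 0 ≤ C ∧ ∀ ρ ∈ Ω, ∀ x ∈ Icc (0 : ℝ) 1, ‖f x ρ‖ ≤ C * ‖ρ⁻¹‖ ^ n

namespace UnifO

variable {Ω : Set ℂ} {n m : ℕ} {f g : ℝ → ℂ → ℂ}

lemma add (hf : UnifO Ω n f) (hg : UnifO Ω n g) : UnifO Ω n (fun x ρ => f x ρ + g x ρ) := by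
  obtain ⟨C, hC, h⟩ := hf
  obtain ⟨D, hD, h'⟩ := hg
  refine ⟨C + D, by positivity, fun ρ hρ x hx => (norm_add_le _ _).trans ?_⟩
  rw [add_mul]
  exact add_le_add (h ρ hρ x hx) (h' ρ hρ x hx)

lemma neg (hf : UnifO Ω n f) : UnifO Ω n (fun x ρ => -f x ρ) := by
  obtain ⟨C, hC, h⟩ := hf
  exact ⟨C, hC, fun ρ hρ x hx => by rw [norm_neg]; exact h ρ hρ x hx⟩

lemma sub (hf : UnifO Ω n f) (hg : UnifO Ω n g) : UnifO Ω n (fun x ρ => f x ρ - g x ρ) := by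
  simpa only [sub_eq_add_neg] using hf.add hg.neg

lemma mul (hf : UnifO Ω n f) (hg : UnifO Ω m g) :
    UnifO Ω (n + m) (fun x ρ => f x ρ * g x ρ) := by
  obtain ⟨C, hC, h⟩ := hf
  obtain ⟨D, hD, h'⟩ := hg
  refine ⟨C * D, by positivity, fun ρ hρ x hx => ?_⟩
  rw [norm_mul]
  calc _ ≤ (C * ‖ρ⁻¹‖ ^ n) * (D * ‖ρ⁻¹‖ ^ m) :=
        mul_le_mul (h ρ hρ x hx) (h' ρ hρ x hx) (norm_nonneg _) (by positivity)
    _ = _ := by rw [pow_add]; ring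

lemma zero : UnifO Ω n (fun _ _ => 0) := ⟨0, le_rfl, fun ρ _ x _ => by simp⟩

lemma sum {ι : Type*} (s : Finset ι) {F : ι → ℝ → ℂ → ℂ} (h : ∀ i ∈ s, UnifO Ω n (F i)) :
    UnifO Ω n (fun x ρ => ∑ i ∈ s, F i x ρ) := by
  classical
  induction s using Finset.induction_on with
  | empty => simpa using zero
  | insert a s ha ih =>
    simp only [Finset.sum_insert ha]
    exact (h a (Finset.mem_insert_self _ _)).add
      (ih fun i hi => h i (Finset.mem_insert_of_mem hi))

lemma congr (hf : UnifO Ω n f) (h : ∀ ρ ∈ Ω, ∀ x ∈ Icc (0 : ℝ) 1, g x ρ = f x ρ) :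
    UnifO Ω n g := by
  obtain ⟨C, hC, h'⟩ := hf
  exact ⟨C, hC, fun ρ hρ x hx => by rw [h ρ hρ x hx]; exact h' ρ hρ x hx⟩

lemma mono (hΩ : ∀ ρ ∈ Ω, 1 ≤ ‖ρ‖) (hf : UnifO Ω n f) (h : m ≤ n) : UnifO Ω m f := by
  obtain ⟨C, hC, h'⟩ := hf
  refine ⟨C, hC, fun ρ hρ x hx => (h' ρ hρ x hx).trans ?_⟩
  refine mul_le_mul_of_nonneg_left (pow_le_pow_of_le_one (norm_nonneg _) ?_ h) hC
  rw [norm_inv]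
  exact inv_le_one_of_one_le₀ (hΩ ρ hρ)

lemma inv_pow (n : ℕ) : UnifO Ω n (fun _ ρ => ρ⁻¹ ^ n) :=
  ⟨1, zero_le_one, fun ρ _ x _ => by rw [norm_pow, one_mul]⟩

lemma of_continuousOn {a : ℝ → ℂ} (ha : ContinuousOn a (Icc 0 1)) :
    UnifO Ω 0 (fun x _ => a x) := by
  obtain ⟨C, hC⟩ := isCompact_Icc.exists_bound_of_continuousOn ha
  have h0 : (0 : ℝ) ∈ Icc (0 : ℝ) 1 := ⟨le_rfl, zero_le_one⟩
  exact ⟨C, (norm_nonneg _).trans (hC 0 h0), fun ρ _ x hx => by simpa using hC x hx⟩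

lemma const (c : ℂ) : UnifO Ω 0 (fun _ _ => c) := of_continuousOn continuousOn_const

lemma comp (hf : UnifO Ω n f) {b : ℝ} (hb : b ∈ Icc (0 : ℝ) 1) : UnifO Ω n (fun _ ρ => f b ρ) := by
  obtain ⟨C, hC, h⟩ := hf
  exact ⟨C, hC, fun ρ hρ x _ => h ρ hρ b hb⟩

/-- Integration against a bounded kernel and an integrable weight preserves the order. -/
lemma integral {s D : ℝ} (hs : s ∈ Icc (0 : ℝ) 1) (hD : 0 ≤ D) {E : ℝ → ℝ → ℂ → ℂ}
    (hE : ∀ ρ ∈ Ω, ∀ x ∈ Icc (0 : ℝ) 1, ∀ t ∈ uIcc s x, ‖E x t ρ‖ ≤ D)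
    {w : ℝ → ℂ} (hw : IntervalIntegrable w volume 0 1) (hf : UnifO Ω n f) :
    UnifO Ω n (fun x ρ => ∫ t in s..x, E x t ρ * (f t ρ * w t)) := by
  obtain ⟨C, hC, h⟩ := hf
  refine ⟨D * C * ∫ t in (0 : ℝ)..1, ‖w t‖, mul_nonneg (by positivity)
    (intervalIntegral.integral_nonneg zero_le_one fun _ _ => norm_nonneg _),
    fun ρ hρ x hx => ?_⟩
  have hsub : uIcc s x ⊆ Icc 0 1 := uIcc_subset_Icc hs hx
  have hsub' : uIoc s x ⊆ Ioc 0 1 := by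
    intro t ht
    rw [uIoc, mem_Ioc] at ht
    exact ⟨lt_of_le_of_lt (le_min hs.1 hx.1) ht.1, ht.2.trans (max_le hs.2 hx.2)⟩
  rw [intervalIntegral.norm_intervalIntegral_eq]
  have hwi : IntegrableOn (fun t => ‖w t‖) (Ioc 0 1) :=
    ((intervalIntegrable_iff_integrableOn_Ioc_of_le zero_le_one).1 hw).norm
  calc ‖∫ t in uIoc s x, E x t ρ * (f t ρ * w t)‖
      ≤ ∫ t in uIoc s x, D * C * ‖ρ⁻¹‖ ^ n * ‖w t‖ := by
        refine norm_integral_le_of_norm_le ((hwi.mono_set hsub').const_mul _) ?_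
        rw [ae_restrict_iff' measurableSet_uIoc]
        refine Filter.Eventually.of_forall fun t ht => ?_
        have ht' := uIoc_subset_uIcc ht
        rw [norm_mul, norm_mul]
        calc _ ≤ D * (C * ‖ρ⁻¹‖ ^ n * ‖w t‖) := by
              gcongr
              · exact hE ρ hρ x hx t ht'
              · exact h ρ hρ t (hsub ht')
          _ = _ := by ring
    _ = D * C * ‖ρ⁻¹‖ ^ n * ∫ t in uIoc s x, ‖w t‖ := integral_const_mul _ _
    _ ≤ D * C * ‖ρ⁻¹‖ ^ n * ∫ t in Ioc 0 1, ‖w t‖ := by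
        refine mul_le_mul_of_nonneg_left ?_ (by positivity)
        exact setIntegral_mono_set hwi (Filter.Eventually.of_forall fun _ => norm_nonneg _)
          (Filter.Eventually.of_forall hsub')
    _ = _ := by rw [intervalIntegral.integral_of_le zero_le_one]; ring

end UnifO

/-! ### The Birkhoff system of integral equations -/

/-- The system of integral equations whose solutions `U` give a solution `e^{ρ ω_k x} U(x, ρ)` of
`V' = (ρ diag(ω) + ρ⁻¹ a + ρ⁻³ b) V`, with the initial values `β`. -/
def IsIntegralSolution (ω : Fin 4 → ℂ) (k : Fin 4) (a b : Fin 4 → Fin 4 → ℝ → ℂ)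
    (β : Fin 4 → ℂ → ℂ) (Ω : Set ℂ) (U : Fin 4 → ℝ → ℂ → ℂ) : Prop :=
  ∀ l, ∀ x ∈ Icc (0 : ℝ) 1, ∀ ρ ∈ Ω,
    U l x ρ = Complex.exp (ρ * (ω l - ω k) * ((x - basePoint k l : ℝ) : ℂ)) * β l ρ +
      ∫ t in basePoint k l..x, Complex.exp (ρ * (ω l - ω k) * ((x - t : ℝ) : ℂ)) *
        ∑ j, (ρ⁻¹ * a l j t + ρ⁻¹ ^ 3 * b l j t) * U j t ρ

/-- The initial values at the base points: those for which no boundary terms are left after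
integration by parts. -/
def initialValue (ω : Fin 4 → ℂ) (k : Fin 4) (a : Fin 4 → Fin 4 → ℝ → ℂ) (l : Fin 4) (ρ : ℂ) : ℂ :=
  if l = k then 1 else -(ρ⁻¹ ^ 2 * (a l k (basePoint k l) / (ω l - ω k)))

/-- The integral equations are solvable for large `ρ`, since their kernels are `O(ρ⁻¹)`. -/
lemma exists_isIntegralSolution (ω : Fin 4 → ℂ) (k : Fin 4) {a b : Fin 4 → Fin 4 → ℝ → ℂ}
    (ha : ∀ l j, Continuous (a l j)) (hb : ∀ l j, Continuous (b l j)) {C : ℝ} (hC : 0 ≤ C) :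
    ∃ R, 1 ≤ R ∧ ∃ U : Fin 4 → ℝ → ℂ → ℂ,
      (∀ l, ContinuousOn (fun p : ℝ × ℂ => U l p.1 p.2) (univ ×ˢ expRegion ω C R)) ∧
      (∀ l x, DifferentiableOn ℂ (U l x) (expRegion ω C R)) ∧
      (∀ l, UnifO (expRegion ω C R) 0 (U l)) ∧
      IsIntegralSolution ω k a b (initialValue ω k a) (expRegion ω C R) U := by
  obtain ⟨A, hA0, hA⟩ : ∃ A, 0 ≤ A ∧ ∀ l j, ∀ x ∈ Icc (0 : ℝ) 1, ‖a l j x‖ ≤ A ∧ ‖b l j x‖ ≤ A := by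
    have hc : Continuous fun x => ((fun p : Fin 4 × Fin 4 => a p.1 p.2 x),
        (fun p : Fin 4 × Fin 4 => b p.1 p.2 x)) := by
      refine Continuous.prodMk ?_ ?_
      · exact continuous_pi fun p => ha p.1 p.2
      · exact continuous_pi fun p => hb p.1 p.2
    obtain ⟨A, hA⟩ := isCompact_Icc.exists_bound_of_continuousOn
      (hc.continuousOn (s := Icc (0 : ℝ) 1))
    refine ⟨A, (norm_nonneg _).trans (hA 0 ⟨le_rfl, zero_le_one⟩), fun l j x hx => ⟨?_, ?_⟩⟩
    · exact (norm_le_pi_norm (fun p : Fin 4 × Fin 4 => a p.1 p.2 x) (l, j)).trans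
        ((norm_fst_le _).trans (hA x hx))
    · exact (norm_le_pi_norm (fun p : Fin 4 × Fin 4 => b p.1 p.2 x) (l, j)).trans
        ((norm_snd_le _).trans (hA x hx))
  -- each of the four kernels of a row is at most `2 A e^C / |ρ|`, and their sum has to be `≤ 1/2`
  set R : ℝ := 1 + 16 * Real.exp C * A with hR
  have hR1 : 1 ≤ R := by rw [hR]; have := Real.exp_pos C; nlinarith [mul_nonneg this.le hA0]
  set Ω := expRegion ω C R with hΩ
  have hinv : ∀ ρ ∈ Ω, ‖ρ⁻¹‖ ≤ 1 ∧ ρ ≠ 0 ∧ 16 * Real.exp C * A * ‖ρ⁻¹‖ ≤ 1 := by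
    intro ρ hρ
    have h1 : R < ‖ρ‖ := hρ.1
    have h0 : 0 < ‖ρ‖ := by linarith
    refine ⟨?_, norm_pos_iff.1 h0, ?_⟩
    · rw [norm_inv]; exact inv_le_one_of_one_le₀ (by linarith)
    · rw [norm_inv, ← div_eq_mul_inv, div_le_one h0]; linarith
  have hne : ∀ p ∈ (univ : Set ℝ) ×ˢ (univ : Set ℝ) ×ˢ Ω, p.2.2 ≠ 0 := fun p hp =>
    (hinv _ hp.2.2).2.1
  have hcinv : ContinuousOn (fun ρ : ℂ => ρ⁻¹) Ω :=
    continuousOn_inv₀.mono fun ρ hρ => (hinv ρ hρ).2.1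
  have hdinv : DifferentiableOn ℂ (fun ρ : ℂ => ρ⁻¹) Ω :=
    differentiableOn_inv.mono fun ρ hρ => (hinv ρ hρ).2.1
  have hβc : ∀ l, DifferentiableOn ℂ (initialValue ω k a l) Ω := by
    intro l
    unfold initialValue
    split_ifs
    · exact differentiableOn_const _
    · exact ((hdinv.pow 2).mul (differentiableOn_const _)).neg
  have hβB : ∃ B, 0 ≤ B ∧ ∀ l, ∀ ρ ∈ Ω, ‖initialValue ω k a l ρ‖ ≤ B := by
    refine ⟨1 + ∑ l, ‖a l k (basePoint k l) / (ω l - ω k)‖, by positivity, fun l ρ hρ => ?_⟩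
    have hs := Finset.single_le_sum (f := fun l => ‖a l k (basePoint k l) / (ω l - ω k)‖)
      (fun _ _ => norm_nonneg _) (Finset.mem_univ l)
    unfold initialValue
    split_ifs
    · rw [norm_one]
      have := (norm_nonneg _).trans hs
      linarith
    · rw [norm_neg, norm_mul, norm_pow]
      have h1 : ‖ρ⁻¹‖ ^ 2 ≤ 1 := pow_le_one₀ (norm_nonneg _) (hinv ρ hρ).1
      have := mul_le_mul_of_nonneg_right h1
        (norm_nonneg (a l k (basePoint k l) / (ω l - ω k)))
      linarith
  obtain ⟨B, hB0, hB⟩ := hβB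
  have hbase : ∀ l, basePoint k l ∈ Icc (0 : ℝ) 1 := basePoint_mem k
  obtain ⟨U, hUc, hUd, hUB, hU⟩ := exists_solution_integral_system (isOpen_expRegion ω C R)
    (s := basePoint k) hbase
    (K := fun l j x t ρ => Complex.exp (ρ * (ω l - ω k) * ((x - t : ℝ) : ℂ)) *
      (ρ⁻¹ * a l j t + ρ⁻¹ ^ 3 * b l j t))
    (f := fun l x ρ => Complex.exp (ρ * (ω l - ω k) * ((x - basePoint k l : ℝ) : ℂ)) *
      initialValue ω k a l ρ) (B := Real.exp C * B)
    (fun l j => by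
      have h1 : ContinuousOn (fun p : ℝ × ℝ × ℂ => p.2.2⁻¹) (univ ×ˢ univ ×ˢ Ω) :=
        hcinv.comp (by fun_prop) fun p hp => hp.2.2
      have h2 := ha l j
      have h3 := hb l j
      fun_prop)
    (fun l j x t => by fun_prop)
    (fun l => by
      have h1 : ContinuousOn (fun p : ℝ × ℂ => initialValue ω k a l p.2) (univ ×ˢ Ω) :=
        (hβc l).continuousOn.comp (by fun_prop) fun p hp => hp.2
      fun_prop)
    (fun l x => by
      have := hβc l
      fun_prop)
    (by positivity)
    (fun l x hx ρ hρ => by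
      rw [norm_mul]
      exact mul_le_mul (norm_exp_le hC hρ hx left_mem_uIcc) (hB l ρ hρ) (norm_nonneg _)
        (Real.exp_pos C).le)
    (fun l x hx t ht ρ hρ => by
      have htI : t ∈ Icc (0 : ℝ) 1 := uIcc_subset_Icc (hbase l) hx ht
      have h3 : ∀ j, ‖Complex.exp (ρ * (ω l - ω k) * ((x - t : ℝ) : ℂ)) *
          (ρ⁻¹ * a l j t + ρ⁻¹ ^ 3 * b l j t)‖ ≤ Real.exp C * (2 * A * ‖ρ⁻¹‖) := by
        intro j
        rw [norm_mul]
        refine mul_le_mul (norm_exp_le hC hρ hx ht) ?_ (norm_nonneg _) (Real.exp_pos C).le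
        have h4 : ‖ρ⁻¹‖ ^ 3 ≤ ‖ρ⁻¹‖ := pow_le_of_le_one (norm_nonneg _) (hinv ρ hρ).1 (by norm_num)
        calc _ ≤ ‖ρ⁻¹‖ * A + ‖ρ⁻¹‖ ^ 3 * A := by
              refine (norm_add_le _ _).trans ?_
              rw [norm_mul, norm_mul, norm_pow]
              gcongr
              · exact (hA l j t htI).1
              · exact (hA l j t htI).2
          _ ≤ ‖ρ⁻¹‖ * A + ‖ρ⁻¹‖ * A := by gcongr
          _ = _ := by ring
      refine (Finset.sum_le_sum fun j _ => h3 j).trans ?_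
      have := (hinv ρ hρ).2.2
      simp only [Finset.sum_const, Finset.card_univ, Fintype.card_fin, nsmul_eq_mul]
      push_cast
      linarith)
  refine ⟨R, hR1, U, hUc, hUd, fun l => ⟨2 * (Real.exp C * B), by positivity, fun ρ hρ x _ => ?_⟩,
    fun l x hx ρ hρ => ?_⟩
  · simpa using hUB l x ρ hρ
  · rw [hU l x hx ρ hρ]
    congr 1
    refine intervalIntegral.integral_congr fun t _ => ?_
    simp only [Finset.mul_sum, mul_assoc]

namespace IsIntegralSolution

variable {ω : Fin 4 → ℂ} {k : Fin 4} {a b : Fin 4 → Fin 4 → ℝ → ℂ} {β : Fin 4 → ℂ → ℂ}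
  {U : Fin 4 → ℝ → ℂ → ℂ} {C R : ℝ}

lemma continuous_forcing (ha : ∀ l j, Continuous (a l j)) (hb : ∀ l j, Continuous (b l j))
    {Ω : Set ℂ} (hUc : ∀ l, ContinuousOn (fun p : ℝ × ℂ => U l p.1 p.2) (univ ×ˢ Ω))
    {ρ : ℂ} (hρ : ρ ∈ Ω) (l : Fin 4) :
    (∀ j, Continuous fun t => U j t ρ) ∧
      Continuous fun t => ∑ j, (ρ⁻¹ * a l j t + ρ⁻¹ ^ 3 * b l j t) * U j t ρ := by
  have h : ∀ j, Continuous fun t => U j t ρ := fun j =>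
    (hUc j).comp_continuous (f := fun t : ℝ => (t, ρ)) (by fun_prop) fun t => ⟨trivial, hρ⟩
  refine ⟨h, ?_⟩
  have h1 := ha l
  have h2 := hb l
  fun_prop

/-- The differential form of the integral equations. -/
lemma hasDerivWithinAt (hU : IsIntegralSolution ω k a b β (expRegion ω C R) U)
    (ha : ∀ l j, Continuous (a l j)) (hb : ∀ l j, Continuous (b l j))
    (hUc : ∀ l, ContinuousOn (fun p : ℝ × ℂ => U l p.1 p.2) (univ ×ˢ expRegion ω C R))
    {ρ : ℂ} (hρ : ρ ∈ expRegion ω C R) (l : Fin 4) {x : ℝ} (hx : x ∈ Icc (0 : ℝ) 1) :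
    HasDerivWithinAt (fun x => U l x ρ) (ρ * (ω l - ω k) * U l x ρ +
      ∑ j, (ρ⁻¹ * a l j x + ρ⁻¹ ^ 3 * b l j x) * U j x ρ) (Icc 0 1) x :=
  hasDerivWithinAt_duhamel (continuous_forcing ha hb hUc hρ l).2.continuousOn (basePoint_mem k l)
    (fun x hx => hU l x hx ρ hρ) hx

end IsIntegralSolution

/-! ### Asymptotics of the amplitudes -/

namespace IsIntegralSolution

variable {ω : Fin 4 → ℂ} {k : Fin 4} {a b : Fin 4 → Fin 4 → ℝ → ℂ}
  {U : Fin 4 → ℝ → ℂ → ℂ} {C R : ℝ}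

/-- The part of the forcing term that does not contain the leading term `ρ⁻¹ a_{lk} U_k`. -/
def remainderForcing (k : Fin 4) (a b : Fin 4 → Fin 4 → ℝ → ℂ) (U : Fin 4 → ℝ → ℂ → ℂ)
    (l : Fin 4) (t : ℝ) (ρ : ℂ) : ℂ :=
  ρ⁻¹ * ∑ j ∈ Finset.univ.erase k, a l j t * U j t ρ + ρ⁻¹ ^ 3 * ∑ j, b l j t * U j t ρ

lemma forcing_eq (l : Fin 4) (t : ℝ) (ρ : ℂ) :
    ∑ j, (ρ⁻¹ * a l j t + ρ⁻¹ ^ 3 * b l j t) * U j t ρ =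
      ρ⁻¹ * (a l k t * U k t ρ) + remainderForcing k a b U l t ρ := by
  unfold remainderForcing
  have h : ∑ j, a l j t * U j t ρ =
      a l k t * U k t ρ + ∑ j ∈ Finset.univ.erase k, a l j t * U j t ρ :=
    (Finset.add_sum_erase _ _ (Finset.mem_univ k)).symm
  rw [← add_assoc, ← mul_add, ← h, Finset.mul_sum, Finset.mul_sum, ← Finset.sum_add_distrib]
  exact Finset.sum_congr rfl fun j _ => by ring

lemma unifO_remainderForcing (ha : ∀ l j, Continuous (a l j)) (hb : ∀ l j, Continuous (b l j))
    {Ω : Set ℂ} (h1 : ∀ ρ ∈ Ω, 1 ≤ ‖ρ‖) (hUB : ∀ l, UnifO Ω 0 (U l)) {n : ℕ} (hn : n ≤ 2)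
    (hUn : ∀ j, j ≠ k → UnifO Ω n (U j)) (l : Fin 4) :
    UnifO Ω (n + 1) (remainderForcing k a b U l) := by
  refine UnifO.add ?_ ?_
  · have := (UnifO.inv_pow (Ω := Ω) 1).mul (UnifO.sum (Finset.univ.erase k) fun j hj =>
      (UnifO.of_continuousOn (Ω := Ω) (ha l j).continuousOn).mul (hUn j (Finset.ne_of_mem_erase hj)))
    rw [zero_add, add_comm] at this
    simpa only [pow_one] using this
  · exact ((UnifO.inv_pow (Ω := Ω) 3).mul (UnifO.sum Finset.univ fun j _ =>
      (UnifO.of_continuousOn (Ω := Ω) (hb l j).continuousOn).mul (hUB j))).mono h1 (by omega)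

/-- Integration by parts in the off-diagonal equations: the boundary terms at the base point
cancel against the initial value. -/
lemma sub_leading_eq (hω : ∀ l, l ≠ k → ω l - ω k ≠ 0)
    (hU : IsIntegralSolution ω k a b (initialValue ω k a) (expRegion ω C R) U) (hR : 1 ≤ R)
    (ha : ∀ l j, Continuous (a l j)) (hb : ∀ l j, Continuous (b l j))
    (hUc : ∀ l, ContinuousOn (fun p : ℝ × ℂ => U l p.1 p.2) (univ ×ˢ expRegion ω C R))
    {g : Fin 4 → ℝ → ℂ} (hg : ∀ l, IntervalIntegrable (g l) volume 0 1)
    (hag : ∀ l, l ≠ k → ∀ x ∈ Icc (0 : ℝ) 1, a l k x = a l k 0 + ∫ t in (0 : ℝ)..x, g l t)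
    {l : Fin 4} (hl : l ≠ k) {ρ : ℂ} (hρ : ρ ∈ expRegion ω C R) {x : ℝ}
    (hx : x ∈ Icc (0 : ℝ) 1) :
    U l x ρ - ρ⁻¹ ^ 2 * (((∫ t in basePoint k l..x,
        Complex.exp (ρ * (ω l - ω k) * ((x - t : ℝ) : ℂ)) * g l t) - a l k x) / (ω l - ω k)) =
      ρ⁻¹ ^ 2 * ((((∫ t in basePoint k l..x, Complex.exp (ρ * (ω l - ω k) * ((x - t : ℝ) : ℂ)) *
            ((∑ j, (ρ⁻¹ * a k j t + ρ⁻¹ ^ 3 * b k j t) * U j t ρ) * a l k t))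
          - (U k x ρ - 1) * a l k x)
        + Complex.exp (ρ * (ω l - ω k) * ((x - basePoint k l : ℝ) : ℂ)) *
            ((U k (basePoint k l) ρ - 1) * a l k (basePoint k l))
        + ∫ t in basePoint k l..x, Complex.exp (ρ * (ω l - ω k) * ((x - t : ℝ) : ℂ)) *
            ((U k t ρ - 1) * g l t)) * (ω l - ω k)⁻¹)
      + ∫ t in basePoint k l..x, Complex.exp (ρ * (ω l - ω k) * ((x - t : ℝ) : ℂ)) *
            (remainderForcing k a b U l t ρ * 1) := by
  set s := basePoint k l with hs
  set d := ω l - ω k with hd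
  have hd0 : d ≠ 0 := hω l hl
  have hρ0 : ρ ≠ 0 := norm_pos_iff.1 (lt_trans (lt_of_lt_of_le one_pos hR) hρ.1)
  have hsI : s ∈ Icc (0 : ℝ) 1 := basePoint_mem k l
  obtain ⟨hUcont, hFk⟩ := continuous_forcing ha hb hUc hρ k
  set F : ℝ → ℂ := fun t => ∑ j, (ρ⁻¹ * a k j t + ρ⁻¹ ^ 3 * b k j t) * U j t ρ with hF
  set E : ℝ → ℂ := fun t => Complex.exp (ρ * d * ((x - t : ℝ) : ℂ)) with hE
  have hEc : Continuous E := by simp only [hE]; fun_prop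
  have hGc : Continuous fun t => remainderForcing k a b U l t ρ := by
    unfold remainderForcing
    have h1 := ha l
    have h2 := hb l
    fun_prop
  have hUk := hUcont k
  have halk := ha l k
  have hgi : IntervalIntegrable (g l) volume s x :=
    (hg l).mono_set (by rw [uIcc_of_le zero_le_one]; exact uIcc_subset_Icc hsI hx)
  have hφ : ∀ t ∈ Icc (0 : ℝ) 1, HasDerivWithinAt (fun t => E t * U k t ρ)
      (-(ρ * d) * (E t * U k t ρ) + E t * F t) (Icc 0 1) t := by
    intro t ht
    have h1 : HasDerivWithinAt E (E t * (ρ * d * (-1 : ℝ))) (Icc 0 1) t := by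
      refine HasDerivAt.hasDerivWithinAt (HasDerivAt.cexp ?_)
      exact (HasDerivAt.ofReal_comp ((hasDerivAt_id t).const_sub x)).const_mul (ρ * d)
    have h2 := hU.hasDerivWithinAt ha hb hUc hρ k ht
    convert! h1.fun_mul h2 using 1
    simp only [hF, sub_self, mul_zero, zero_mul, zero_add]
    push_cast
    ring
  have hibp := integral_deriv_mul_primitive (hg l) (hag l hl) hφ
    (Continuous.continuousOn (by fun_prop)) hsI hx
  have e1 : ∫ t in s..x, (-(ρ * d) * (E t * U k t ρ) + E t * F t) * a l k t =
      -(ρ * d) * (∫ t in s..x, E t * (a l k t * U k t ρ)) + ∫ t in s..x, E t * (F t * a l k t) := by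
    rw [← intervalIntegral.integral_const_mul, ← intervalIntegral.integral_add
      (Continuous.intervalIntegrable (by fun_prop) _ _)
      (Continuous.intervalIntegrable (by fun_prop) _ _)]
    exact intervalIntegral.integral_congr fun t _ => by ring
  have e2 : ∫ t in s..x, E t * U k t ρ * g l t =
      (∫ t in s..x, E t * g l t) + ∫ t in s..x, E t * ((U k t ρ - 1) * g l t) := by
    have i2 : IntervalIntegrable (fun t => E t * ((U k t ρ - 1) * g l t)) volume s x :=
      (hgi.continuousOn_mul
        (hUk.sub continuous_const).continuousOn).continuousOn_mul hEc.continuousOn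
    rw [← intervalIntegral.integral_add (hgi.continuousOn_mul hEc.continuousOn) i2]
    exact intervalIntegral.integral_congr fun t _ => by ring
  have e3 : ∫ t in s..x, E t * ∑ j, (ρ⁻¹ * a l j t + ρ⁻¹ ^ 3 * b l j t) * U j t ρ =
      ρ⁻¹ * (∫ t in s..x, E t * (a l k t * U k t ρ)) +
        ∫ t in s..x, E t * (remainderForcing k a b U l t ρ * 1) := by
    rw [← intervalIntegral.integral_const_mul, ← intervalIntegral.integral_add
      (Continuous.intervalIntegrable (by fun_prop) _ _)
      (Continuous.intervalIntegrable (by fun_prop) _ _)]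
    refine intervalIntegral.integral_congr fun t _ => ?_
    simp only [forcing_eq (k := k)]
    ring
  have e4 := hU l x hx ρ hρ
  rw [initialValue, if_neg hl, ← hs, ← hd] at e4
  have hEx : E x = 1 := by simp [hE]
  have hEs : E s = Complex.exp (ρ * d * ((x - s : ℝ) : ℂ)) := rfl
  rw [e1, e2, hEx] at hibp
  rw [e4, e3, ← hEs]
  set I0 := ∫ t in s..x, E t * (a l k t * U k t ρ) with hI0
  have hI : ρ⁻¹ * I0 = ρ⁻¹ ^ 2 * ((∫ t in s..x, E t * (F t * a l k t)) - (1 * U k x ρ * a l k x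
      - E s * U k s ρ * a l k s - ((∫ t in s..x, E t * g l t) +
        ∫ t in s..x, E t * ((U k t ρ - 1) * g l t)))) * d⁻¹ := by
    rw [← hibp, sub_add_cancel_right, neg_mul, neg_neg]
    field_simp
  rw [hI]
  ring

/-- Asymptotics of the system to the order `ρ⁻³`, uniformly on `[0,1]`. -/
theorem asymptotics (hω : ∀ l, l ≠ k → ω l - ω k ≠ 0)
    (hU : IsIntegralSolution ω k a b (initialValue ω k a) (expRegion ω C R) U) (hR : 1 ≤ R)
    (hC : 0 ≤ C) (ha : ∀ l j, Continuous (a l j)) (hb : ∀ l j, Continuous (b l j))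
    (hUc : ∀ l, ContinuousOn (fun p : ℝ × ℂ => U l p.1 p.2) (univ ×ˢ expRegion ω C R))
    (hUB : ∀ l, UnifO (expRegion ω C R) 0 (U l))
    {g : Fin 4 → ℝ → ℂ} (hg : ∀ l, IntervalIntegrable (g l) volume 0 1)
    (hag : ∀ l, l ≠ k → ∀ x ∈ Icc (0 : ℝ) 1, a l k x = a l k 0 + ∫ t in (0 : ℝ)..x, g l t) :
    (∀ l, l ≠ k → UnifO (expRegion ω C R) 2 (U l)) ∧
    (∀ l, l ≠ k → UnifO (expRegion ω C R) 3 (fun x ρ =>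
      U l x ρ - ρ⁻¹ ^ 2 * (((∫ t in basePoint k l..x,
        Complex.exp (ρ * (ω l - ω k) * ((x - t : ℝ) : ℂ)) * g l t) - a l k x) / (ω l - ω k)))) ∧
    UnifO (expRegion ω C R) 1 (fun x ρ => U k x ρ - 1) ∧
    UnifO (expRegion ω C R) 3 (fun x ρ =>
      U k x ρ - (1 + ρ⁻¹ * (∫ t in (0 : ℝ)..x, a k k t) +
        ρ⁻¹ ^ 2 * ∫ t in (0 : ℝ)..x, a k k t * ∫ u in (0 : ℝ)..t, a k k u)) := by
  set Ω := expRegion ω C R with hΩ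
  have h1 : ∀ ρ ∈ Ω, 1 ≤ ‖ρ‖ := fun ρ hρ => hR.trans hρ.1.le
  have hE : ∀ l, ∀ ρ ∈ Ω, ∀ x ∈ Icc (0 : ℝ) 1, ∀ t ∈ uIcc (basePoint k l) x,
      ‖Complex.exp (ρ * (ω l - ω k) * ((x - t : ℝ) : ℂ))‖ ≤ Real.exp C := fun l ρ hρ x hx t ht =>
    norm_exp_le hC hρ hx ht
  have hEs : ∀ l, UnifO Ω 0 (fun x ρ =>
      Complex.exp (ρ * (ω l - ω k) * ((x - basePoint k l : ℝ) : ℂ))) := fun l =>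
    ⟨Real.exp C, (Real.exp_pos C).le, fun ρ hρ x hx => by
      rw [pow_zero, mul_one]; exact hE l ρ hρ x hx _ left_mem_uIcc⟩
  have hai : ∀ l j, IntervalIntegrable (a l j) volume 0 1 := fun l j =>
    (ha l j).intervalIntegrable _ _
  have hF : UnifO Ω 1 (fun t ρ => ∑ j, (ρ⁻¹ * a k j t + ρ⁻¹ ^ 3 * b k j t) * U j t ρ) := by
    refine UnifO.congr (f := fun t ρ =>
      ρ⁻¹ * (a k k t * U k t ρ) + remainderForcing k a b U k t ρ) ?_ fun ρ _ t _ => forcing_eq k t ρ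
    refine UnifO.add ?_ (unifO_remainderForcing ha hb h1 hUB (Nat.zero_le 2) (fun j _ => hUB j) k)
    have := (UnifO.inv_pow (Ω := Ω) 1).mul
      ((UnifO.of_continuousOn (Ω := Ω) (ha k k).continuousOn).mul (hUB k))
    simpa only [pow_one] using this
  have hbk : basePoint k k = 0 := by simp [basePoint]
  have hUk : ∀ ρ ∈ Ω, ∀ x ∈ Icc (0 : ℝ) 1, U k x ρ = 1 +
      ∫ t in (0 : ℝ)..x, ∑ j, (ρ⁻¹ * a k j t + ρ⁻¹ ^ 3 * b k j t) * U j t ρ := by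
    intro ρ hρ x hx
    have := hU k x hx ρ hρ
    simpa [initialValue, hbk] using this
  have h0I : (0 : ℝ) ∈ Icc (0 : ℝ) 1 := ⟨le_rfl, zero_le_one⟩
  have hone : ∀ ρ ∈ Ω, ∀ x ∈ Icc (0 : ℝ) 1, ∀ t ∈ uIcc (0 : ℝ) x,
      ‖(fun (_ _ : ℝ) (_ : ℂ) => (1 : ℂ)) x t ρ‖ ≤ 1 := fun _ _ _ _ _ _ => norm_one.le
  have hD1 : UnifO Ω 1 (fun x ρ => U k x ρ - 1) := by
    refine (UnifO.integral h0I zero_le_one hone (w := fun _ => 1)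
      intervalIntegrable_const hF).congr fun ρ hρ x hx => ?_
    rw [hUk ρ hρ x hx]
    simp
  -- each pass through the off-diagonal equations improves the order of `U_l` by one
  have hstep : ∀ n ≤ 2, (∀ j, j ≠ k → UnifO Ω n (U j)) → ∀ l, l ≠ k →
      UnifO Ω (n + 1) (fun x ρ => U l x ρ - ρ⁻¹ ^ 2 * (((∫ t in basePoint k l..x,
        Complex.exp (ρ * (ω l - ω k) * ((x - t : ℝ) : ℂ)) * g l t) - a l k x) / (ω l - ω k))) := by
    intro n hn hUn l hl
    refine UnifO.congr ?_ fun ρ hρ x hx => sub_leading_eq hω hU hR ha hb hUc hg hag hl hρ hx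
    refine UnifO.add (UnifO.mono h1 (n := 2 + 1) (UnifO.mul (UnifO.inv_pow 2)
      (UnifO.mul (m := 0) (n := 1) (UnifO.add (UnifO.add (UnifO.sub ?_ ?_) ?_) ?_)
        (UnifO.const _))) (by omega)) ?_
    · exact UnifO.integral (basePoint_mem k l) (Real.exp_pos C).le (hE l) (hai l k) hF
    · exact hD1.mul (UnifO.of_continuousOn (ha l k).continuousOn)
    · have h2 := (hEs l).mul ((hD1.comp (basePoint_mem k l)).mul
        (UnifO.const (a l k (basePoint k l))))
      simpa only [zero_add, add_zero] using h2
    · exact UnifO.integral (basePoint_mem k l) (Real.exp_pos C).le (hE l) (hg l) hD1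
    · exact UnifO.integral (w := fun _ => 1) (basePoint_mem k l) (Real.exp_pos C).le (hE l)
        intervalIntegrable_const (unifO_remainderForcing ha hb h1 hUB hn hUn l)
  have hlead : ∀ l, UnifO Ω 2 (fun x ρ => ρ⁻¹ ^ 2 * (((∫ t in basePoint k l..x,
        Complex.exp (ρ * (ω l - ω k) * ((x - t : ℝ) : ℂ)) * g l t) - a l k x) / (ω l - ω k))) := by
    intro l
    have h2 := UnifO.integral (f := fun _ _ => 1) (n := 0) (basePoint_mem k l) (Real.exp_pos C).le
      (hE l) (hg l) (UnifO.const 1)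
    simp only [one_mul] at h2
    have h3 := (UnifO.inv_pow (Ω := Ω) 2).mul
      ((h2.sub (UnifO.of_continuousOn (ha l k).continuousOn)).mul (UnifO.const (ω l - ω k)⁻¹))
    simpa only [div_eq_mul_inv] using h3
  have hup : ∀ n, n ≤ 1 → (∀ j, j ≠ k → UnifO Ω n (U j)) → ∀ j, j ≠ k → UnifO Ω (n + 1) (U j) := by
    intro n hn hUn j hj
    refine ((hstep n (by omega) hUn j hj).add ((hlead j).mono h1 (by omega))).congr
      fun ρ _ x _ => ?_
    ring
  have hU2 := hup 1 le_rfl (hup 0 zero_le_one fun j _ => hUB j)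
  refine ⟨hU2, hstep 2 le_rfl hU2, hD1, ?_⟩
  have hRem : UnifO Ω 3 (fun x ρ => ∫ t in (0 : ℝ)..x, 1 * (remainderForcing k a b U k t ρ * 1)) :=
    UnifO.integral (w := fun _ => 1) h0I zero_le_one hone intervalIntegrable_const
      (unifO_remainderForcing ha hb h1 hUB le_rfl hU2 k)
  -- the `k`-th equation has no exponential factor: substituting an approximation `p` of order `n`
  -- into its right-hand side improves the order by one
  have hiter : ∀ p : ℝ → ℂ → ℂ, (∀ ρ, Continuous fun t => p t ρ) → ∀ n ≤ 2,
      UnifO Ω n (fun x ρ => U k x ρ - p x ρ) →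
      UnifO Ω (n + 1) (fun x ρ => U k x ρ - (1 + ρ⁻¹ * ∫ t in (0 : ℝ)..x, p t ρ * a k k t)) := by
    intro p hp n hn hpn
    have h2 := (UnifO.inv_pow (Ω := Ω) 1).mul (UnifO.integral h0I zero_le_one hone (hai k k) hpn)
    rw [add_comm] at h2
    refine (h2.add (hRem.mono h1 (by omega))).congr fun ρ hρ x hx => ?_
    obtain ⟨hUcont, -⟩ := continuous_forcing ha hb hUc hρ k
    have hUkc := hUcont k
    have hpc := hp ρ
    have hakk := ha k k
    have hGc : Continuous fun t => remainderForcing k a b U k t ρ := by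
      unfold remainderForcing
      have h1 := ha k
      have h2 := hb k
      fun_prop
    simp only [one_mul, mul_one, pow_one]
    have e1 : ∫ t in (0 : ℝ)..x, (U k t ρ - p t ρ) * a k k t =
        (∫ t in (0 : ℝ)..x, a k k t * U k t ρ) - ∫ t in (0 : ℝ)..x, p t ρ * a k k t := by
      rw [← intervalIntegral.integral_sub (Continuous.intervalIntegrable (by fun_prop) _ _)
        (Continuous.intervalIntegrable (by fun_prop) _ _)]
      exact intervalIntegral.integral_congr fun t _ => by ring
    have e2 : ∫ t in (0 : ℝ)..x, ∑ j, (ρ⁻¹ * a k j t + ρ⁻¹ ^ 3 * b k j t) * U j t ρ =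
        ρ⁻¹ * (∫ t in (0 : ℝ)..x, a k k t * U k t ρ) +
          ∫ t in (0 : ℝ)..x, remainderForcing k a b U k t ρ := by
      rw [← intervalIntegral.integral_const_mul, ← intervalIntegral.integral_add
        (Continuous.intervalIntegrable (by fun_prop) _ _)
        (Continuous.intervalIntegrable (by fun_prop) _ _)]
      exact intervalIntegral.integral_congr fun t _ => forcing_eq k t ρ
    rw [e1, hUk ρ hρ x hx, e2]
    ring
  have hprim : Continuous fun x => ∫ t in (0 : ℝ)..x, a k k t :=
    intervalIntegral.continuous_primitive (fun _ _ => (ha k k).intervalIntegrable _ _) 0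
  have hD2 := hiter (fun _ _ => 1) (fun _ => continuous_const) 1 one_le_two hD1
  simp only [one_mul] at hD2
  have hD3 := hiter (fun t ρ => 1 + ρ⁻¹ * ∫ u in (0 : ℝ)..t, a k k u) (fun ρ => by fun_prop) 2
    le_rfl hD2
  refine hD3.congr fun ρ _ x _ => ?_
  have hakk := ha k k
  have e : ∫ t in (0 : ℝ)..x, (1 + ρ⁻¹ * ∫ u in (0 : ℝ)..t, a k k u) * a k k t =
      (∫ t in (0 : ℝ)..x, a k k t) + ρ⁻¹ * ∫ t in (0 : ℝ)..x, a k k t * ∫ u in (0 : ℝ)..t, a k k u := by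
    rw [← intervalIntegral.integral_const_mul, ← intervalIntegral.integral_add
      (Continuous.intervalIntegrable (by fun_prop) _ _)
      (Continuous.intervalIntegrable (by fun_prop) _ _)]
    exact intervalIntegral.integral_congr fun t _ => by ring
  rw [e]
  ring

end IsIntegralSolution

/-! ### Coefficients -/

lemma IsL2.intervalIntegrable {f : ℝ → ℂ} (hf : IsL2 f) : IntervalIntegrable f volume 0 1 := by
  rw [intervalIntegrable_iff_integrableOn_Icc_of_le zero_le_one]
  exact MemLp.integrable one_le_two hf

lemma isL2_const (c : ℂ) : IsL2 fun _ => c := memLp_const c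

lemma intervalIntegrable_of_mem {g : ℝ → ℂ} (hg : IntervalIntegrable g volume 0 1) {x : ℝ}
    (hx : x ∈ Icc (0 : ℝ) 1) : IntervalIntegrable g volume 0 x :=
  hg.mono_set (by
    rw [uIcc_of_le zero_le_one]
    exact uIcc_subset_Icc ⟨le_rfl, zero_le_one⟩ hx)

namespace IsW12

lemma add {f g : ℝ → ℂ} (hf : IsW12 f) (hg : IsW12 g) : IsW12 fun x => f x + g x := by
  obtain ⟨u, hu, hfu⟩ := hf
  obtain ⟨v, hv, hgv⟩ := hg
  refine ⟨fun t => u t + v t, MemLp.add hu hv, fun x hx => ?_⟩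
  beta_reduce
  rw [hfu x hx, hgv x hx, intervalIntegral.integral_add
    (intervalIntegrable_of_mem hu.intervalIntegrable hx)
    (intervalIntegrable_of_mem hv.intervalIntegrable hx)]
  ring

lemma const_mul {f : ℝ → ℂ} (c : ℂ) (hf : IsW12 f) : IsW12 fun x => c * f x := by
  obtain ⟨u, hu, hfu⟩ := hf
  refine ⟨fun t => c * u t, MemLp.const_mul hu c, fun x hx => ?_⟩
  beta_reduce
  rw [hfu x hx, intervalIntegral.integral_const_mul]
  ring

lemma continuousOn {f : ℝ → ℂ} (hf : IsW12 f) : ContinuousOn f (Icc 0 1) := by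
  obtain ⟨u, hu, hfu⟩ := hf
  have h := (absolutelyContinuousOnInterval_primitive hu.intervalIntegrable (c := 0)
    (by simp)).continuousOn
  rw [uIcc_of_le zero_le_one] at h
  exact (h.const_add (f 0)).congr hfu

end IsW12

lemma isW12_sigma1 {τ₁ : ℝ → ℂ} (h : IsL2 τ₁) : IsW12 (sigma1 τ₁) :=
  ⟨τ₁, h, fun x _ => by simp [sigma1]⟩

lemma isW12_sigma0 {r₀ : ℝ → ℂ} (h : IsL2 r₀) : IsW12 (sigma0 r₀) := by
  refine ⟨fun t => r₀ t - ∫ t in (0 : ℝ)..1, r₀ t, MemLp.sub h (isL2_const _), fun x hx => ?_⟩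
  rw [intervalIntegral.integral_sub (intervalIntegrable_of_mem h.intervalIntegrable hx)
    intervalIntegrable_const, intervalIntegral.integral_const]
  simp [sigma0]

/-! ### The matrix of the roots of unity -/

section coefficients

variable {ω : Fin 4 → ℂ}

lemma root_ne_zero (hω4 : ∀ k, ω k ^ 4 = 1) (k : Fin 4) : ω k ≠ 0 := fun h => by
  have := hω4 k
  rw [h] at this
  norm_num at this

/-- The inverse of `Ω`: its entries are `ω_l^{-j} / 4`. -/
lemma omegaMatrix_inv (hω4 : ∀ k, ω k ^ 4 = 1) (hinj : Function.Injective ω) :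
    (omegaMatrix ω)⁻¹ = Matrix.of (fun l j : Fin 4 => (ω l ^ (j : ℕ))⁻¹ / 4) ∧
      omegaMatrix ω * (omegaMatrix ω)⁻¹ = 1 ∧ (omegaMatrix ω)⁻¹ * omegaMatrix ω = 1 := by
  have hleft : Matrix.of (fun l j : Fin 4 => (ω l ^ (j : ℕ))⁻¹ / 4) * omegaMatrix ω = 1 := by
    ext l k
    have hl := root_ne_zero hω4 l
    rw [Matrix.mul_apply, Fin.sum_univ_four, Matrix.one_apply]
    simp only [omegaMatrix, Matrix.of_apply]
    split_ifs with h
    · subst h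
      simp only [Fin.val_zero, Fin.val_one, Fin.val_two, show ((3 : Fin 4) : ℕ) = 3 from rfl]
      field_simp
      norm_num
    · have hq : ω k / ω l ≠ 1 := fun hq => h (hinj ((div_eq_one_iff_eq hl).1 hq)).symm
      have h4 : (ω k / ω l) ^ 4 = 1 := by rw [div_pow, hω4, hω4, div_one]
      have hs : 1 + ω k / ω l + (ω k / ω l) ^ 2 + (ω k / ω l) ^ 3 = 0 := by
        have : (ω k / ω l - 1) * (1 + ω k / ω l + (ω k / ω l) ^ 2 + (ω k / ω l) ^ 3) = 0 := by
          linear_combination h4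
        exact (mul_eq_zero.1 this).resolve_left (sub_ne_zero.2 hq)
      simp only [Fin.val_zero, Fin.val_one, Fin.val_two, show ((3 : Fin 4) : ℕ) = 3 from rfl]
      simp only [div_pow] at hs
      linear_combination (1 / 4) * hs
  have hinv := Matrix.inv_eq_left_inv hleft
  refine ⟨hinv, ?_, by rw [hinv]; exact hleft⟩
  rw [hinv]
  exact mul_eq_one_comm.1 hleft

/-- The lower subdiagonal part of the associated matrix, which enters with the factor `ρ⁻¹`. -/
def subdiagMatrix (τ₂ τ₁ r₀ : ℝ → ℂ) (x : ℝ) : Matrix (Fin 4) (Fin 4) ℂ :=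
  !![0, 0, 0, 0;
     -(sigma1 τ₁ x + sigma0 r₀ x), 0, 0, 0;
     0, -τ₂ x + 2 * sigma0 r₀ x, 0, 0;
     0, 0, sigma1 τ₁ x - sigma0 r₀ x, 0]

/-- The corner of the associated matrix, which enters with the factor `ρ⁻³`. -/
def cornerMatrix (τ₁ r₀ : ℝ → ℂ) (x : ℝ) : Matrix (Fin 4) (Fin 4) ℂ :=
  !![0, 0, 0, 0; 0, 0, 0, 0; 0, 0, 0, 0; sigma0 r₀ x ^ 2 - sigma1 τ₁ x ^ 2, 0, 0, 0]

/-- The corner matrix in the coordinates that diagonalize the principal part. -/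
def matrixB (ω : Fin 4 → ℂ) (τ₁ r₀ : ℝ → ℂ) (x : ℝ) : Matrix (Fin 4) (Fin 4) ℂ :=
  (omegaMatrix ω)⁻¹ * cornerMatrix τ₁ r₀ x * omegaMatrix ω

variable {τ₂ τ₁ r₀ : ℝ → ℂ}

lemma matrixA2_apply (x : ℝ) (l k : Fin 4) :
    matrixA2 ω τ₂ τ₁ r₀ x l k =
      (-((omegaMatrix ω)⁻¹ l 1 * omegaMatrix ω 0 k) + (omegaMatrix ω)⁻¹ l 3 * omegaMatrix ω 2 k)
        * sigma1 τ₁ x +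
      ((-((omegaMatrix ω)⁻¹ l 1 * omegaMatrix ω 0 k) + 2 * ((omegaMatrix ω)⁻¹ l 2 *
        omegaMatrix ω 1 k) - (omegaMatrix ω)⁻¹ l 3 * omegaMatrix ω 2 k) * sigma0 r₀ x +
      -((omegaMatrix ω)⁻¹ l 2 * omegaMatrix ω 1 k) * τ₂ x) := by
  simp only [matrixA2, Matrix.mul_apply, Fin.sum_univ_four]
  simp
  ring

lemma isW12_matrixA2 (hτ₂ : IsW12 τ₂) (hτ₁ : IsL2 τ₁) (hr₀ : IsL2 r₀) (l k : Fin 4) :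
    IsW12 fun x => matrixA2 ω τ₂ τ₁ r₀ x l k := by
  simp only [matrixA2_apply]
  exact ((isW12_sigma1 hτ₁).const_mul _).add
    (((isW12_sigma0 hr₀).const_mul _).add (hτ₂.const_mul _))

lemma continuousOn_matrixB (hτ₁ : IsL2 τ₁) (hr₀ : IsL2 r₀) (l k : Fin 4) :
    ContinuousOn (fun x => matrixB ω τ₁ r₀ x l k) (Icc 0 1) := by
  have h1 := (isW12_sigma1 hτ₁).continuousOn
  have h0 := (isW12_sigma0 hr₀).continuousOn
  have : ∀ x, matrixB ω τ₁ r₀ x l k =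
      (omegaMatrix ω)⁻¹ l 3 * (sigma0 r₀ x ^ 2 - sigma1 τ₁ x ^ 2) * omegaMatrix ω 0 k := by
    intro x
    simp only [matrixB, cornerMatrix, Matrix.mul_apply, Fin.sum_univ_four]
    simp
  simp only [this]
  fun_prop

lemma matrixA2_diag (hω4 : ∀ k, ω k ^ 4 = 1) (hinj : Function.Injective ω) (x : ℝ) (k : Fin 4) :
    matrixA2 ω τ₂ τ₁ r₀ x k k = -(τ₂ x / (4 * ω k)) := by
  have hk := root_ne_zero hω4 k
  rw [matrixA2_apply, (omegaMatrix_inv hω4 hinj).1]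
  simp only [omegaMatrix, Matrix.of_apply, Fin.val_zero, Fin.val_one, Fin.val_two,
    show ((3 : Fin 4) : ℕ) = 3 from rfl]
  field_simp
  ring

lemma sum_omega_matrixA2 (hω4 : ∀ k, ω k ^ 4 = 1) (hinj : Function.Injective ω) (x : ℝ)
    (i j : Fin 4) : ∑ l, ω l ^ (i : ℕ) * matrixA2 ω τ₂ τ₁ r₀ x l j =
      (subdiagMatrix τ₂ τ₁ r₀ x * omegaMatrix ω) i j := by
  have : omegaMatrix ω * matrixA2 ω τ₂ τ₁ r₀ x = subdiagMatrix τ₂ τ₁ r₀ x * omegaMatrix ω := by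
    rw [matrixA2, ← Matrix.mul_assoc, ← Matrix.mul_assoc, (omegaMatrix_inv hω4 hinj).2.1,
      Matrix.one_mul]
    rfl
  rw [← this, Matrix.mul_apply]
  rfl

lemma sum_omega_matrixB (hω4 : ∀ k, ω k ^ 4 = 1) (hinj : Function.Injective ω) (x : ℝ)
    (i j : Fin 4) : ∑ l, ω l ^ (i : ℕ) * matrixB ω τ₁ r₀ x l j =
      (cornerMatrix τ₁ r₀ x * omegaMatrix ω) i j := by
  have : omegaMatrix ω * matrixB ω τ₁ r₀ x = cornerMatrix τ₁ r₀ x * omegaMatrix ω := by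
    rw [matrixB, ← Matrix.mul_assoc, ← Matrix.mul_assoc, (omegaMatrix_inv hω4 hinj).2.1,
      Matrix.one_mul]
  rw [← this, Matrix.mul_apply]
  rfl

end coefficients

/-! ### The first-order system -/

lemma quasiDeriv_zero (F : ℝ → Matrix (Fin 4) (Fin 4) ℂ) (y : ℝ → ℂ) : quasiDeriv F y 0 = y := by
  rw [quasiDeriv]

/-- `Y` solves on `[0,1]` the first-order system `Y' = (F + μ E₄₁) Y` equivalent to
`y^[4] = μ y`. -/
def IsSystemSolution (F : ℝ → Matrix (Fin 4) (Fin 4) ℂ) (μ : ℂ) (Y : Fin 4 → ℝ → ℂ) : Prop :=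
  ∀ i, ∀ x ∈ Icc (0 : ℝ) 1, HasDerivWithinAt (Y i)
    (∑ j, F x i j * Y j x + if i = 3 then μ * Y 0 x else 0) (Icc 0 1) x

namespace IsSystemSolution

variable {F : ℝ → Matrix (Fin 4) (Fin 4) ℂ} {μ : ℂ} {Y : Fin 4 → ℝ → ℂ}

lemma linear_comb {Z : Fin 4 → Fin 4 → ℝ → ℂ} (h : ∀ k, IsSystemSolution F μ (Z k))
    (c : Fin 4 → ℂ) : IsSystemSolution F μ (fun i x => ∑ k, c k * Z k i x) := by
  intro i x hx
  have h1 := HasDerivWithinAt.fun_sum (u := Finset.univ)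
    fun k _ => (h k i x hx).const_mul (c k)
  convert! h1 using 1
  have e : ∀ k, c k * (∑ j, F x i j * Z k j x + if i = 3 then μ * Z k 0 x else 0) =
      ∑ j, F x i j * (c k * Z k j x) + if i = 3 then μ * (c k * Z k 0 x) else 0 := by
    intro k
    rw [mul_add, Finset.mul_sum]
    congr 1
    · exact Finset.sum_congr rfl fun j _ => by ring
    · split_ifs <;> ring
  simp only [e, Finset.sum_add_distrib, Finset.mul_sum]
  rw [Finset.sum_comm]
  congr 1
  split_ifs <;> simp

lemma sub {Y' : Fin 4 → ℝ → ℂ} (h : IsSystemSolution F μ Y) (h' : IsSystemSolution F μ Y') :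
    IsSystemSolution F μ (fun i x => Y i x - Y' i x) := by
  intro i x hx
  convert! (h i x hx).fun_sub (h' i x hx) using 1
  simp only [mul_sub, Finset.sum_sub_distrib]
  split_ifs <;> ring

/-- Uniqueness of the initial value problem. -/
lemma eq_zero (hF : ∀ i j, ContinuousOn (fun x => F x i j) (Icc 0 1))
    (h : IsSystemSolution F μ Y) (h0 : ∀ i, Y i 0 = 0) :
    ∀ i, ∀ x ∈ Icc (0 : ℝ) 1, Y i x = 0 := by
  obtain ⟨A, hA⟩ : ∃ A, ∀ x ∈ Icc (0 : ℝ) 1, ‖(fun p : Fin 4 × Fin 4 => F x p.1 p.2)‖ ≤ A :=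
    isCompact_Icc.exists_bound_of_continuousOn (continuousOn_pi.2 fun p => hF p.1 p.2)
  have hA' : ∀ x ∈ Icc (0 : ℝ) 1, ∀ i j, ‖F x i j‖ ≤ A := fun x hx i j =>
    (norm_le_pi_norm (fun p : Fin 4 × Fin 4 => F x p.1 p.2) (i, j)).trans (hA x hx)
  have hA0 : 0 ≤ A := (norm_nonneg _).trans (hA' 0 ⟨le_rfl, zero_le_one⟩ 0 0)
  set v : ℝ → (Fin 4 → ℂ) → (Fin 4 → ℂ) := fun x y i =>
    ∑ j, F x i j * y j + if i = 3 then μ * y 0 else 0 with hv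
  have hlip : ∀ x ∈ Ico (0 : ℝ) 1,
      LipschitzOnWith (Real.toNNReal (4 * A + ‖μ‖)) (v x) univ := by
    intro x hx
    refine LipschitzWith.lipschitzOnWith (LipschitzWith.of_dist_le_mul fun y z => ?_)
    rw [Real.coe_toNNReal _ (by positivity), dist_eq_norm, dist_eq_norm,
      pi_norm_le_iff_of_nonneg (by positivity)]
    intro i
    have e : (v x y - v x z) i =
        ∑ j, F x i j * (y - z) j + if i = 3 then μ * (y - z) 0 else 0 := by
      simp only [hv, Pi.sub_apply, mul_sub, Finset.sum_sub_distrib]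
      split_ifs <;> ring
    rw [e, add_mul]
    refine (norm_add_le _ _).trans (add_le_add ?_ ?_)
    · calc _ ≤ ∑ j : Fin 4, A * ‖y - z‖ := by
            refine (norm_sum_le _ _).trans (Finset.sum_le_sum fun j _ => ?_)
            rw [norm_mul]
            exact mul_le_mul (hA' x ⟨hx.1, hx.2.le⟩ i j) (norm_le_pi_norm _ j) (norm_nonneg _) hA0
        _ = _ := by simp; ring
    · split_ifs
      · rw [norm_mul]
        gcongr
        exact norm_le_pi_norm (y - z) 0
      · rw [norm_zero]
        positivity
  have hY : ∀ x ∈ Icc (0 : ℝ) 1,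
      HasDerivWithinAt (fun x i => Y i x) (v x (fun i => Y i x)) (Icc 0 1) x := fun x hx =>
    hasDerivWithinAt_pi.2 fun i => h i x hx
  have hz : ∀ x, HasDerivWithinAt (fun (_ : ℝ) (_ : Fin 4) => (0 : ℂ)) (v x 0) (Ici x) x := by
    intro x
    have : v x 0 = 0 := by ext i; simp [hv]
    rw [this]
    exact hasDerivWithinAt_const _ _ _
  have heq := ODE_solution_unique_of_mem_Icc_right (v := v) (s := fun _ => univ) hlip
    (fun x hx => (hY x hx).continuousWithinAt)
    (fun x hx => (hY x ⟨hx.1, hx.2.le⟩).mono_of_mem_nhdsWithin (Icc_mem_nhdsGE_of_mem hx))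
    (fun _ _ => trivial) continuousOn_const (fun x _ => hz x) (fun _ _ => trivial)
    (funext fun i => h0 i)
  intro i x hx
  exact congrFun (heq hx) i

end IsSystemSolution

section assoc

variable {τ₂ τ₁ r₀ : ℝ → ℂ} {μ : ℂ} {Y : Fin 4 → ℝ → ℂ}

lemma continuousOn_assocMatrix (hτ₂ : IsW12 τ₂) (hτ₁ : IsL2 τ₁) (hr₀ : IsL2 r₀) (i j : Fin 4) :
    ContinuousOn (fun x => assocMatrix τ₂ τ₁ r₀ x i j) (Icc 0 1) := by
  have h1 := (isW12_sigma1 hτ₁).continuousOn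
  have h0 := (isW12_sigma0 hr₀).continuousOn
  have h2 := hτ₂.continuousOn
  fin_cases i <;> fin_cases j <;> simp [assocMatrix] <;> fun_prop

lemma assocMatrix_sum (x : ℝ) (v : Fin 4 → ℂ) :
    (∑ j, assocMatrix τ₂ τ₁ r₀ x 0 j * v j = assocMatrix τ₂ τ₁ r₀ x 0 0 * v 0 + v 1) ∧
    (∑ j, assocMatrix τ₂ τ₁ r₀ x 1 j * v j = assocMatrix τ₂ τ₁ r₀ x 1 0 * v 0 +
      assocMatrix τ₂ τ₁ r₀ x 1 1 * v 1 + v 2) ∧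
    (∑ j, assocMatrix τ₂ τ₁ r₀ x 2 j * v j = assocMatrix τ₂ τ₁ r₀ x 2 0 * v 0 +
      assocMatrix τ₂ τ₁ r₀ x 2 1 * v 1 + assocMatrix τ₂ τ₁ r₀ x 2 2 * v 2 + v 3) := by
  simp [assocMatrix, Fin.sum_univ_four]

/-- The components of a solution of the system are the quasi-derivatives of the first one. -/
lemma IsSystemSolution.quasiDeriv_eq (h : IsSystemSolution (assocMatrix τ₂ τ₁ r₀) μ Y) :
    (∀ i : Fin 4, ∀ x ∈ Icc (0 : ℝ) 1,
      quasiDeriv (assocMatrix τ₂ τ₁ r₀) (Y 0) i x = Y i x) ∧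
    ∀ x ∈ Icc (0 : ℝ) 1, quasiDeriv (assocMatrix τ₂ τ₁ r₀) (Y 0) 4 x = μ * Y 0 x := by
  set F := assocMatrix τ₂ τ₁ r₀ with hF
  have hd : ∀ (i : Fin 4) (f : ℝ → ℂ), (∀ x ∈ Icc (0 : ℝ) 1, f x = Y i x) →
      ∀ x ∈ Icc (0 : ℝ) 1, derivWithin f (Icc 0 1) x =
        ∑ j, F x i j * Y j x + if i = 3 then μ * Y 0 x else 0 := by
    intro i f hf x hx
    rw [derivWithin_congr hf (hf x hx)]
    exact (h i x hx).derivWithin (uniqueDiffOn_Icc zero_lt_one x hx)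
  have q0 : ∀ x ∈ Icc (0 : ℝ) 1, quasiDeriv F (Y 0) 0 x = Y 0 x := fun x _ => by
    rw [quasiDeriv_zero]
  have q1 : ∀ x ∈ Icc (0 : ℝ) 1, quasiDeriv F (Y 0) 1 x = Y 1 x := by
    intro x hx
    rw [quasiDeriv]
    beta_reduce
    rw [hd 0 _ q0 x hx, q0 x hx, (assocMatrix_sum x _).1]
    simp [hF]
  have q2 : ∀ x ∈ Icc (0 : ℝ) 1, quasiDeriv F (Y 0) 2 x = Y 2 x := by
    intro x hx
    rw [quasiDeriv]
    beta_reduce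
    rw [hd 1 _ q1 x hx, q0 x hx, q1 x hx, (assocMatrix_sum x _).2.1]
    simp [hF]
  have q3 : ∀ x ∈ Icc (0 : ℝ) 1, quasiDeriv F (Y 0) 3 x = Y 3 x := by
    intro x hx
    rw [quasiDeriv]
    beta_reduce
    rw [hd 2 _ q2 x hx, q0 x hx, q1 x hx, q2 x hx, (assocMatrix_sum x _).2.2]
    simp [hF]
  refine ⟨fun i => ?_, fun x hx => ?_⟩
  · fin_cases i
    exacts [q0, q1, q2, q3]
  · rw [quasiDeriv]
    beta_reduce
    rw [hd 3 _ q3 x hx, q0 x hx, q1 x hx, q2 x hx, q3 x hx, Fin.sum_univ_four]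
    simp

lemma IsSystemSolution.isSolution (hτ₂ : IsW12 τ₂) (hτ₁ : IsL2 τ₁) (hr₀ : IsL2 r₀)
    (h : IsSystemSolution (assocMatrix τ₂ τ₁ r₀) μ Y) :
    IsSolution (assocMatrix τ₂ τ₁ r₀) μ (Y 0) := by
  have hYc : ∀ i, ContinuousOn (Y i) (Icc 0 1) := fun i x hx => (h i x hx).continuousWithinAt
  have hac : ∀ i, AbsolutelyContinuousOnInterval (Y i) 0 1 := by
    intro i
    refine absolutelyContinuousOnInterval_of_hasDerivWithinAt (h i) ?_
    refine ContinuousOn.add (continuousOn_finsetSum _ fun j _ =>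
      (continuousOn_assocMatrix hτ₂ hτ₁ hr₀ i j).mul (hYc j)) ?_
    split_ifs
    · exact continuousOn_const.mul (hYc 0)
    · exact continuousOn_const
  refine ⟨fun j hj => ?_, ?_⟩
  · refine absolutelyContinuousOnInterval_of_dist_le (hac ⟨j, hj⟩) fun x hx y hy => ?_
    rw [uIcc_of_le zero_le_one] at hx hy
    exact (congrArg₂ dist (h.quasiDeriv_eq.1 ⟨j, hj⟩ x hx) (h.quasiDeriv_eq.1 ⟨j, hj⟩ y hy)).le
  · rw [ae_restrict_iff' measurableSet_Icc]
    exact Filter.Eventually.of_forall fun x hx => h.quasiDeriv_eq.2 x hx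

/-- Conversely, the quasi-derivatives of a solution form a solution of the system: all of them are
continuously differentiable, since the entries of the associated matrix are continuous. -/
lemma IsSolution.isSystemSolution (hτ₂ : IsW12 τ₂) (hτ₁ : IsL2 τ₁) (hr₀ : IsL2 r₀) {z : ℝ → ℂ}
    (h : IsSolution (assocMatrix τ₂ τ₁ r₀) μ z) :
    IsSystemSolution (assocMatrix τ₂ τ₁ r₀) μ
      (fun i => quasiDeriv (assocMatrix τ₂ τ₁ r₀) z i) := by
  obtain ⟨hac, heq⟩ := h
  have hFc := continuousOn_assocMatrix hτ₂ hτ₁ hr₀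
  have hac' : ∀ i : Fin 4, AbsolutelyContinuousOnInterval
    (quasiDeriv (assocMatrix τ₂ τ₁ r₀) z i) 0 1 := fun i => hac i i.2
  have hc : ∀ i : Fin 4, ContinuousOn (quasiDeriv (assocMatrix τ₂ τ₁ r₀) z i) (Icc 0 1) :=
    fun i => by simpa only [uIcc_of_le zero_le_one (α := ℝ)] using (hac' i).continuousOn
  intro i
  refine hasDerivWithinAt_of_ae_eq (hac' i) (G := fun x => ∑ j : Fin 4, assocMatrix τ₂ τ₁ r₀ x i j *
    quasiDeriv (assocMatrix τ₂ τ₁ r₀) z j x +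
      if i = 3 then μ * quasiDeriv (assocMatrix τ₂ τ₁ r₀) z (0 : Fin 4) x else 0) ?_ ?_
  · refine ContinuousOn.add (continuousOn_finsetSum _ fun j _ => (hFc i j).mul (hc j)) ?_
    split_ifs
    · exact continuousOn_const.mul (hc 0)
    · exact continuousOn_const
  · filter_upwards [heq] with x hx
    have hs := assocMatrix_sum (τ₂ := τ₂) (τ₁ := τ₁) (r₀ := r₀) x
      fun j => quasiDeriv (assocMatrix τ₂ τ₁ r₀) z j x
    fin_cases i
    · simp only [Fin.zero_eta, Fin.isValue, hs.1]
      simp [quasiDeriv]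
    · simp only [Fin.mk_one, Fin.isValue, hs.2.1]
      simp [quasiDeriv]
    · simp only [Fin.reduceFinMk, Fin.isValue, hs.2.2]
      simp [quasiDeriv]
    · rw [quasiDeriv] at hx
      beta_reduce at hx
      rw [Fin.sum_univ_four]
      simp only [Fin.reduceFinMk, Fin.isValue, if_true, Fin.val_zero, Fin.val_one, Fin.val_two,
        show ((3 : Fin 4) : ℕ) = 3 from rfl]
      rw [quasiDeriv_zero] at hx ⊢
      linear_combination hx

/-- A solution of the system whose first component vanishes is zero. -/
lemma IsSystemSolution.eq_zero_of_first (h : IsSystemSolution (assocMatrix τ₂ τ₁ r₀) μ Y)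
    (h0 : ∀ x ∈ Icc (0 : ℝ) 1, Y 0 x = 0) : ∀ i, ∀ x ∈ Icc (0 : ℝ) 1, Y i x = 0 := by
  have hd : ∀ i, (∀ x ∈ Icc (0 : ℝ) 1, Y i x = 0) → ∀ x ∈ Icc (0 : ℝ) 1,
      ∑ j, assocMatrix τ₂ τ₁ r₀ x i j * Y j x + (if i = 3 then μ * Y 0 x else 0) = 0 := by
    intro i hi x hx
    have h1 := (h i x hx).derivWithin (uniqueDiffOn_Icc zero_lt_one x hx)
    rw [← h1, derivWithin_congr hi (hi x hx), derivWithin_fun_const]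
    rfl
  have q1 : ∀ x ∈ Icc (0 : ℝ) 1, Y 1 x = 0 := by
    intro x hx
    have := hd 0 h0 x hx
    rw [(assocMatrix_sum x fun j => Y j x).1] at this
    simpa [h0 x hx] using this
  have q2 : ∀ x ∈ Icc (0 : ℝ) 1, Y 2 x = 0 := by
    intro x hx
    have := hd 1 q1 x hx
    rw [(assocMatrix_sum x fun j => Y j x).2.1] at this
    simpa [h0 x hx, q1 x hx] using this
  have q3 : ∀ x ∈ Icc (0 : ℝ) 1, Y 3 x = 0 := by
    intro x hx
    have := hd 2 q2 x hx
    rw [(assocMatrix_sum x fun j => Y j x).2.2] at this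
    simpa [h0 x hx, q1 x hx, q2 x hx] using this
  intro i
  fin_cases i
  exacts [h0, q1, q2, q3]

/-- Solutions of the system whose initial vectors are linearly independent give a fundamental
system of solutions of the equation. -/
lemma isFundamentalSystem_of_independent (hτ₂ : IsW12 τ₂) (hτ₁ : IsL2 τ₁) (hr₀ : IsL2 r₀)
    {Z : Fin 4 → Fin 4 → ℝ → ℂ} (h : ∀ k, IsSystemSolution (assocMatrix τ₂ τ₁ r₀) μ (Z k))
    (hind : ∀ c : Fin 4 → ℂ, (∀ i, ∑ k, c k * Z k i 0 = 0) → c = 0) :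
    IsFundamentalSystem (assocMatrix τ₂ τ₁ r₀) μ (fun k => Z k 0) := by
  have h0I : (0 : ℝ) ∈ Icc (0 : ℝ) 1 := ⟨le_rfl, zero_le_one⟩
  refine ⟨fun k => (h k).isSolution hτ₂ hτ₁ hr₀, fun c hc => ?_, fun z hz => ?_⟩
  · exact hind c fun i =>
      (IsSystemSolution.linear_comb h c).eq_zero_of_first hc i 0 h0I
  · have hzs := hz.isSystemSolution hτ₂ hτ₁ hr₀
    let N : Matrix (Fin 4) (Fin 4) ℂ := Matrix.of fun i k => Z k i 0
    have hinj : Function.Injective N.mulVecLin := by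
      rw [← LinearMap.ker_eq_bot, LinearMap.ker_eq_bot']
      intro c hc
      refine hind c fun i => ?_
      have := congrFun hc i
      simp only [Matrix.mulVecLin_apply, Matrix.mulVec, dotProduct, Pi.zero_apply] at this
      rw [← this]
      exact Finset.sum_congr rfl fun k _ => mul_comm _ _
    obtain ⟨c, hc⟩ := LinearMap.injective_iff_surjective.1 hinj
      fun i : Fin 4 => quasiDeriv (assocMatrix τ₂ τ₁ r₀) z i 0
    refine ⟨c, fun x hx => ?_⟩
    have := (hzs.sub (IsSystemSolution.linear_comb h c)).eq_zero
      (continuousOn_assocMatrix hτ₂ hτ₁ hr₀) (fun i => by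
        have := congrFun hc i
        simp only [Matrix.mulVecLin_apply, Matrix.mulVec, dotProduct] at this
        rw [← this, sub_eq_zero]
        exact Finset.sum_congr rfl fun k _ => mul_comm _ _) 0 x hx
    rw [Fin.val_zero, quasiDeriv_zero] at this
    exact sub_eq_zero.1 this

end assoc

/-! ### The vector of quasi-derivatives -/

/-- The vector `e^{ρ ω_k x} diag(1, ρ, ρ², ρ³) Ω U(x, ρ)` of quasi-derivatives, written in terms of the
amplitudes `U`. -/
def birkhoffVector (ω : Fin 4 → ℂ) (k : Fin 4) (U : Fin 4 → ℝ → ℂ → ℂ) (ρ : ℂ) (i : Fin 4)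
    (x : ℝ) : ℂ :=
  ρ ^ (i : ℕ) * (Complex.exp (ρ * ω k * (x : ℂ)) * ∑ l, ω l ^ (i : ℕ) * U l x ρ)

/-- The substitution `Y = e^{ρ ω_k x} diag(ρ^i) Ω U` diagonalizes the principal part of the system: the
superdiagonal and the spectral term give `ρ diag(ω)`, because `ω_l⁴ = 1`, the subdiagonal gets the
factor `ρ⁻¹` and the corner the factor `ρ⁻³`. -/
lemma isSystemSolution_birkhoffVector {ω : Fin 4 → ℂ} (hω4 : ∀ k, ω k ^ 4 = 1)
    (hinj : Function.Injective ω) (k : Fin 4) {τ₂ τ₁ r₀ : ℝ → ℂ} {U : Fin 4 → ℝ → ℂ → ℂ} {ρ : ℂ}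
    (hρ : ρ ≠ 0)
    (hU : ∀ l, ∀ x ∈ Icc (0 : ℝ) 1, HasDerivWithinAt (fun x => U l x ρ)
      (ρ * (ω l - ω k) * U l x ρ + ∑ j, (ρ⁻¹ * matrixA2 ω τ₂ τ₁ r₀ x l j +
        ρ⁻¹ ^ 3 * matrixB ω τ₁ r₀ x l j) * U j x ρ) (Icc 0 1) x) :
    IsSystemSolution (assocMatrix τ₂ τ₁ r₀) (ρ ^ 4) (birkhoffVector ω k U ρ) := by
  intro i x hx
  set e := Complex.exp (ρ * ω k * (x : ℂ)) with he
  have hexp : HasDerivWithinAt (fun x : ℝ => Complex.exp (ρ * ω k * (x : ℂ)))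
      (e * (ρ * ω k * (1 : ℝ))) (Icc 0 1) x := by
    refine HasDerivAt.hasDerivWithinAt (HasDerivAt.cexp ?_)
    exact (HasDerivAt.ofReal_comp (hasDerivAt_id x)).const_mul (ρ * ω k)
  have hsum := HasDerivWithinAt.fun_sum (u := Finset.univ)
    fun l _ => (hU l x hx).const_mul (ω l ^ (i : ℕ))
  have hmain := (hexp.fun_mul hsum).const_mul (ρ ^ (i : ℕ))
  convert! hmain using 1
  set S : ℕ → ℂ := fun m => ∑ l, ω l ^ m * U l x ρ with hS
  have h1 : ∑ l, ω l ^ (i : ℕ) * (ρ * (ω l - ω k) * U l x ρ +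
      ∑ j, (ρ⁻¹ * matrixA2 ω τ₂ τ₁ r₀ x l j + ρ⁻¹ ^ 3 * matrixB ω τ₁ r₀ x l j) * U j x ρ) =
      ρ * S (i + 1) - ρ * ω k * S i +
      (ρ⁻¹ * (∑ j, (subdiagMatrix τ₂ τ₁ r₀ x * omegaMatrix ω) i j * U j x ρ) +
        ρ⁻¹ ^ 3 * ∑ j, (cornerMatrix τ₁ r₀ x * omegaMatrix ω) i j * U j x ρ) := by
    simp only [← sum_omega_matrixA2 hω4 hinj, ← sum_omega_matrixB hω4 hinj, mul_add,
      Finset.sum_add_distrib, hS, Finset.mul_sum, Finset.sum_mul, add_mul,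
      ← Finset.sum_sub_distrib]
    refine congrArg₂ (· + ·) (Finset.sum_congr rfl fun l _ => by ring) (congrArg₂ (· + ·) ?_ ?_)
    · rw [Finset.sum_comm]
      exact Finset.sum_congr rfl fun j _ => Finset.sum_congr rfl fun l _ => by ring
    · rw [Finset.sum_comm]
      exact Finset.sum_congr rfl fun j _ => Finset.sum_congr rfl fun l _ => by ring
  have hY : ∀ j : Fin 4, birkhoffVector ω k U ρ j x = ρ ^ (j : ℕ) * (e * S j) := fun j => rfl
  have hS4 : S 4 = S 0 := by simp only [hS, hω4, pow_zero]
  have hgen : ∀ (M : Matrix (Fin 4) (Fin 4) ℂ) (i : Fin 4),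
      ∑ j, (M * omegaMatrix ω) i j * U j x ρ = ∑ m : Fin 4, M i m * S m := by
    intro M i
    simp only [Matrix.mul_apply, hS, Finset.sum_mul, Finset.mul_sum]
    rw [Finset.sum_comm]
    exact Finset.sum_congr rfl fun m _ => Finset.sum_congr rfl fun j _ => mul_assoc _ _ _
  rw [h1, hgen, hgen, ← he]
  simp only [hY]
  have hi : ∑ l, ω l ^ (i : ℕ) * U l x ρ = S i := rfl
  rw [hi]
  clear_value S e
  fin_cases i <;>
    simp [Fin.sum_univ_four, assocMatrix, subdiagMatrix, cornerMatrix]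
  · ring
  · field_simp
    ring
  · field_simp
    ring
  · rw [hS4]
    field_simp
    ring

/-! ### The fundamental system -/

lemma IsRootOrdering.injective {κ : ℕ} {ω : Fin 4 → ℂ} (hω : IsRootOrdering κ ω) :
    Function.Injective ω := by
  have hmem : ((1 : ℝ) : ℂ) * Complex.exp (Complex.I * ((Real.pi * ((κ : ℝ) - 1 / 2) / 4 : ℝ) : ℂ))
      ∈ sector κ := by
    refine ⟨1, _, one_pos, ?_, ?_, rfl⟩ <;> nlinarith [Real.pi_pos]
  intro l k hlk
  refine (hω.2 _ hmem).injective ?_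
  simp only [hlk]

lemma norm_root {ω : Fin 4 → ℂ} (hω4 : ∀ k, ω k ^ 4 = 1) (k : Fin 4) : ‖ω k‖ = 1 := by
  have h := congrArg norm (hω4 k)
  rw [norm_pow, norm_one] at h
  exact (pow_eq_one_iff_of_nonneg (norm_nonneg _) (by norm_num)).1 h

/-- Shifting a sector by `h` changes `Re (ρ (ω_l - ω_k))` by at most `2h`, so that the closure of the
extended sector lies in an open region where the exponentials are still ordered up to a factor. -/
lemma closure_extSector_subset {κ : ℕ} {ω : Fin 4 → ℂ} (hω : IsRootOrdering κ ω) {h : ℝ}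
    (hh : 0 < h) {R ρs : ℝ} (hR : R < ρs) :
    closure (extSector κ h ρs) ⊆ expRegion ω (2 * h + 1) R := by
  have hsub : extSector κ h ρs ⊆
      {ρ | ρs ≤ ‖ρ‖ ∧ ∀ l k, l < k → (ρ * (ω l - ω k)).re ≤ 2 * h} := by
    rintro ρ ⟨hρ, hρs⟩
    refine ⟨hρs.le, fun l k hlk => ?_⟩
    have h1 := hω.2 _ hρ hlk
    set e := Complex.exp (Complex.I * (Real.pi : ℂ) * ((κ : ℂ) - 1 / 2) / 4) with he
    have hen : ‖e‖ = 1 := by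
      have : e = Complex.exp (((Real.pi * ((κ : ℝ) - 1 / 2) / 4 : ℝ) : ℂ) * Complex.I) := by
        rw [he]
        congr 1
        push_cast
        ring
      rw [this, Complex.norm_exp_ofReal_mul_I]
    have h2 : (ρ * (ω l - ω k)).re =
        ((ρ + h * e) * ω l).re - ((ρ + h * e) * ω k).re + ((h : ℂ) * e * (ω k - ω l)).re := by
      rw [← Complex.sub_re, ← Complex.add_re]
      congr 1
      ring
    have h3 : ((h : ℂ) * e * (ω k - ω l)).re ≤ 2 * h := by
      refine (Complex.re_le_norm _).trans ?_
      rw [norm_mul, norm_mul, hen, Complex.norm_real, Real.norm_of_nonneg hh.le, mul_one]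
      have := norm_sub_le (ω k) (ω l)
      rw [norm_root hω.1, norm_root hω.1] at this
      nlinarith
    simp only at h1
    linarith
  have hclosed : IsClosed {ρ : ℂ | ρs ≤ ‖ρ‖ ∧ ∀ l k, l < k → (ρ * (ω l - ω k)).re ≤ 2 * h} := by
    have : {ρ : ℂ | ρs ≤ ‖ρ‖ ∧ ∀ l k, l < k → (ρ * (ω l - ω k)).re ≤ 2 * h} =
        {ρ | ρs ≤ ‖ρ‖} ∩ ⋂ l, ⋂ k, ⋂ (_ : l < k), {ρ : ℂ | (ρ * (ω l - ω k)).re ≤ 2 * h} := by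
      ext ρ
      simp
    rw [this]
    refine (isClosed_le continuous_const continuous_norm).inter ?_
    exact isClosed_iInter fun l => isClosed_iInter fun k => isClosed_iInter fun _ =>
      isClosed_le (by fun_prop) continuous_const
  intro ρ hρ
  obtain ⟨h1, h2⟩ := closure_minimal hsub hclosed hρ
  exact ⟨hR.trans_le h1, fun l k hlk => (h2 l k hlk).trans_lt (by linarith)⟩

lemma UnifO.sqSummableOn {Ω : Set ℂ} {f : ℝ → ℂ → ℂ} (hΩ : ∀ ρ ∈ Ω, 1 ≤ ‖ρ‖) (hf : UnifO Ω 3 f)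
    {x : ℝ} (hx : x ∈ Icc (0 : ℝ) 1) : SqSummableOn Ω fun ρ => ρ ^ 2 * f x ρ := by
  obtain ⟨C, -, h⟩ := hf
  refine SqSummableOn.of_le_inv hΩ (C := C) fun ρ hρ => ?_
  have h0 : ‖ρ‖ ≠ 0 := by linarith [hΩ ρ hρ]
  rw [norm_mul, norm_pow]
  refine (mul_le_mul_of_nonneg_left (h ρ hρ x hx) (by positivity)).trans_eq ?_
  rw [norm_inv]
  field_simp

/-- The leading off-diagonal terms: the base point is chosen so that the exponential is bounded. -/
lemma sqSummableOn_integral_basePoint {ω : Fin 4 → ℂ} {C R : ℝ} {k l : Fin 4}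
    (hlk : l ≠ k) (hd : ω l - ω k ≠ 0) {g : ℝ → ℂ} (hg : IsL2 g) {x : ℝ}
    (hx : x ∈ Icc (0 : ℝ) 1) :
    SqSummableOn (expRegion ω C R) fun ρ =>
      ∫ t in basePoint k l..x, Complex.exp (ρ * (ω l - ω k) * ((x - t : ℝ) : ℂ)) * g t := by
  unfold basePoint
  split_ifs with h
  · have hsub : Ioc 0 x ⊆ Icc 0 1 := fun t ht => ⟨ht.1.le, ht.2.trans hx.2⟩
    refine (SqSummableOn.integral_exp (Γ := expRegion ω C R) hd (C := C) (ε := 1) (x := x)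
      (E := Ioc 0 x) (u := g) abs_one measurableSet_Ioc (fun t ht => ?_) (fun ρ hρ => ?_)
      (hg.mono_measure (Measure.restrict_mono hsub le_rfl))).congr fun ρ _ => ?_
    · rw [abs_sub_comm, abs_of_nonneg (sub_nonneg.2 ht.2)]
      constructor <;> linarith [ht.1, hx.2]
    · rw [one_mul]
      exact (hρ.2 l k (h.lt_of_ne hlk)).le
    · rw [intervalIntegral.integral_of_le hx.1]
  · have hsub : Ioc x 1 ⊆ Icc 0 1 := fun t ht => ⟨hx.1.trans ht.1.le, ht.2⟩
    refine ((SqSummableOn.integral_exp (Γ := expRegion ω C R) hd (C := C) (ε := -1) (x := x)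
      (E := Ioc x 1) (u := g) (by simp) measurableSet_Ioc (fun t ht => ?_) (fun ρ hρ => ?_)
      (hg.mono_measure (Measure.restrict_mono hsub le_rfl))).const_mul (-1)).congr fun ρ _ => ?_
    · rw [abs_of_nonneg (sub_nonneg.2 ht.1.le)]
      constructor <;> linarith [ht.2, hx.1]
    · have h1 := (hρ.2 k l (not_le.1 h)).le
      have e : (ρ * (ω l - ω k)).re = -(ρ * (ω k - ω l)).re := by
        rw [← Complex.neg_re]; congr 1; ring
      rw [e]
      linarith
    · rw [intervalIntegral.integral_of_ge hx.2]
      ring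

/-- The remainder `Υ_{kj}(x, ρ)`, written in terms of the amplitudes `U`. -/
def amplitudeRemainder (ω : Fin 4 → ℂ) (τ₂ τ₁ r₀ : ℝ → ℂ) (k : Fin 4) (U : Fin 4 → ℝ → ℂ → ℂ)
    (j : Fin 4) (x : ℝ) (ρ : ℂ) : ℂ :=
  ρ ^ 2 * (∑ l, (ω l / ω k) ^ (j : ℕ) * U l x ρ -
    (1 - primOne τ₂ x / (4 * ρ * ω k) + primTwo τ₂ x / (4 * ρ * ω k) ^ 2
      - ∑ l ∈ Finset.univ.erase k, (ω l / ω k) ^ (j : ℕ) * (matrixA2 ω τ₂ τ₁ r₀ x l k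
          / (ρ ^ 2 * (ω l - ω k)))))

/-- The amplitudes `U` of the `k`-th solution: outside a large disk they solve the differential
system, are close to the `k`-th unit vector, and have a square-summable remainder. -/
lemma exists_amplitudes {ω : Fin 4 → ℂ} (hω4 : ∀ k, ω k ^ 4 = 1) (hinj : Function.Injective ω)
    {τ₂ τ₁ r₀ : ℝ → ℂ} (hτ₂ : IsW12 τ₂) (hτ₁ : IsL2 τ₁) (hr₀ : IsL2 r₀) {C : ℝ} (hC : 0 ≤ C)
    (k : Fin 4) :
    ∃ R, 1 ≤ R ∧ ∃ U : Fin 4 → ℝ → ℂ → ℂ,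
      (∀ l, ContinuousOn (fun p : ℝ × ℂ => U l p.1 p.2) (univ ×ˢ expRegion ω C R)) ∧
      (∀ l x, DifferentiableOn ℂ (U l x) (expRegion ω C R)) ∧
      (∀ ρ ∈ expRegion ω C R, ∀ l, ∀ x ∈ Icc (0 : ℝ) 1, HasDerivWithinAt (fun x => U l x ρ)
        (ρ * (ω l - ω k) * U l x ρ + ∑ j, (ρ⁻¹ * matrixA2 ω τ₂ τ₁ r₀ x l j +
          ρ⁻¹ ^ 3 * matrixB ω τ₁ r₀ x l j) * U j x ρ) (Icc 0 1) x) ∧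
      (∀ l, UnifO (expRegion ω C R) 1 fun x ρ => U l x ρ - if l = k then 1 else 0) ∧
      ∀ j, ∀ x ∈ Icc (0 : ℝ) 1,
        SqSummableOn (expRegion ω C R) (amplitudeRemainder ω τ₂ τ₁ r₀ k U j x) := by
  have hd : ∀ l, l ≠ k → ω l - ω k ≠ 0 := fun l hl => sub_ne_zero.2 (hinj.ne hl)
  have hk := root_ne_zero hω4 k
  set a : Fin 4 → Fin 4 → ℝ → ℂ := fun l j x => matrixA2 ω τ₂ τ₁ r₀ (clip x) l j with hadef
  set b : Fin 4 → Fin 4 → ℝ → ℂ := fun l j x => matrixB ω τ₁ r₀ (clip x) l j with hbdef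
  have ha : ∀ l j, Continuous (a l j) := fun l j =>
    ContinuousOn.comp_clip (isW12_matrixA2 hτ₂ hτ₁ hr₀ l j).continuousOn
  have hb : ∀ l j, Continuous (b l j) := fun l j =>
    ContinuousOn.comp_clip (continuousOn_matrixB hτ₁ hr₀ l j)
  choose g hg hag using fun l => isW12_matrixA2 (ω := ω) hτ₂ hτ₁ hr₀ l k
  have haI : ∀ l j, ∀ x ∈ Icc (0 : ℝ) 1, a l j x = matrixA2 ω τ₂ τ₁ r₀ x l j := by
    intro l j x hx
    simp only [hadef, clip_of_mem hx]
  have h0I : (0 : ℝ) ∈ Icc (0 : ℝ) 1 := ⟨le_rfl, zero_le_one⟩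
  obtain ⟨R, hR, U, hUc, hUd, hUB, hU⟩ := exists_isIntegralSolution ω k ha hb hC
  have hΩ : ∀ ρ ∈ expRegion ω C R, 1 ≤ ‖ρ‖ := fun ρ hρ => hR.trans hρ.1.le
  obtain ⟨hU2, hU3, hUk1, hUk3⟩ := hU.asymptotics hd hR hC ha hb hUc hUB
    (fun l => (hg l).intervalIntegrable) fun l _ x hx => by
      rw [haI l k x hx, haI l k 0 h0I]
      exact hag l x hx
  refine ⟨R, hR, U, hUc, hUd, fun ρ hρ l x hx => ?_, fun l => ?_, fun j x hx => ?_⟩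
  · have := hU.hasDerivWithinAt ha hb hUc hρ l hx
    simpa only [hadef, hbdef, clip_of_mem hx] using this
  · rcases eq_or_ne l k with rfl | hl
    · simpa using hUk1
    · simpa [hl] using (hU2 l hl).mono hΩ one_le_two
  · have hP : ∀ y ∈ Icc (0 : ℝ) 1, ∫ t in (0 : ℝ)..y, a k k t = -(primOne τ₂ y / (4 * ω k)) := by
      intro y hy
      rw [primOne, ← intervalIntegral.integral_div, ← intervalIntegral.integral_neg]
      refine intervalIntegral.integral_congr fun t ht => ?_
      rw [uIcc_of_le hy.1] at ht
      simp only [haI k k t ⟨ht.1, ht.2.trans hy.2⟩, matrixA2_diag hω4 hinj]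
    have hQ : ∫ t in (0 : ℝ)..x, a k k t * ∫ u in (0 : ℝ)..t, a k k u =
        primTwo τ₂ x / (4 * ω k) ^ 2 := by
      rw [primTwo, ← intervalIntegral.integral_div]
      refine intervalIntegral.integral_congr fun t ht => ?_
      rw [uIcc_of_le hx.1] at ht
      have htI : t ∈ Icc (0 : ℝ) 1 := ⟨ht.1, ht.2.trans hx.2⟩
      simp only [haI k k t htI, matrixA2_diag hω4 hinj, hP t htI]
      field_simp
    have hS1 := SqSummableOn.sum (Finset.univ.erase k) fun l hl =>
      (sqSummableOn_integral_basePoint (C := C) (R := R) (Finset.ne_of_mem_erase hl)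
        (hd l (Finset.ne_of_mem_erase hl)) (hg l) hx).const_mul
          ((ω l / ω k) ^ (j : ℕ) / (ω l - ω k))
    have hS2 := SqSummableOn.sum (Finset.univ.erase k) fun l hl =>
      ((hU3 l (Finset.ne_of_mem_erase hl)).sqSummableOn hΩ hx).const_mul ((ω l / ω k) ^ (j : ℕ))
    refine ((hS1.add hS2).add (hUk3.sqSummableOn hΩ hx)).congr fun ρ hρ => ?_
    have hρ0 : ρ ≠ 0 := norm_pos_iff.1 (by linarith [hΩ ρ hρ])
    rw [amplitudeRemainder, ← Finset.add_sum_erase _ _ (Finset.mem_univ k), div_self hk, one_pow,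
      one_mul, hP x hx, hQ, ← Finset.sum_add_distrib]
    have e : ∀ s t u v : ℂ, ρ ^ 2 * (u + s - (v - t)) = ρ ^ 2 * (s + t) + ρ ^ 2 * (u - v) := by
      intros; ring
    rw [e, ← Finset.sum_add_distrib, Finset.mul_sum]
    congr 1
    · refine Finset.sum_congr rfl fun l hl => ?_
      have := hd l (Finset.ne_of_mem_erase hl)
      rw [haI l k x hx]
      field_simp
      ring
    · field_simp
      ring

/-- A matrix that is entrywise `1/8`-close to the identity has trivial kernel. -/
lemma eq_zero_of_near_one {M : Fin 4 → Fin 4 → ℂ}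
    (hM : ∀ l k, ‖M l k - if l = k then 1 else 0‖ ≤ 1 / 8) {c : Fin 4 → ℂ}
    (hc : ∀ l, ∑ k, M l k * c k = 0) : c = 0 := by
  have h1 : ∀ l, ‖c l‖ ≤ 1 / 2 * ‖c‖ := by
    intro l
    have e : c l = -∑ k, (M l k - if l = k then 1 else 0) * c k := by
      simp only [sub_mul, Finset.sum_sub_distrib, hc l, ite_mul, one_mul, zero_mul,
        Finset.sum_ite_eq, Finset.mem_univ, if_true]
      ring
    rw [e, norm_neg]
    refine (norm_sum_le _ _).trans ?_
    refine (Finset.sum_le_sum fun k _ => (norm_mul_le _ _).trans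
      (mul_le_mul (hM l k) (norm_le_pi_norm c k) (norm_nonneg _) (by norm_num))).trans_eq ?_
    simp only [Finset.sum_const, Finset.card_univ, Fintype.card_fin, nsmul_eq_mul]
    push_cast
    ring
  have h2 : ‖c‖ ≤ 1 / 2 * ‖c‖ := (pi_norm_le_iff_of_nonneg (by positivity)).2 h1
  exact norm_le_zero_iff.1 (by linarith)

/-- The initial vectors are independent where the matrix of the amplitudes is near the identity. -/
lemma birkhoffVector_independent {ω : Fin 4 → ℂ} (hω4 : ∀ k, ω k ^ 4 = 1)
    (hinj : Function.Injective ω) {U : Fin 4 → Fin 4 → ℝ → ℂ → ℂ} {ρ : ℂ} (hρ : ρ ≠ 0)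
    (hU : ∀ k l, ‖U k l 0 ρ - if l = k then 1 else 0‖ ≤ 1 / 8) {c : Fin 4 → ℂ}
    (hc : ∀ i, ∑ k, c k * birkhoffVector ω k (U k) ρ i 0 = 0) : c = 0 := by
  refine eq_zero_of_near_one (M := fun l k => U k l 0 ρ) (fun l k => hU k l) fun l => ?_
  set v : Fin 4 → ℂ := fun l => ∑ k, U k l 0 ρ * c k with hv
  have h1 : (omegaMatrix ω).mulVec v = 0 := by
    ext i
    have h2 : ρ ^ (i : ℕ) * (omegaMatrix ω).mulVec v i = 0 := by
      rw [← hc i]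
      simp only [Matrix.mulVec, dotProduct, hv, omegaMatrix, Matrix.of_apply, birkhoffVector,
        Finset.mul_sum, Complex.ofReal_zero, mul_zero, Complex.exp_zero, one_mul]
      rw [Finset.sum_comm]
      exact Finset.sum_congr rfl fun k _ => Finset.sum_congr rfl fun l _ => by ring
    exact (mul_eq_zero.1 h2).resolve_left (pow_ne_zero _ hρ)
  have h3 : v = 0 := by
    have := congrArg (omegaMatrix ω)⁻¹.mulVec h1
    rwa [Matrix.mulVec_mulVec, (omegaMatrix_inv hω4 hinj).2.2, Matrix.one_mulVec,
      Matrix.mulVec_zero] at this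
  exact congrFun h3 l

end FourthOrder

theorem theorem1 (τ₂ τ₁ r₀ : ℝ → ℂ)
    (hτ₂ : FourthOrder.IsW12 τ₂) (hτ₁ : FourthOrder.IsL2 τ₁) (hr₀ : FourthOrder.IsL2 r₀)
    (κ : ℕ) (hκ : κ ∈ Set.Icc 1 8)
    (ω : Fin 4 → ℂ) (hω : FourthOrder.IsRootOrdering κ ω)
    (h : ℝ) (hh : 0 < h) :
    ∃ ρs : ℝ, 0 < ρs ∧ ∃ y : Fin 4 → ℂ → ℝ → ℂ,
      (∀ ρ ∈ closure (FourthOrder.extSector κ h ρs),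
        FourthOrder.IsFundamentalSystem (FourthOrder.assocMatrix τ₂ τ₁ r₀) (ρ ^ 4)
          (fun k => y k ρ)) ∧
      (∀ k j : Fin 4,
        ContinuousOn
          (fun p : ℝ × ℂ =>
            FourthOrder.quasiDeriv (FourthOrder.assocMatrix τ₂ τ₁ r₀) (y k p.2) j p.1)
          (Set.Icc 0 1 ×ˢ closure (FourthOrder.extSector κ h ρs))) ∧
      (∀ k j : Fin 4, ∀ x ∈ Set.Icc (0 : ℝ) 1,
        AnalyticOnNhd ℂ
          (fun ρ => FourthOrder.quasiDeriv (FourthOrder.assocMatrix τ₂ τ₁ r₀) (y k ρ) j x)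
          (FourthOrder.extSector κ h ρs)) ∧
      ∃ Υ : Fin 4 → Fin 4 → ℝ → ℂ → ℂ,
        (∀ k j : Fin 4, ∀ x ∈ Set.Icc (0 : ℝ) 1,
          FourthOrder.IsUpsilon (FourthOrder.extSector κ h ρs) (Υ k j x)) ∧
        ∀ k j : Fin 4, ∀ x ∈ Set.Icc (0 : ℝ) 1,
          ∀ ρ ∈ closure (FourthOrder.extSector κ h ρs),
            FourthOrder.quasiDeriv (FourthOrder.assocMatrix τ₂ τ₁ r₀) (y k ρ) j x =
              (ρ * ω k) ^ (j : ℕ) * Complex.exp (ρ * ω k * (x : ℂ)) *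
                (1 - FourthOrder.primOne τ₂ x / (4 * ρ * ω k)
                  + FourthOrder.primTwo τ₂ x / (4 * ρ * ω k) ^ 2
                  - ∑ l ∈ Finset.univ.erase k,
                      (ω l / ω k) ^ (j : ℕ) * (FourthOrder.matrixA2 ω τ₂ τ₁ r₀ x l k
                        / (ρ ^ 2 * (ω l - ω k)))
                  + Υ k j x ρ / ρ ^ 2) := by
  have hω4 := hω.1
  have hinj := hω.injective
  choose R hR U hUc hUd hUode hU1 hUS using FourthOrder.exists_amplitudes hω4 hinj hτ₂ hτ₁ hr₀
    (show (0 : ℝ) ≤ 2 * h + 1 by linarith)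
  choose D hD0 hD using hU1
  -- the second sum makes the amplitudes `1/8`-close to the unit vectors, so that they are independent
  set R₀ : ℝ := ∑ k, R k + 8 * ∑ k, ∑ l, D k l with hR₀
  have hDsum : ∀ k, 0 ≤ ∑ l, D k l := fun k => Finset.sum_nonneg fun l _ => hD0 k l
  have hRk : ∀ k, R k ≤ R₀ := fun k => by
    have h1 := Finset.single_le_sum (f := R) (fun i _ => zero_le_one.trans (hR i))
      (Finset.mem_univ k)
    have h2 : 0 ≤ ∑ k, ∑ l, D k l := Finset.sum_nonneg fun k _ => hDsum k
    linarith
  have hDk : ∀ k l, 8 * D k l ≤ R₀ := fun k l => by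
    have h1 := Finset.single_le_sum (f := D k) (fun i _ => hD0 k i) (Finset.mem_univ l)
    have h2 := Finset.single_le_sum (f := fun k => ∑ l, D k l) (fun i _ => hDsum i)
      (Finset.mem_univ k)
    have h3 : 0 ≤ ∑ k, R k := Finset.sum_nonneg fun k _ => zero_le_one.trans (hR k)
    linarith
  have hR₀1 : 1 ≤ R₀ := (hR 0).trans (hRk 0)
  set Ω := FourthOrder.expRegion ω (2 * h + 1) R₀ with hΩ
  have hsub : closure (FourthOrder.extSector κ h (R₀ + 1)) ⊆ Ω :=
    FourthOrder.closure_extSector_subset hω hh (lt_add_one R₀)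
  have hΩk : ∀ k, Ω ⊆ FourthOrder.expRegion ω (2 * h + 1) (R k) := fun k =>
    FourthOrder.expRegion_mono ω _ (hRk k)
  have hne : ∀ ρ ∈ Ω, ρ ≠ 0 := fun ρ hρ => norm_pos_iff.1 (by linarith [hρ.1])
  have hsys : ∀ ρ ∈ Ω, ∀ k, FourthOrder.IsSystemSolution (FourthOrder.assocMatrix τ₂ τ₁ r₀) (ρ ^ 4)
      (FourthOrder.birkhoffVector ω k (U k) ρ) := fun ρ hρ k =>
    FourthOrder.isSystemSolution_birkhoffVector hω4 hinj k (hne ρ hρ) (hUode k ρ (hΩk k hρ))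
  have hq : ∀ ρ ∈ Ω, ∀ k j : Fin 4, ∀ x ∈ Icc (0 : ℝ) 1,
      FourthOrder.quasiDeriv (FourthOrder.assocMatrix τ₂ τ₁ r₀)
        (FourthOrder.birkhoffVector ω k (U k) ρ 0) j x =
      FourthOrder.birkhoffVector ω k (U k) ρ j x := fun ρ hρ k j x hx =>
    (hsys ρ hρ k).quasiDeriv_eq.1 j x hx
  refine ⟨R₀ + 1, by linarith, fun k ρ => FourthOrder.birkhoffVector ω k (U k) ρ 0,
    fun ρ hρ => ?_, fun k j => ?_, fun k j x hx => ?_,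
    fun k j => FourthOrder.amplitudeRemainder ω τ₂ τ₁ r₀ k (U k) j, fun k j x hx => ?_,
    fun k j x hx ρ hρ => ?_⟩
  · have hρΩ := hsub hρ
    refine FourthOrder.isFundamentalSystem_of_independent hτ₂ hτ₁ hr₀ (hsys ρ hρΩ) fun c hc =>
      FourthOrder.birkhoffVector_independent hω4 hinj (hne ρ hρΩ) (fun k l => ?_) hc
    refine (hD k l ρ (hΩk k hρΩ) 0 ⟨le_rfl, zero_le_one⟩).trans ?_
    have hpos : 0 < ‖ρ‖ := by linarith [hρΩ.1]
    rw [pow_one, norm_inv, ← div_eq_mul_inv, div_le_iff₀ hpos]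
    linarith [hDk k l, hρΩ.1]
  · refine ContinuousOn.congr (f := fun p : ℝ × ℂ =>
      FourthOrder.birkhoffVector ω k (U k) p.2 j p.1) ?_
      fun p hp => hq p.2 (hsub hp.2) k j p.1 hp.1
    have h1 : ∀ l, ContinuousOn (fun p : ℝ × ℂ => U k l p.1 p.2)
        (Icc 0 1 ×ˢ closure (FourthOrder.extSector κ h (R₀ + 1))) := fun l =>
      (hUc k l).mono (prod_mono (subset_univ _) (hsub.trans (hΩk k)))
    unfold FourthOrder.birkhoffVector
    fun_prop
  · intro ρ hρ
    have hopen := FourthOrder.isOpen_expRegion ω (2 * h + 1) R₀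
    have hmem : Ω ∈ 𝓝 ρ := hopen.mem_nhds (hsub (subset_closure hρ))
    have h1 : DifferentiableOn ℂ (fun ρ => FourthOrder.birkhoffVector ω k (U k) ρ j x) Ω := by
      have h2 : ∀ l, DifferentiableOn ℂ (U k l x) Ω := fun l => (hUd k l x).mono (hΩk k)
      unfold FourthOrder.birkhoffVector
      fun_prop
    refine (h1.analyticAt hmem).congr ?_
    filter_upwards [hmem] with ρ' hρ'
    exact (hq ρ' hρ' k j x hx).symm
  · exact FourthOrder.SqSummableOn.isUpsilon (hUS k j x hx) (hsub.trans (hΩk k))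
  · have hρ0 := hne ρ (hsub hρ)
    have hk := FourthOrder.root_ne_zero hω4 k
    beta_reduce
    rw [hq ρ (hsub hρ) k j x hx, FourthOrder.amplitudeRemainder,
      mul_div_cancel_left₀ _ (pow_ne_zero 2 hρ0), add_sub_cancel, FourthOrder.birkhoffVector,
      mul_pow]
    simp only [Finset.mul_sum, div_pow]
    refine Finset.sum_congr rfl fun l _ => ?_
    field_simp

end
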